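/- **Setting.** Let $d\ge 1$ and let $\Omega\subset\mathbb R^d$ be a bounded Lipschitz domain. Let $\mathcal T$ be a finite conforming simplicial triangulation of $\Omega$ (its closed $d$-simplices, the elements, fill $\overline\Omega$). It is called shape regular with constant $\sigma$ if every element $\tau$ contains a ball of some radius $r>0$ with $\operatorname{diam}\tau\le\sigma r$ and, when $d=1$ (where the ball condition carries no information), $\operatorname{diam}\tau\le\sigma\operatorname{diam}\tau'$ for all elements $\tau,\tau'$ that share a vertex. Let $V=\mathbb V(\mathcal T)$ be the space of continuous functions on $\overline\Omega$ that are affine on each element and vanish on $\partial\Omega$, extended by zero to $\mathbb R^d$. Write $\|\cdot\|_0=\|\cdot\|_{L^2(\Omega)}$, $|v|_1=\|\nabla v\|_{L^2(\mathbb R^d)}$ and, for $s\in(0,1)$, $$|v|_s^2=\frac{C(d,s)}2\iint_{\mathbb R^d\times\mathbb R^d}\frac{|v(x)-v(y)|^2}{|x-y|^{d+2s}}\,dx\,dy,\qquad C(d,s)=\frac{2^{2s}s\,\Gamma(s+\frac d2)}{\pi^{d/2}\,\Gamma(1-s)} .$$ For subspaces $V_0,\dots,V_J$ of $V$ let $Q_j:V\to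 V_j$ be the $L^2(\Omega)$-orthogonal projection, and $Q_{-1}:=0$. **Lemma ($s$-uniform interpolation).** Let $d$, $\Omega$, $\sigma$ be as above, $\gamma\in(0,1)$ and $C_1>0$. There is a constant $C>0$, depending only on $d,\Omega,\sigma,\gamma,C_1$ (in particular not on $s$, $J$, the triangulation or the spaces $V_j$), such that the following holds for every triangulation $\mathcal T$ of $\Omega$ that is shape regular with constant $\sigma$, every $J\in\mathbb N_0$ and all nested subspaces $V_0\subset V_1\subset\dots\subset V_J$ of $V=\mathbb V(\mathcal T)$ with $V=\sum_{j=0}^J V_j$. If $$\sum_{j=0}^J\gamma^{-2j}\|(Q_j-Q_{j-1})v\|_0^2\le C_1|v|_1^2\qquad\forall v\in V,$$ then $$\sum_{j=0}^J\gamma^{-2sj}\|(Q_j-Q_{j-1})v\|_0^2\le C\,|v|_s^2\qquad\forall v\in V,\ \forall s\in(0,1).$$ -/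

import Mathlib

open MeasureTheory

noncomputable section

/-- `Ω ⊆ ℝᵈ` is a bounded Lipschitz domain: a bounded, connected, nonempty open set which, near
each of its boundary points and in suitable Cartesian coordinates (the unit vector `ν` being the
last coordinate direction), is the set of points lying strictly above the graph of a Lipschitz
function. The function `φ` is only ever evaluated on the hyperplane orthogonal to `ν`. -/
structure IsBoundedLipschitzDomain {d : ℕ} (Ω : Set (EuclideanSpace ℝ (Fin d))) : Prop where
  isOpen : IsOpen Ω
  isConnected : IsConnected Ω
  isBounded : Bornology.IsBounded Ω
  lipschitz_boundary : ∀ p ∈ frontier Ω,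
    ∃ (U : Set (EuclideanSpace ℝ (Fin d))) (ν : EuclideanSpace ℝ (Fin d))
      (L : NNReal) (φ : EuclideanSpace ℝ (Fin d) → ℝ),
      IsOpen U ∧ p ∈ U ∧ ‖ν‖ = 1 ∧ LipschitzWith L φ ∧
        ∀ x ∈ U, (x ∈ Ω ↔ φ (x - inner ℝ ν x • ν) < inner ℝ ν x)

/-- The simplicial complex `T` is a (finite, conforming) triangulation of `Ω`: its simplices fill
the closure of `Ω` and each of them is a face of a `d`-dimensional simplex of `T`. Conformity (two
simplices meet in a common face or not at all) is part of Mathlib's `SimplicialComplex`. -/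
structure IsTriangulation {d : ℕ} (Ω : Set (EuclideanSpace ℝ (Fin d)))
    (T : Geometry.SimplicialComplex ℝ (EuclideanSpace ℝ (Fin d))) : Prop where
  finite_faces : T.faces.Finite
  space_eq : T.space = closure Ω
  pure : ∀ s ∈ T.faces, ∃ t ∈ T.faces, s ⊆ t ∧ t.card = d + 1

/-- The elements of `T`: (vertex sets of) the `d`-dimensional simplices. -/
def meshElements {d : ℕ} (T : Geometry.SimplicialComplex ℝ (EuclideanSpace ℝ (Fin d))) :
    Set (Finset (EuclideanSpace ℝ (Fin d))) :=
  {t ∈ T.faces | t.card = d + 1}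

/-- `T` is shape regular with constant `σ`: every element contains a ball whose radius `r`
satisfies `diam τ ≤ σ r`. In dimension one every interval satisfies such a bound, and shape
regularity has its usual meaning there: elements sharing a vertex have comparable lengths. (For
`d ≥ 2` comparability of the sizes of adjacent elements is a consequence of the ball condition.) -/
structure IsShapeRegular {d : ℕ} (σ : ℝ)
    (T : Geometry.SimplicialComplex ℝ (EuclideanSpace ℝ (Fin d))) : Prop where
  exists_ball : ∀ t ∈ meshElements T, ∃ (c : EuclideanSpace ℝ (Fin d)) (r : ℝ), 0 < r ∧
    Metric.closedBall c r ⊆ convexHull ℝ (t : Set (EuclideanSpace ℝ (Fin d))) ∧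
    Metric.diam (convexHull ℝ (t : Set (EuclideanSpace ℝ (Fin d)))) ≤ σ * r
  comparable_of_dim_one : d = 1 → ∀ t ∈ meshElements T, ∀ t' ∈ meshElements T,
    (∃ p, p ∈ t ∧ p ∈ t') →
    Metric.diam (convexHull ℝ (t : Set (EuclideanSpace ℝ (Fin d)))) ≤
      σ * Metric.diam (convexHull ℝ (t' : Set (EuclideanSpace ℝ (Fin d))))

/-- The finite element space `𝕍(T)`: continuous functions that are affine on each element and
vanish on the boundary, extended by zero to the complement of `Ω`. -/
def feSpace {d : ℕ} (Ω : Set (EuclideanSpace ℝ (Fin d)))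
    (T : Geometry.SimplicialComplex ℝ (EuclideanSpace ℝ (Fin d))) :
    Submodule ℝ (EuclideanSpace ℝ (Fin d) → ℝ) where
  carrier := {v | Continuous v ∧ (∀ x ∉ Ω, v x = 0) ∧
    ∀ t ∈ meshElements T, ∃ a : EuclideanSpace ℝ (Fin d) →ᵃ[ℝ] ℝ,
      ∀ x ∈ convexHull ℝ (t : Set (EuclideanSpace ℝ (Fin d))), v x = a x}
  zero_mem' := ⟨continuous_const, fun _ _ => rfl, fun _ _ => ⟨0, fun _ _ => rfl⟩⟩
  add_mem' := by
    rintro v w ⟨hv, hv0, hva⟩ ⟨hw, hw0, hwa⟩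
    refine ⟨hv.add hw, fun x hx => by simp [hv0 x hx, hw0 x hx], fun t ht => ?_⟩
    obtain ⟨a, ha⟩ := hva t ht
    obtain ⟨b, hb⟩ := hwa t ht
    exact ⟨a + b, fun x hx => by simp [ha x hx, hb x hx]⟩
  smul_mem' := by
    rintro c v ⟨hv, hv0, hva⟩
    refine ⟨hv.const_smul c, fun x hx => by simp [hv0 x hx], fun t ht => ?_⟩
    obtain ⟨a, ha⟩ := hva t ht
    exact ⟨c • a, fun x hx => by simp [ha x hx]⟩

/-- The `L²(Ω)` inner product `(u, v)`. -/
def l2Inner {d : ℕ} (Ω : Set (EuclideanSpace ℝ (Fin d)))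
    (u v : EuclideanSpace ℝ (Fin d) → ℝ) : ℝ :=
  ∫ x in Ω, u x * v x

/-- The `L²(Ω)` norm `‖v‖₀`. -/
def l2Norm {d : ℕ} (Ω : Set (EuclideanSpace ℝ (Fin d)))
    (v : EuclideanSpace ℝ (Fin d) → ℝ) : ℝ :=
  √(l2Inner Ω v v)

/-- `w` is the `L²(Ω)`-projection of `v` onto `W`: `w ∈ W` and `(w, z) = (v, z)` for `z ∈ W`. -/
def IsL2Projection {d : ℕ} (Ω : Set (EuclideanSpace ℝ (Fin d)))
    (W : Submodule ℝ (EuclideanSpace ℝ (Fin d) → ℝ))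
    (v w : EuclideanSpace ℝ (Fin d) → ℝ) : Prop :=
  w ∈ W ∧ ∀ z ∈ W, l2Inner Ω w z = l2Inner Ω v z

open Classical in
/-- The `L²(Ω)`-projection of `v` onto `W`; see `isL2Projection_l2Proj` and
`IsL2Projection.eq_l2Proj` for its existence and uniqueness in finite element spaces. -/
def l2Proj {d : ℕ} (Ω : Set (EuclideanSpace ℝ (Fin d)))
    (W : Submodule ℝ (EuclideanSpace ℝ (Fin d) → ℝ))
    (v : EuclideanSpace ℝ (Fin d) → ℝ) : EuclideanSpace ℝ (Fin d) → ℝ :=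
  if h : ∃ w, IsL2Projection Ω W v w then h.choose else 0

/-- The `L²`-slices `(Q_j - Q_{j-1}) v`, where `Q_j` is the `L²(Ω)`-projection onto `V j` and
`Q_{-1} = 0`. -/
def l2Slice {d : ℕ} (Ω : Set (EuclideanSpace ℝ (Fin d)))
    (V : ℕ → Submodule ℝ (EuclideanSpace ℝ (Fin d) → ℝ))
    (v : EuclideanSpace ℝ (Fin d) → ℝ) : ℕ → EuclideanSpace ℝ (Fin d) → ℝ
  | 0 => l2Proj Ω (V 0) v
  | j + 1 => l2Proj Ω (V (j + 1)) v - l2Proj Ω (V j) v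

/-- The seminorm `|v|_1 = ‖∇v‖_{L²(ℝᵈ)}`. The functions it is applied to are continuous and
piecewise affine with compact support, so the classical gradient, defined almost everywhere, is
the weak gradient. -/
def h1Seminorm {d : ℕ} (v : EuclideanSpace ℝ (Fin d) → ℝ) : ℝ :=
  √(∫ x, ‖gradient v x‖ ^ 2)

/-- The constant `C(d, s) = 2^{2s} s Γ(s + d/2) / (π^{d/2} Γ(1 - s))` of the integral fractional
Laplacian. -/
def fracLaplaceConst (d : ℕ) (s : ℝ) : ℝ :=
  (2 : ℝ) ^ (2 * s) * s * Real.Gamma (s + d / 2) /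
    (Real.pi ^ ((d : ℝ) / 2) * Real.Gamma (1 - s))

/-- The bilinear form `(u, v)_s`, `0 < s < 1`, of the integral fractional Laplacian. -/
def fracForm {d : ℕ} (s : ℝ) (u v : EuclideanSpace ℝ (Fin d) → ℝ) : ℝ :=
  fracLaplaceConst d s / 2 *
    ∫ p : EuclideanSpace ℝ (Fin d) × EuclideanSpace ℝ (Fin d),
      (u p.1 - u p.2) * (v p.1 - v p.2) / ‖p.1 - p.2‖ ^ ((d : ℝ) + 2 * s)

/-- The fractional norm `|v|_s = (v, v)_s^{1/2}`, `0 < s < 1`. -/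
def fracSeminorm {d : ℕ} (s : ℝ) (v : EuclideanSpace ℝ (Fin d) → ℝ) : ℝ :=
  √(fracForm s v v)

section Projection

variable {d : ℕ} {Ω : Set (EuclideanSpace ℝ (Fin d))}
  {T : Geometry.SimplicialComplex ℝ (EuclideanSpace ℝ (Fin d))}

theorem feSpace_finiteDimensional (hT : IsTriangulation Ω T) :
    FiniteDimensional ℝ (feSpace Ω T) := by
  classical
  let F : Finset (EuclideanSpace ℝ (Fin d)) := hT.finite_faces.toFinset.biUnion id
  let ev : feSpace Ω T →ₗ[ℝ] (F → ℝ) :=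
    { toFun := fun v p => v.1 p.1
      map_add' := fun _ _ => rfl
      map_smul' := fun _ _ => rfl }
  refine FiniteDimensional.of_injective ev ((injective_iff_map_eq_zero ev).2 fun v hv => ?_)
  have hF : ∀ p ∈ F, v.1 p = 0 := fun p hp => congrFun hv ⟨p, hp⟩
  obtain ⟨-, hv0, hva⟩ := v.2
  refine Subtype.ext (funext fun x => ?_)
  change v.1 x = 0
  by_cases hx : x ∈ Ω
  · have hx' : x ∈ T.space := by rw [hT.space_eq]; exact subset_closure hx
    obtain ⟨s, hs, hxs⟩ := Geometry.SimplicialComplex.mem_space_iff.1 hx'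
    obtain ⟨t, ht, hst, hcard⟩ := hT.pure s hs
    obtain ⟨a, ha⟩ := hva t ⟨ht, hcard⟩
    have hxt := convexHull_mono (𝕜 := ℝ) (Finset.coe_subset.2 hst) hxs
    have hsub : convexHull ℝ (t : Set (EuclideanSpace ℝ (Fin d))) ⊆ a ⁻¹' {0} := by
      refine convexHull_min (fun p hp => ?_) ((convex_singleton (0 : ℝ)).affine_preimage a)
      have hpF : p ∈ F :=
        Finset.mem_biUnion.2 ⟨t, hT.finite_faces.mem_toFinset.2 ht, Finset.mem_coe.1 hp⟩
      have h := hF p hpF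
      rw [Set.mem_preimage, Set.mem_singleton_iff, ← ha p (subset_convexHull ℝ _ hp), h]
    rw [ha x hxt]
    exact hsub hxt
  · exact hv0 x hx

theorem feSpace_hasCompactSupport (hΩ : IsBoundedLipschitzDomain Ω)
    {v : EuclideanSpace ℝ (Fin d) → ℝ} (hv : v ∈ feSpace Ω T) : HasCompactSupport v :=
  HasCompactSupport.intro hΩ.isBounded.isCompact_closure
    fun x hx => hv.2.1 x fun h => hx (subset_closure h)

theorem feSpace_memLp (hΩ : IsBoundedLipschitzDomain Ω)
    {v : EuclideanSpace ℝ (Fin d) → ℝ} (hv : v ∈ feSpace Ω T) :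
    MemLp v 2 (volume.restrict Ω) :=
  (hv.1.memLp_of_hasCompactSupport (feSpace_hasCompactSupport hΩ hv)).restrict Ω

theorem l2Inner_eq_inner {u v : EuclideanSpace ℝ (Fin d) → ℝ}
    (hu : MemLp u 2 (volume.restrict Ω)) (hv : MemLp v 2 (volume.restrict Ω)) :
    l2Inner Ω u v = inner ℝ (hu.toLp u) (hv.toLp v) := by
  rw [L2.inner_def]
  refine integral_congr_ae ?_
  filter_upwards [hu.coeFn_toLp, hv.coeFn_toLp] with x h1 h2
  rw [h1, h2]
  simp [mul_comm]

/-- Existence of the `L²(Ω)`-projection onto a subspace of the finite element space. -/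
theorem isL2Projection_l2Proj (hΩ : IsBoundedLipschitzDomain Ω) (hT : IsTriangulation Ω T)
    {W : Submodule ℝ (EuclideanSpace ℝ (Fin d) → ℝ)} (hW : W ≤ feSpace Ω T)
    {v : EuclideanSpace ℝ (Fin d) → ℝ} (hv : v ∈ feSpace Ω T) :
    IsL2Projection Ω W v (l2Proj Ω W v) := by
  have hex : ∃ w, IsL2Projection Ω W v w := by
    have := feSpace_finiteDimensional hT
    have : FiniteDimensional ℝ W :=
      FiniteDimensional.of_injective (Submodule.inclusion hW) (Submodule.inclusion_injective hW)
    let ι : W →ₗ[ℝ] Lp ℝ 2 (volume.restrict Ω) :=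
      { toFun := fun w => (feSpace_memLp hΩ (hW w.2)).toLp w.1
        map_add' := fun _ _ => rfl
        map_smul' := fun _ _ => rfl }
    let v' := (feSpace_memLp hΩ hv).toLp v
    obtain ⟨w, hw⟩ : (LinearMap.range ι).starProjection v' ∈ LinearMap.range ι :=
      Submodule.starProjection_apply_mem _ _
    refine ⟨w.1, w.2, fun z hz => ?_⟩
    rw [l2Inner_eq_inner (feSpace_memLp hΩ (hW w.2)) (feSpace_memLp hΩ (hW hz)),
      l2Inner_eq_inner (feSpace_memLp hΩ hv) (feSpace_memLp hΩ (hW hz))]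
    have h := Submodule.starProjection_inner_eq_zero (K := LinearMap.range ι) v' (ι ⟨z, hz⟩)
      ⟨_, rfl⟩
    rw [← hw, inner_sub_left, sub_eq_zero] at h
    exact h.symm
  rw [l2Proj, dif_pos hex]
  exact hex.choose_spec

/-- Uniqueness of the `L²(Ω)`-projection onto a subspace of the finite element space. -/
theorem IsL2Projection.eq_l2Proj (hΩ : IsBoundedLipschitzDomain Ω) (hT : IsTriangulation Ω T)
    {W : Submodule ℝ (EuclideanSpace ℝ (Fin d) → ℝ)} (hW : W ≤ feSpace Ω T)
    {v w : EuclideanSpace ℝ (Fin d) → ℝ} (hv : v ∈ feSpace Ω T)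
    (hw : IsL2Projection Ω W v w) : w = l2Proj Ω W v := by
  have hp := isL2Projection_l2Proj hΩ hT hW hv
  set q := l2Proj Ω W v
  have hu : w - q ∈ feSpace Ω T := hW (W.sub_mem hw.1 hp.1)
  have mw := feSpace_memLp hΩ (hW hw.1)
  have mq := feSpace_memLp hΩ (hW hp.1)
  have mu := feSpace_memLp hΩ hu
  have h0 : inner ℝ (mu.toLp (w - q)) (mu.toLp (w - q)) = 0 := by
    have e : mu.toLp (w - q) = mw.toLp w - mq.toLp q := rfl
    have h1 := (hw.2 _ (W.sub_mem hw.1 hp.1)).trans (hp.2 _ (W.sub_mem hw.1 hp.1)).symm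
    rw [l2Inner_eq_inner mw mu, l2Inner_eq_inner mq mu] at h1
    conv_lhs => arg 2; rw [e]
    rw [inner_sub_left, h1, sub_self]
  have hae : (w - q) =ᵐ[volume.restrict Ω] 0 := by
    have h2 := inner_self_eq_zero.1 h0
    exact mu.coeFn_toLp.symm.trans ((Lp.eq_zero_iff_ae_eq_zero).1 h2)
  have hon : Set.EqOn (w - q) 0 Ω :=
    Measure.eqOn_open_of_ae_eq hae hΩ.isOpen hu.1.continuousOn continuousOn_const
  refine sub_eq_zero.1 (funext fun x => ?_)
  by_cases hx : x ∈ Ω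
  · exact hon hx
  · exact hu.2.1 x hx

end Projection

end

/-! The theorem is real interpolation by a K-functional, with every dependence on s kept explicit.
Fix a scale t > 0 and suppose that some w in the finite element space satisfies ‖v − w‖₀² + t²|w|₁²
≤ K(t). The slices of v are the sums of those of v − w and of w. The former are square-summable with
weight 1 by orthogonality, the latter with weight γ^(-2j) by the hypothesis. Hence Σ_j min(1, t²
γ^(-2j)) ‖(Q_j − Q_{j-1})v‖₀² is bounded by a multiple of K(t). Multiplying by t^(-1-2s) and
integrating over all t turns the weight into γ^(-2sj) / (2s(1 − s)) (`lintegral_min_rpow`).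

The choice K(t) = A t^(-d) ∫ `localOsc v t` makes the right-hand side, by Tonelli, exactly a
multiple 4^q/q of the Gagliardo double integral with q = d + 2s (`lintegral_localOsc`). Since C(d,s)
≥ c s(1 − s) (`exists_le_fracLaplaceConst`), the degenerating factors s(1 − s) cancel and the
constant is uniform in s.

The substance is `exists_discrete_approximation`: the competitor w has to lie in the finite element
space of the given mesh, with constants depending only on shape regularity and Ω, although the mesh
may be finer than t in one place and coarser in another. It interpolates nodal values: at a vertex
of some element of diameter at least t the value of v is kept, and at all other vertices an average
of v over radius t, cut off near the boundary, is used. The cut-off is harmless because v vanishes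
on exterior balls of size comparable to t (`IsBoundedLipschitzDomain.exists_exterior_ball`).
Elements carrying a kept value must have size at least a multiple of t, which is the comparability
of elements sharing a vertex (`IsShapeRegular.diam_le_of_vertex`). For d ≥ 2 this is derived from
the ball condition by joining the elements at a vertex through shared edges, using that a Lipschitz
domain stays connected near a point after the point is removed. -/

noncomputable section

/-! ### Exterior balls of bounded Lipschitz domains. -/

section Domain

variable {d : ℕ} {Ω : Set (EuclideanSpace ℝ (Fin d))}

theorem norm_sub_inner_smul_le {E : Type*} [NormedAddCommGroup E] [InnerProductSpace ℝ E]
    {ν : E} (hν : ‖ν‖ = 1) (e : E) : ‖e - inner ℝ ν e • ν‖ ≤ ‖e‖ := by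
  have h : ‖e - inner ℝ ν e • ν‖ ^ 2 = ‖e‖ ^ 2 - inner ℝ ν e ^ 2 := by
    rw [norm_sub_sq_real, inner_smul_right, norm_smul, hν, real_inner_comm]
    simp only [Real.norm_eq_abs, mul_one, sq_abs]
    ring
  have : 0 ≤ inner ℝ ν e ^ 2 := sq_nonneg _
  nlinarith [norm_nonneg (e - inner ℝ ν e • ν), norm_nonneg e]

/-- Lipschitz bound for `φ` composed with the projection along the unit vector `ν`. -/
theorem LipschitzWith.le_add_norm_along {E : Type*} [NormedAddCommGroup E]
    [InnerProductSpace ℝ E] {ν : E} (hν : ‖ν‖ = 1) {L : NNReal} {φ : E → ℝ}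
    (hφ : LipschitzWith L φ) (x y : E) (a : ℝ) :
    φ (x - inner ℝ ν x • ν) ≤ φ (y - inner ℝ ν y • ν) + L * ‖x - y - a • ν‖ := by
  have h := hφ.dist_le_mul (x - inner ℝ ν x • ν) (y - inner ℝ ν y • ν)
  have e : x - inner ℝ ν x • ν - (y - inner ℝ ν y • ν)
      = (x - y - a • ν) - inner ℝ ν (x - y - a • ν) • ν := by
    have h1 : inner ℝ ν ν = (1 : ℝ) := by rw [real_inner_self_eq_norm_sq, hν]; norm_num
    simp only [inner_sub_right, inner_smul_right, h1]
    module
  rw [Real.dist_eq, dist_eq_norm, e] at h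
  have h2 := norm_sub_inner_smul_le hν (x - y - a • ν)
  have h3 : (L : ℝ) * ‖(x - y - a • ν) - inner ℝ ν (x - y - a • ν) • ν‖
      ≤ L * ‖x - y - a • ν‖ := by gcongr
  linarith [le_abs_self (φ (x - inner ℝ ν x • ν) - φ (y - inner ℝ ν y • ν))]

/-- Moving from q by t/2 against ν leads a depth t/2 below the graph. Within distance κt of the new
point, height and graph together change by at most (1 + L)κt = t/4, so the whole ball stays below
the graph. -/
theorem IsBoundedLipschitzDomain.exists_exterior_ball_locally (hΩ : IsBoundedLipschitzDomain Ω)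
    {p : EuclideanSpace ℝ (Fin d)} (hp : p ∈ frontier Ω) :
    ∃ κ > 0, ∃ ρ > 0, ∀ q ∈ Metric.ball p ρ ∩ frontier Ω, ∀ t, 0 < t → t ≤ ρ →
      ∃ y, Metric.closedBall y (κ * t) ⊆ Metric.closedBall q t \ Ω := by
  obtain ⟨U, ν, L, φ, hU, hpU, hν, hφ, hUΩ⟩ := hΩ.lipschitz_boundary p hp
  obtain ⟨ρ, hρ, hball⟩ := Metric.isOpen_iff.1 hU p hpU
  have hL : (0 : ℝ) ≤ L := L.2
  refine ⟨1 / (4 * (1 + L)), by positivity, ρ / 2, by positivity, ?_⟩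
  rintro q ⟨hqp, hq⟩ t ht htρ
  rw [Metric.mem_ball] at hqp
  have hqΩ : q ∉ Ω := by
    rw [hΩ.isOpen.frontier_eq] at hq
    exact hq.2
  have hκ : (1 + L) * (1 / (4 * (1 + L)) * t) = t / 4 := by field_simp
  set κ : ℝ := 1 / (4 * (1 + L))
  have hκ0 : 0 < κ := by positivity
  have hκ1 : κ * t ≤ t / 4 := by nlinarith [mul_pos hκ0 ht]
  have hqU : q ∈ U := hball (by rw [Metric.mem_ball]; linarith)
  have h1 : inner ℝ ν q ≤ φ (q - inner ℝ ν q • ν) := not_lt.1 fun h => hqΩ ((hUΩ q hqU).2 h)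
  refine ⟨q - (t / 2) • ν, fun y hy => ?_⟩
  rw [Metric.mem_closedBall, dist_eq_norm] at hy
  have hyq : ‖y - q‖ ≤ t := by
    calc ‖y - q‖ = ‖(y - (q - (t / 2) • ν)) - (t / 2) • ν‖ := by congr 1; module
      _ ≤ ‖y - (q - (t / 2) • ν)‖ + ‖(t / 2) • ν‖ := norm_sub_le _ _
      _ ≤ t / 4 + t / 2 := by
        gcongr
        · linarith
        · rw [norm_smul, hν, Real.norm_eq_abs, abs_of_pos (by positivity), mul_one]
      _ ≤ t := by linarith
  refine ⟨by rwa [Metric.mem_closedBall, dist_eq_norm], fun hyΩ => ?_⟩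
  have hyU : y ∈ U := hball (by
    rw [Metric.mem_ball]
    calc dist y p ≤ dist y q + dist q p := dist_triangle _ _ _
      _ < ρ / 2 + ρ / 2 := by rw [dist_eq_norm y q]; linarith
      _ = ρ := by ring)
  have h2 := (hUΩ y hyU).1 hyΩ
  have h3 := hφ.le_add_norm_along hν q y (t / 2)
  have h4 : ‖q - y - (t / 2) • ν‖ = ‖y - (q - (t / 2) • ν)‖ := by
    rw [← norm_neg]; congr 1; module
  rw [h4] at h3
  have h5 : inner ℝ ν y = inner ℝ ν q - t / 2 + inner ℝ ν (y - (q - (t / 2) • ν)) := by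
    have h1 : inner ℝ ν ν = (1 : ℝ) := by rw [real_inner_self_eq_norm_sq, hν]; norm_num
    simp only [inner_sub_right, inner_smul_right, h1]
    ring
  have h6 : inner ℝ ν (y - (q - (t / 2) • ν)) ≤ ‖y - (q - (t / 2) • ν)‖ := by
    have := real_inner_le_norm ν (y - (q - (t / 2) • ν))
    rwa [hν, one_mul] at this
  have h7 : (L : ℝ) * ‖y - (q - (t / 2) • ν)‖ ≤ L * (κ * t) := by gcongr
  nlinarith

/-- A bounded Lipschitz domain satisfies the exterior ball-density condition at all scales. -/
theorem IsBoundedLipschitzDomain.exists_exterior_ball (hd : 1 ≤ d)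
    (hΩ : IsBoundedLipschitzDomain Ω) :
    ∃ κ > 0, ∀ p ∈ frontier Ω, ∀ t, 0 < t →
      ∃ y, Metric.closedBall y (κ * t) ⊆ Metric.closedBall p t \ Ω := by
  have hcomp : IsCompact (frontier Ω) :=
    hΩ.isBounded.isCompact_closure.of_isClosed_subset isClosed_frontier frontier_subset_closure
  obtain ⟨κ, hκ, ρ, hρ, h⟩ : ∃ κ > 0, ∃ ρ > 0, ∀ q ∈ frontier Ω, ∀ t, 0 < t → t ≤ ρ →
      ∃ y, Metric.closedBall y (κ * t) ⊆ Metric.closedBall q t \ Ω := by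
    refine hcomp.induction_on (p := fun S => ∃ κ > 0, ∃ ρ > 0, ∀ q ∈ S, ∀ t, 0 < t → t ≤ ρ →
      ∃ y, Metric.closedBall y (κ * t) ⊆ Metric.closedBall q t \ Ω) ?_ ?_ ?_ ?_
    · exact ⟨1, one_pos, 1, one_pos, by simp⟩
    · rintro S S' hS ⟨κ, hκ, ρ, hρ, h⟩
      exact ⟨κ, hκ, ρ, hρ, fun q hq => h q (hS hq)⟩
    · rintro S S' ⟨κ, hκ, ρ, hρ, h⟩ ⟨κ', hκ', ρ', hρ', h'⟩
      refine ⟨min κ κ', by positivity, min ρ ρ', by positivity, fun q hq t ht htρ => ?_⟩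
      rcases hq with hq | hq
      · obtain ⟨y, hy⟩ := h q hq t ht (htρ.trans (min_le_left _ _))
        exact ⟨y, (Metric.closedBall_subset_closedBall (by gcongr; exact min_le_left _ _)).trans hy⟩
      · obtain ⟨y, hy⟩ := h' q hq t ht (htρ.trans (min_le_right _ _))
        exact ⟨y, (Metric.closedBall_subset_closedBall
          (by gcongr; exact min_le_right _ _)).trans hy⟩
    · intro p hp
      obtain ⟨κ, hκ, ρ, hρ, h⟩ := hΩ.exists_exterior_ball_locally hp
      exact ⟨Metric.ball p ρ ∩ frontier Ω, Filter.inter_mem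
        (mem_nhdsWithin_of_mem_nhds (Metric.ball_mem_nhds p hρ)) self_mem_nhdsWithin,
        κ, hκ, ρ, hρ, h⟩
  obtain ⟨D, hD⟩ := hΩ.isBounded.closure.subset_closedBall 0
  have hD' : ∀ x ∈ closure Ω, ‖x‖ ≤ D := fun x hx => by simpa using hD hx
  -- For t ≤ R a ball found at the smaller scale (ρ/R)t ≤ ρ suffices. For t > R the domain has
  -- diameter at most 2|D| < t/4, so it misses a ball of radius t/4 centred at distance t/2 from p.
  set R : ℝ := max (8 * (|D| + 1)) ρ
  have hR : 0 < R := lt_max_of_lt_right hρ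
  refine ⟨min (κ * (ρ / R)) (1 / 4), by positivity, fun p hp t ht => ?_⟩
  rcases le_or_gt t R with htR | htR
  · have hs : ρ / R * t ≤ t := by
      have : ρ / R ≤ 1 := (div_le_one hR).2 (le_max_right _ _)
      nlinarith
    obtain ⟨y, hy⟩ := h p hp (ρ / R * t) (by positivity) (by
      rw [div_mul_eq_mul_div, div_le_iff₀ hR]; gcongr)
    refine ⟨y, ((Metric.closedBall_subset_closedBall ?_).trans hy).trans
      (Set.sdiff_subset_sdiff_left (Metric.closedBall_subset_closedBall hs))⟩
    rw [← mul_assoc]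
    gcongr
    exact min_le_left _ _
  · have ht8 : 8 * (|D| + 1) < t := (le_max_left _ _).trans_lt htR
    let e : EuclideanSpace ℝ (Fin d) := EuclideanSpace.single ⟨0, hd⟩ 1
    have he : ‖e‖ = 1 := by simp [e]
    refine ⟨p + (t / 2) • e, fun x hx => ?_⟩
    rw [Metric.mem_closedBall, dist_eq_norm] at hx
    have hx4 : ‖x - (p + (t / 2) • e)‖ ≤ t / 4 := hx.trans (by
      have := min_le_right (κ * (ρ / R)) (1 / 4)
      nlinarith)
    have hte : ‖(t / 2) • e‖ = t / 2 := by
      rw [norm_smul, he, Real.norm_eq_abs, abs_of_pos (by positivity), mul_one]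
    constructor
    · rw [Metric.mem_closedBall, dist_eq_norm]
      calc ‖x - p‖ = ‖(x - (p + (t / 2) • e)) + (t / 2) • e‖ := by congr 1; module
        _ ≤ t / 4 + t / 2 := (norm_add_le _ _).trans (by rw [hte]; gcongr)
        _ ≤ t := by linarith
    · intro hxΩ
      have h1 := hD' x (subset_closure hxΩ)
      have h2 := hD' p (frontier_subset_closure hp)
      have h3 : t / 2 ≤ ‖x - p‖ + t / 4 := by
        calc t / 2 = ‖(t / 2) • e‖ := hte.symm
          _ = ‖(x - p) - (x - (p + (t / 2) • e))‖ := by congr 1; module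
          _ ≤ _ := (norm_sub_le _ _).trans (by gcongr)
      have h4 := norm_sub_le x p
      linarith [le_abs_self D]

/-- Exterior balls shrink to every boundary point, so the domain has no slits. This recovers Ω from
the union of the mesh elements, which only determines its closure. -/
theorem IsBoundedLipschitzDomain.interior_closure (hΩ : IsBoundedLipschitzDomain Ω) :
    interior (closure Ω) = Ω := by
  refine subset_antisymm (fun x hx => ?_)
    (interior_maximal subset_closure hΩ.isOpen)
  by_contra hxΩ
  have hxf : x ∈ frontier Ω := by
    rw [hΩ.isOpen.frontier_eq]; exact ⟨interior_subset hx, hxΩ⟩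
  obtain ⟨κ, hκ, ρ, hρ, h⟩ := hΩ.exists_exterior_ball_locally hxf
  obtain ⟨ε, hε, hball⟩ := Metric.isOpen_iff.1 isOpen_interior x hx
  have ht : 0 < min ρ (ε / 2) := by positivity
  obtain ⟨y, hy⟩ := h x ⟨Metric.mem_ball_self hρ, hxf⟩ (min ρ (ε / 2)) ht (min_le_left _ _)
  have hyx := (hy (Metric.mem_closedBall_self (by positivity))).1
  have hycl : y ∈ closure Ω := interior_subset (hball (by
    rw [Metric.mem_ball]
    rw [Metric.mem_closedBall] at hyx
    linarith [min_le_right ρ (ε / 2)]))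
  obtain ⟨z, hz, hzy⟩ := Metric.mem_closure_iff.1 hycl (κ * min ρ (ε / 2)) (by positivity)
  exact (hy (by rw [Metric.mem_closedBall, dist_comm]; exact hzy.le)).2 hz

theorem IsBoundedLipschitzDomain.compl_nonempty (hd : 1 ≤ d) (hΩ : IsBoundedLipschitzDomain Ω) :
    Ωᶜ.Nonempty := by
  rw [Set.nonempty_compl]
  rintro rfl
  have : Nonempty (Fin d) := ⟨⟨0, hd⟩⟩
  exact NormedSpace.unbounded_univ ℝ (EuclideanSpace ℝ (Fin d)) hΩ.isBounded

/-- A point of `Ω` close to the complement sees an exterior ball of comparable size. -/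
theorem IsBoundedLipschitzDomain.exists_exterior_ball_of_infDist_lt (hd : 1 ≤ d)
    (hΩ : IsBoundedLipschitzDomain Ω) :
    ∃ κ > 0, ∀ x ∈ Ω, ∀ t, 0 < t → Metric.infDist x Ωᶜ < t →
      ∃ y, Metric.closedBall y (κ * t) ⊆ Metric.closedBall x (2 * t) \ Ω := by
  obtain ⟨κ, hκ, h⟩ := hΩ.exists_exterior_ball hd
  refine ⟨κ, hκ, fun x hx t ht hxt => ?_⟩
  obtain ⟨p, hp, hpx⟩ := exists_mem_frontier_infDist_compl_eq_dist hx
    (Set.nonempty_compl.1 (hΩ.compl_nonempty hd))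
  obtain ⟨y, hy⟩ := h p hp t ht
  refine ⟨y, hy.trans (Set.sdiff_subset_sdiff_left (Metric.closedBall_subset_closedBall' ?_))⟩
  rw [dist_comm, ← hpx]
  linarith

end Domain

/-! ### Barycentric coordinates and nodal interpolation on a conforming mesh. -/

section Mesh

variable {d : ℕ} {Ω : Set (EuclideanSpace ℝ (Fin d))}
  {T : Geometry.SimplicialComplex ℝ (EuclideanSpace ℝ (Fin d))}
  {t t' : Finset (EuclideanSpace ℝ (Fin d))}

theorem affineMap_eqOn_convexHull {E : Type*} [AddCommGroup E] [Module ℝ E] {f g : E →ᵃ[ℝ] ℝ}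
    {s : Set E} (h : Set.EqOn f g s) : Set.EqOn f g (convexHull ℝ s) := by
  have : convexHull ℝ s ⊆ (f - g) ⁻¹' {0} :=
    convexHull_min (fun x hx => by simp [h hx]) ((convex_singleton (0 : ℝ)).affine_preimage _)
  intro x hx
  simpa [sub_eq_zero] using this hx

theorem isCompact_convexHull_finset (t : Finset (EuclideanSpace ℝ (Fin d))) :
    IsCompact (convexHull ℝ (t : Set (EuclideanSpace ℝ (Fin d)))) :=
  t.finite_toSet.isCompact_convexHull ℝ

theorem isClosed_convexHull_finset (t : Finset (EuclideanSpace ℝ (Fin d))) :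
    IsClosed (convexHull ℝ (t : Set (EuclideanSpace ℝ (Fin d)))) :=
  (isCompact_convexHull_finset t).isClosed

/-- The vertices of an element form an affine basis. -/
def meshBasis (ht : t ∈ meshElements T) : AffineBasis t ℝ (EuclideanSpace ℝ (Fin d)) where
  toFun := (↑)
  ind' := T.indep ht.1
  tot' := (T.indep ht.1).affineSpan_eq_top_iff_card_eq_finrank_add_one.2 (by simp [ht.2])

/-- The barycentric coordinate of an element at a vertex; zero if `z` is not a vertex. -/
def baryCoord (ht : t ∈ meshElements T) (z : EuclideanSpace ℝ (Fin d)) :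
    EuclideanSpace ℝ (Fin d) →ᵃ[ℝ] ℝ :=
  open Classical in if hz : z ∈ t then (meshBasis ht).coord ⟨z, hz⟩ else 0

theorem baryCoord_of_notMem (ht : t ∈ meshElements T) {z : EuclideanSpace ℝ (Fin d)}
    (hz : z ∉ t) : baryCoord ht z = 0 := by
  rw [baryCoord, dif_neg hz]

theorem baryCoord_self (ht : t ∈ meshElements T) {z : EuclideanSpace ℝ (Fin d)} (hz : z ∈ t) :
    baryCoord ht z z = 1 := by
  rw [baryCoord, dif_pos hz]
  exact (meshBasis ht).coord_apply_eq ⟨z, hz⟩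

theorem baryCoord_of_ne (ht : t ∈ meshElements T) {z z' : EuclideanSpace ℝ (Fin d)}
    (hz' : z' ∈ t) (h : z ≠ z') : baryCoord ht z z' = 0 := by
  by_cases hz : z ∈ t
  · rw [baryCoord, dif_pos hz]
    exact (meshBasis ht).coord_apply_ne (i := ⟨z, hz⟩) (j := ⟨z', hz'⟩) (by simpa using h)
  · rw [baryCoord_of_notMem ht hz]; rfl

theorem range_meshBasis (ht : t ∈ meshElements T) :
    Set.range (meshBasis ht) = (t : Set (EuclideanSpace ℝ (Fin d))) := by
  change Set.range ((↑) : t → EuclideanSpace ℝ (Fin d)) = _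
  simp

theorem mem_convexHull_iff_baryCoord (ht : t ∈ meshElements T) {x : EuclideanSpace ℝ (Fin d)} :
    x ∈ convexHull ℝ (t : Set (EuclideanSpace ℝ (Fin d))) ↔ ∀ z ∈ t, 0 ≤ baryCoord ht z x := by
  rw [← range_meshBasis ht, (meshBasis ht).convexHull_eq_nonneg_coord]
  constructor
  · intro h z hz
    rw [baryCoord, dif_pos hz]
    exact h ⟨z, hz⟩
  · rintro h ⟨z, hz⟩
    have := h z hz
    rwa [baryCoord, dif_pos hz] at this

theorem baryCoord_nonneg (ht : t ∈ meshElements T) {x : EuclideanSpace ℝ (Fin d)}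
    (hx : x ∈ convexHull ℝ (t : Set (EuclideanSpace ℝ (Fin d)))) (z : EuclideanSpace ℝ (Fin d)) :
    0 ≤ baryCoord ht z x := by
  by_cases hz : z ∈ t
  · exact (mem_convexHull_iff_baryCoord ht).1 hx z hz
  · simp [baryCoord_of_notMem ht hz]

theorem baryCoord_pos_of_mem_interior (ht : t ∈ meshElements T) {x z : EuclideanSpace ℝ (Fin d)}
    (hx : x ∈ interior (convexHull ℝ (t : Set (EuclideanSpace ℝ (Fin d))))) (hz : z ∈ t) :
    0 < baryCoord ht z x := by
  rw [← range_meshBasis ht, (meshBasis ht).interior_convexHull] at hx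
  rw [baryCoord, dif_pos hz]
  exact hx ⟨z, hz⟩

/-- By conformity the intersection lies in the hull of the common vertices, and at those both affine
functions take the same values 0 or 1. Extending the coordinate by zero to non-vertices makes this
hold for every z. -/
theorem baryCoord_eqOn_inter (ht : t ∈ meshElements T) (ht' : t' ∈ meshElements T)
    {x : EuclideanSpace ℝ (Fin d)}
    (hx : x ∈ convexHull ℝ (t : Set (EuclideanSpace ℝ (Fin d))))
    (hx' : x ∈ convexHull ℝ (t' : Set (EuclideanSpace ℝ (Fin d))))
    (z : EuclideanSpace ℝ (Fin d)) : baryCoord ht z x = baryCoord ht' z x := by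
  refine affineMap_eqOn_convexHull (fun y hy => ?_) (T.inter_subset_convexHull ht.1 ht'.1 ⟨hx, hx'⟩)
  by_cases h : z = y
  · subst h
    rw [baryCoord_self ht hy.1, baryCoord_self ht' hy.2]
  · rw [baryCoord_of_ne ht hy.1 h, baryCoord_of_ne ht' hy.2 h]

theorem baryCoord_le_one (ht : t ∈ meshElements T) {x : EuclideanSpace ℝ (Fin d)}
    (hx : x ∈ convexHull ℝ (t : Set (EuclideanSpace ℝ (Fin d)))) (z : EuclideanSpace ℝ (Fin d)) :
    baryCoord ht z x ≤ 1 := by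
  have : convexHull ℝ (t : Set (EuclideanSpace ℝ (Fin d))) ⊆ baryCoord ht z ⁻¹' Set.Iic 1 := by
    refine convexHull_min (fun y hy => ?_) ((convex_Iic (1 : ℝ)).affine_preimage _)
    rw [Set.mem_preimage, Set.mem_Iic]
    by_cases h : z = y
    · subst h; rw [baryCoord_self ht hy]
    · rw [baryCoord_of_ne ht hy h]; exact zero_le_one
  exact this hx

/-- Elements have equally many vertices, so some vertex z of `t` is not in `t'`. Its coordinate is
positive inside `t` and vanishes on `t'`. -/
theorem disjoint_interior_convexHull (ht : t ∈ meshElements T) (ht' : t' ∈ meshElements T)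
    (h : t ≠ t') : Disjoint (interior (convexHull ℝ (t : Set (EuclideanSpace ℝ (Fin d)))))
      (convexHull ℝ (t' : Set (EuclideanSpace ℝ (Fin d)))) := by
  rw [Set.disjoint_left]
  intro x hx hx'
  obtain ⟨z, hz, hz'⟩ : ∃ z ∈ t, z ∉ t' := by
    by_contra! hc
    exact h (Finset.eq_of_subset_of_card_le hc (by rw [ht.2, ht'.2]))
  have h1 := baryCoord_pos_of_mem_interior ht hx hz
  rw [baryCoord_eqOn_inter ht ht' (interior_subset hx) hx' z, baryCoord_of_notMem ht' hz'] at h1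
  exact lt_irrefl _ h1

theorem IsTriangulation.finite_meshElements (hT : IsTriangulation Ω T) :
    (meshElements T).Finite := hT.finite_faces.subset fun _ h => h.1

theorem IsTriangulation.exists_meshElement (hT : IsTriangulation Ω T)
    {x : EuclideanSpace ℝ (Fin d)} (hx : x ∈ closure Ω) :
    ∃ t ∈ meshElements T, x ∈ convexHull ℝ (t : Set (EuclideanSpace ℝ (Fin d))) := by
  rw [← hT.space_eq] at hx
  obtain ⟨s, hs, hxs⟩ := Geometry.SimplicialComplex.mem_space_iff.1 hx
  obtain ⟨t, ht, hst, hcard⟩ := hT.pure s hs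
  exact ⟨t, ⟨ht, hcard⟩, convexHull_mono (Finset.coe_subset.2 hst) hxs⟩

theorem IsTriangulation.convexHull_subset (hT : IsTriangulation Ω T) (ht : t ∈ meshElements T) :
    convexHull ℝ (t : Set (EuclideanSpace ℝ (Fin d))) ⊆ closure Ω :=
  hT.space_eq ▸ Geometry.SimplicialComplex.convexHull_subset_space ht.1

/-- The open star of an interior vertex is contained in the domain. -/
theorem IsTriangulation.mem_of_baryCoord_pos (hT : IsTriangulation Ω T)
    (hΩ : IsBoundedLipschitzDomain Ω) (ht : t ∈ meshElements T)
    {x z : EuclideanSpace ℝ (Fin d)} (hz : z ∈ t) (hzΩ : z ∈ Ω)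
    (hx : x ∈ convexHull ℝ (t : Set (EuclideanSpace ℝ (Fin d)))) (hpos : 0 < baryCoord ht z x) :
    x ∈ Ω := by
  rw [← hΩ.interior_closure, mem_interior_iff_mem_nhds]
  have hcont : Continuous fun ε : ℝ => AffineMap.lineMap z x ε := AffineMap.lineMap_continuous
  -- The contraction towards z by the factor ε carries x, and then a neighbourhood of x, into Ω,
  -- where the mesh covers everything. Membership in an element is then transported back to the
  -- original points.
  obtain ⟨ε, hε0, hε1, hεΩ⟩ : ∃ ε : ℝ, 0 < ε ∧ ε < 1 ∧ AffineMap.lineMap z x ε ∈ Ω := by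
    have h0 : ∀ᶠ ε in nhds (0 : ℝ), AffineMap.lineMap z x ε ∈ Ω :=
      hcont.continuousAt.eventually_mem (by simpa using hΩ.isOpen.mem_nhds hzΩ)
    obtain ⟨δ, hδ, h⟩ := Metric.eventually_nhds_iff.1 h0
    refine ⟨min (δ / 2) (1 / 2), by positivity, by
      linarith [min_le_right (δ / 2) (1 / 2)], h ?_⟩
    rw [Real.dist_eq, sub_zero, abs_of_pos (by positivity)]
    linarith [min_le_left (δ / 2) (1 / 2)]
  have hconty : Continuous fun y => AffineMap.lineMap z y ε := by
    simp only [AffineMap.lineMap_apply]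
    fun_prop
  have hxε : AffineMap.lineMap z x ε ∈ convexHull ℝ (t : Set (EuclideanSpace ℝ (Fin d))) :=
    (convex_convexHull ℝ _).lineMap_mem (subset_convexHull ℝ _ hz) hx ⟨hε0.le, hε1.le⟩
  have hline : ∀ (s : Finset (EuclideanSpace ℝ (Fin d))) (hs : s ∈ meshElements T)
      (y p : EuclideanSpace ℝ (Fin d)), baryCoord hs p (AffineMap.lineMap z y ε)
        = (1 - ε) * baryCoord hs p z + ε * baryCoord hs p y := by
    intro s hs y p
    rw [AffineMap.apply_lineMap, AffineMap.lineMap_apply_module]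
    simp
  -- An element containing the contracted x must have z as a vertex, because the coordinate of z is
  -- positive there. Undoing the contraction multiplies the other coordinates by 1/ε, which
  -- preserves their sign, while the coordinate of z stays positive near x. Elements missing the
  -- contracted x are avoided nearby by closedness.
  have hev : ∀ᶠ y in nhds x, ∀ s ∈ meshElements T,
      AffineMap.lineMap z y ε ∈ convexHull ℝ (s : Set (EuclideanSpace ℝ (Fin d))) →
      y ∈ convexHull ℝ (s : Set (EuclideanSpace ℝ (Fin d))) := by
    rw [Filter.eventually_all_finite hT.finite_meshElements]
    intro s hs
    by_cases hxs : AffineMap.lineMap z x ε ∈ convexHull ℝ (s : Set (EuclideanSpace ℝ (Fin d)))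
    · have heq := baryCoord_eqOn_inter ht hs hxε hxs z
      have hzs : z ∈ s := by
        by_contra hzs
        rw [baryCoord_of_notMem hs hzs, hline t ht x z, baryCoord_self ht hz] at heq
        rw [AffineMap.coe_zero, Pi.zero_apply] at heq
        nlinarith
      have hpos' : 0 < baryCoord hs z x := by
        rw [hline t ht x z, hline s hs x z, baryCoord_self ht hz, baryCoord_self hs hzs] at heq
        have : ε * baryCoord ht z x = ε * baryCoord hs z x := by linarith
        rwa [← mul_left_cancel₀ hε0.ne' this]
      have hc : Continuous (baryCoord hs z) := (baryCoord hs z).continuous_of_finiteDimensional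
      filter_upwards [hc.continuousAt.eventually_const_lt hpos'] with y hy hys
      rw [mem_convexHull_iff_baryCoord hs]
      intro p hp
      by_cases hpz : p = z
      · subst hpz; exact hy.le
      · have h1 := baryCoord_nonneg hs hys p
        rw [hline s hs y p, baryCoord_of_ne hs hzs hpz, mul_zero, zero_add] at h1
        exact (mul_nonneg_iff_of_pos_left hε0).1 h1
    · filter_upwards [hconty.continuousAt.eventually_mem
        ((isClosed_convexHull_finset s).isOpen_compl.mem_nhds hxs)] with y hy hys
      exact absurd hys hy
  have hevΩ : ∀ᶠ y in nhds x, AffineMap.lineMap z y ε ∈ Ω :=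
    hconty.continuousAt.eventually_mem (hΩ.isOpen.mem_nhds hεΩ)
  filter_upwards [hev, hevΩ] with y hy hyΩ
  obtain ⟨s, hs, hys⟩ := hT.exists_meshElement (subset_closure hyΩ)
  exact hT.convexHull_subset hs (hy s hs hys)

/-- The piecewise affine interpolant of nodal values that vanish off `Ω`. -/
theorem IsTriangulation.exists_interpolant (hT : IsTriangulation Ω T)
    (hΩ : IsBoundedLipschitzDomain Ω) (W : EuclideanSpace ℝ (Fin d) → ℝ)
    (hW : ∀ z ∉ Ω, W z = 0) :
    ∃ w ∈ feSpace Ω T, ∀ t ∈ meshElements T, ∀ z ∈ t, w z = W z := by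
  classical
  let b : ∀ t, t ∈ meshElements T → (EuclideanSpace ℝ (Fin d) →ᵃ[ℝ] ℝ) :=
    fun t ht => ∑ z ∈ t, W z • baryCoord ht z
  have hb : ∀ t (ht : t ∈ meshElements T) x, b t ht x = ∑ z ∈ t, W z * baryCoord ht z x := by
    intro t ht x
    have : ∀ s : Finset (EuclideanSpace ℝ (Fin d)),
        (∑ z ∈ s, W z • baryCoord ht z) x = ∑ z ∈ s, W z * baryCoord ht z x := by
      intro s
      induction s using Finset.induction_on with
      | empty => simp
      | insert a s ha ih => rw [Finset.sum_insert ha, Finset.sum_insert ha, ← ih]; rfl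
    exact this t
  have hbz : ∀ t (ht : t ∈ meshElements T), ∀ z ∈ t, b t ht z = W z := by
    intro t ht z hz
    rw [hb, Finset.sum_eq_single z, baryCoord_self ht hz, mul_one]
    · intro p hp hpz
      rw [baryCoord_of_ne ht hz hpz, mul_zero]
    · exact fun h => absurd hz h
  have hbb : ∀ t (ht : t ∈ meshElements T) t' (ht' : t' ∈ meshElements T) x,
      x ∈ convexHull ℝ (t : Set (EuclideanSpace ℝ (Fin d))) →
      x ∈ convexHull ℝ (t' : Set (EuclideanSpace ℝ (Fin d))) → b t ht x = b t' ht' x := by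
    intro t ht t' ht' x hx hx'
    refine affineMap_eqOn_convexHull (fun y hy => ?_)
      (T.inter_subset_convexHull ht.1 ht'.1 ⟨hx, hx'⟩)
    rw [hbz t ht y hy.1, hbz t' ht' y hy.2]
  -- At a point off Ω only vertices off Ω have nonzero coordinates, since the open star of an
  -- interior vertex lies in Ω. This is where the nodal values are zero.
  have hb0 : ∀ t (ht : t ∈ meshElements T) x,
      x ∈ convexHull ℝ (t : Set (EuclideanSpace ℝ (Fin d))) → x ∉ Ω → b t ht x = 0 := by
    intro t ht x hx hxΩ
    rw [hb]
    refine Finset.sum_eq_zero fun z hz => ?_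
    by_cases hzΩ : z ∈ Ω
    · rcases (baryCoord_nonneg ht hx z).eq_or_lt with h | h
      · rw [← h, mul_zero]
      · exact absurd (hT.mem_of_baryCoord_pos hΩ ht hz hzΩ hx h) hxΩ
    · rw [hW z hzΩ, zero_mul]
  let w : EuclideanSpace ℝ (Fin d) → ℝ := fun x =>
    if h : ∃ t, ∃ _ : t ∈ meshElements T, x ∈ convexHull ℝ (t : Set (EuclideanSpace ℝ (Fin d)))
      then b h.choose h.choose_spec.1 x else 0
  have hw : ∀ t (ht : t ∈ meshElements T) x,
      x ∈ convexHull ℝ (t : Set (EuclideanSpace ℝ (Fin d))) → w x = b t ht x := by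
    intro t ht x hx
    have h : ∃ t, ∃ _ : t ∈ meshElements T,
      x ∈ convexHull ℝ (t : Set (EuclideanSpace ℝ (Fin d))) := ⟨t, ht, hx⟩
    simp only [w]
    rw [dif_pos h]
    exact hbb _ h.choose_spec.1 t ht x h.choose_spec.2 hx
  have hw0 : ∀ x ∉ Ω, w x = 0 := by
    intro x hx
    by_cases h : ∃ t, ∃ _ : t ∈ meshElements T,
      x ∈ convexHull ℝ (t : Set (EuclideanSpace ℝ (Fin d)))
    · obtain ⟨t, ht, hxt⟩ := h
      rw [hw t ht x hxt, hb0 t ht x hxt hx]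
    · simp only [w]; rw [dif_neg h]
  refine ⟨w, ⟨?_, hw0, fun t ht => ⟨b t ht, hw t ht⟩⟩, fun t ht z hz => by
    rw [hw t ht z (subset_convexHull ℝ _ hz), hbz t ht z hz]⟩
  -- Continuity by pasting over the finite closed cover formed by the elements and Ωᶜ.
  have := hT.finite_meshElements.to_subtype
  let F : Option (meshElements T) → Set (EuclideanSpace ℝ (Fin d)) := fun o =>
    o.elim Ωᶜ fun t => convexHull ℝ (t.1 : Set (EuclideanSpace ℝ (Fin d)))
  refine (locallyFinite_of_finite F).continuous ?_ ?_ ?_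
  · refine Set.eq_univ_of_forall fun x => ?_
    by_cases hx : x ∈ Ω
    · obtain ⟨t, ht, hxt⟩ := hT.exists_meshElement (subset_closure hx)
      exact Set.mem_iUnion.2 ⟨some ⟨t, ht⟩, hxt⟩
    · exact Set.mem_iUnion.2 ⟨none, hx⟩
  · rintro (_ | t)
    · exact hΩ.isOpen.isClosed_compl
    · exact isClosed_convexHull_finset t.1
  · rintro (_ | t)
    · exact continuousOn_const.congr hw0
    · exact (b t.1 t.2).continuous_of_finiteDimensional.continuousOn.congr (hw t.1 t.2)

end Mesh

/-! ### Inverse estimates for affine functions on shape regular bodies, and the mean oscillation. -/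

section AffineOnBalls

variable {d : ℕ}

theorem exists_gradient_affineMap (a : EuclideanSpace ℝ (Fin d) →ᵃ[ℝ] ℝ) :
    ∃ e : EuclideanSpace ℝ (Fin d), ∀ x y, a x - a y = inner ℝ e (x - y) := by
  refine ⟨(InnerProductSpace.toDual ℝ _).symm (LinearMap.toContinuousLinearMap a.linear),
    fun x y => ?_⟩
  rw [InnerProductSpace.toDual_symm_apply]
  have := a.linearMap_vsub x y
  simpa using this.symm

/-- Between the two ends of the diameter of the ball in direction e, the function changes by exactly
2r‖e‖. -/
theorem two_mul_norm_gradient_le {a : EuclideanSpace ℝ (Fin d) → ℝ}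
    {e c : EuclideanSpace ℝ (Fin d)} {r m : ℝ} {K : Set (EuclideanSpace ℝ (Fin d))}
    (ha : ∀ x y, a x - a y = inner ℝ e (x - y)) (hr : 0 ≤ r)
    (hK : Metric.closedBall c r ⊆ K) (hm : ∀ x ∈ K, ∀ y ∈ K, |a x - a y| ≤ m) :
    2 * r * ‖e‖ ≤ m := by
  by_cases he : e = 0
  · have := hm c (hK (Metric.mem_closedBall_self hr)) c (hK (Metric.mem_closedBall_self hr))
    rw [he, norm_zero, mul_zero]
    exact (abs_nonneg _).trans this
  have hn : 0 < ‖e‖ := norm_pos_iff.2 he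
  have hu : ‖(r / ‖e‖) • e‖ = r := by
    rw [norm_smul, Real.norm_eq_abs, abs_of_nonneg (by positivity), div_mul_cancel₀ _ hn.ne']
  have h := hm (c + (r / ‖e‖) • e) (hK (by simp [hu])) (c - (r / ‖e‖) • e)
    (hK (by simp [hu]))
  rw [ha] at h
  have e1 : c + (r / ‖e‖) • e - (c - (r / ‖e‖) • e) = (2 * (r / ‖e‖)) • e := by module
  rw [e1, inner_smul_right, real_inner_self_eq_norm_sq] at h
  have e2 : 2 * (r / ‖e‖) * ‖e‖ ^ 2 = 2 * r * ‖e‖ := by field_simp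
  rw [e2] at h
  exact (le_abs_self _).trans h

/-- On a ball, an affine function is bounded below on a smaller ball of comparable radius. -/
theorem exists_closedBall_le_abs_affine {a : EuclideanSpace ℝ (Fin d) → ℝ}
    {e c : EuclideanSpace ℝ (Fin d)} {r : ℝ}
    (ha : ∀ x y, a x - a y = inner ℝ e (x - y)) (hr : 0 ≤ r) :
    ∃ y, Metric.closedBall y (r / 4) ⊆ Metric.closedBall c r ∧
      ∀ x ∈ Metric.closedBall y (r / 4), |a c| + ‖e‖ * (r / 4) ≤ |a x| := by
  obtain ⟨u, hu1, hue⟩ : ∃ u : EuclideanSpace ℝ (Fin d), ‖u‖ ≤ 1 ∧ inner ℝ e u = ‖e‖ := by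
    by_cases he : e = 0
    · exact ⟨0, by simp, by simp [he]⟩
    · have hn : ‖e‖ ≠ 0 := norm_ne_zero_iff.2 he
      refine ⟨‖e‖⁻¹ • e, ?_, ?_⟩
      · rw [norm_smul, norm_inv, norm_norm, inv_mul_cancel₀ hn]
      · rw [inner_smul_right, real_inner_self_eq_norm_sq]
        field_simp
  -- The new centre is shifted by r/2 along the gradient, to the side where |a| grows. It gains
  -- ‖e‖r/2, of which at most ‖e‖r/4 is lost on the ball of radius r/4.
  have hs : ∃ s : ℝ, |s| = 1 ∧ s * a c = |a c| := by
    rcases le_total 0 (a c) with h | h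
    · exact ⟨1, by simp, by rw [abs_of_nonneg h, one_mul]⟩
    · exact ⟨-1, by simp, by rw [abs_of_nonpos h]; ring⟩
  obtain ⟨s, hs1, hsc⟩ := hs
  have hss : s * s = 1 := by rw [← abs_mul_abs_self s, hs1, one_mul]
  have hn : ‖(s * (r / 2)) • u‖ ≤ r / 2 := by
    rw [norm_smul, Real.norm_eq_abs, abs_mul, hs1, one_mul, abs_of_nonneg (by positivity)]
    nlinarith [norm_nonneg u]
  refine ⟨c + (s * (r / 2)) • u, fun x hx => ?_, fun x hx => ?_⟩
  · rw [Metric.mem_closedBall] at hx ⊢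
    have := dist_triangle x (c + (s * (r / 2)) • u) c
    rw [dist_self_add_left] at this
    linarith
  · rw [Metric.mem_closedBall, dist_eq_norm] at hx
    have h1 : a x = a c + inner ℝ e ((x - (c + (s * (r / 2)) • u)) + (s * (r / 2)) • u) := by
      have := ha x c
      rw [show (x - (c + (s * (r / 2)) • u)) + (s * (r / 2)) • u = x - c by module]
      linarith
    rw [inner_add_right, inner_smul_right, hue] at h1
    have h2 := abs_real_inner_le_norm e (x - (c + (s * (r / 2)) • u))
    have h3 : |s * a x| = |a x| := by rw [abs_mul, hs1, one_mul]
    have h4 : s * a x = |a c| + s * inner ℝ e (x - (c + (s * (r / 2)) • u))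
        + (r / 2) * ‖e‖ := by
      rw [h1, mul_add, hsc, mul_add]
      linear_combination ((r / 2) * ‖e‖) * hss
    have h5 : |s * inner ℝ e (x - (c + (s * (r / 2)) • u))| ≤ ‖e‖ * (r / 4) := by
      rw [abs_mul, hs1, one_mul]
      exact h2.trans (by gcongr)
    have h6 := neg_le_of_abs_le h5
    rw [← h3]
    refine le_trans ?_ (le_abs_self _)
    rw [h4]
    linarith

theorem volume_real_closedBall (x : EuclideanSpace ℝ (Fin d)) {r : ℝ} (hr : 0 ≤ r) :
    volume.real (Metric.closedBall x r)
      = r ^ d * volume.real (Metric.ball (0 : EuclideanSpace ℝ (Fin d)) 1) := by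
  rw [Measure.addHaar_real_closedBall _ _ hr, finrank_euclideanSpace_fin]

theorem volume_real_unitBall_pos :
    0 < volume.real (Metric.ball (0 : EuclideanSpace ℝ (Fin d)) 1) :=
  ENNReal.toReal_pos (Metric.measure_ball_pos _ _ one_pos).ne' measure_ball_lt_top.ne

theorem volume_real_closedBall_mul (x y : EuclideanSpace ℝ (Fin d)) {r k : ℝ} (hr : 0 ≤ r)
    (hk : 0 ≤ k) :
    volume.real (Metric.closedBall x (k * r)) = k ^ d * volume.real (Metric.closedBall y r) := by
  rw [volume_real_closedBall _ (by positivity), volume_real_closedBall _ hr]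
  ring

/-- A lower bound on a subset gives a lower bound for the integral. -/
theorem mul_volume_le_setIntegral {f : EuclideanSpace ℝ (Fin d) → ℝ}
    {B K : Set (EuclideanSpace ℝ (Fin d))} {m : ℝ} (hB : MeasurableSet B)
    (hK : MeasurableSet K) (hBK : B ⊆ K)
    (hBv : volume B ≠ ⊤) (hf : IntegrableOn f K) (h0 : ∀ x ∈ K, 0 ≤ f x)
    (hm : ∀ x ∈ B, m ≤ f x) : volume.real B * m ≤ ∫ x in K, f x := by
  calc volume.real B * m = ∫ _ in B, m := by simp
    _ ≤ ∫ x in B, f x := setIntegral_mono_on (integrableOn_const hBv)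
        (hf.mono_set hBK) hB hm
    _ ≤ ∫ x in K, f x := setIntegral_mono_set hf
        ((ae_restrict_mem hK).mono h0) (Filter.Eventually.of_forall hBK)

theorem continuous_of_gradient {a : EuclideanSpace ℝ (Fin d) → ℝ} {e : EuclideanSpace ℝ (Fin d)}
    (ha : ∀ x y, a x - a y = inner ℝ e (x - y)) : Continuous a := by
  have : a = fun x => a 0 + inner ℝ e x := by
    funext x
    have := ha x 0
    rw [sub_zero] at this
    linarith
  rw [this]
  fun_prop

theorem volume_real_le_of_subset_closedBall {K : Set (EuclideanSpace ℝ (Fin d))}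
    {c y : EuclideanSpace ℝ (Fin d)} {r k : ℝ} (hr : 0 ≤ r) (hk : 0 ≤ k)
    (hK : K ⊆ Metric.closedBall c (k * r)) :
    volume.real K ≤ k ^ d * volume.real (Metric.closedBall y r) := by
  rw [← volume_real_closedBall_mul c y hr hk]
  exact measureReal_mono hK measure_closedBall_lt_top.ne

/-- The inverse estimate between point values and the `L²` norm of an affine function on a shape
regular body. -/
theorem volume_mul_sq_le_setIntegral_sq {a : EuclideanSpace ℝ (Fin d) → ℝ}
    {e c : EuclideanSpace ℝ (Fin d)} {r σ : ℝ} {K : Set (EuclideanSpace ℝ (Fin d))}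
    (ha : ∀ x y, a x - a y = inner ℝ e (x - y)) (hr : 0 ≤ r) (hσ : 1 ≤ σ) (hK : IsCompact K)
    (hcK : Metric.closedBall c r ⊆ K) (hKc : K ⊆ Metric.closedBall c (σ * r))
    {z : EuclideanSpace ℝ (Fin d)} (hz : z ∈ K) :
    volume.real K * a z ^ 2 ≤ (4 * σ) ^ (d + 2) * ∫ x in K, a x ^ 2 := by
  obtain ⟨y, hy, hya⟩ := exists_closedBall_le_abs_affine (c := c) ha hr
  have hcont := continuous_of_gradient ha
  have h1 : volume.real (Metric.closedBall y (r / 4)) * (|a c| + ‖e‖ * (r / 4)) ^ 2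
      ≤ ∫ x in K, a x ^ 2 := by
    refine mul_volume_le_setIntegral measurableSet_closedBall hK.measurableSet (hy.trans hcK)
      measure_closedBall_lt_top.ne (ContinuousOn.integrableOn_compact hK (by fun_prop))
      (fun x _ => sq_nonneg _) fun x hx => ?_
    rw [← sq_abs (a x)]
    exact pow_le_pow_left₀ (by positivity) (hya x hx) 2
  -- Here |a z| ≤ |a c| + ‖e‖σr, and σr = 4σ · (r/4) produces the factor 4σ.
  have h2 : |a z| ≤ 4 * σ * (|a c| + ‖e‖ * (r / 4)) := by
    have hzc := hKc hz
    rw [Metric.mem_closedBall, dist_eq_norm] at hzc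
    have : |a z| ≤ |a c| + ‖e‖ * (σ * r) := by
      have h3 : a z = a c + inner ℝ e (z - c) := by rw [← ha]; ring
      rw [h3]
      exact (abs_add_le _ _).trans (by gcongr; exact (abs_real_inner_le_norm _ _).trans (by gcongr))
    nlinarith [abs_nonneg (a c)]
  have h3 : volume.real K ≤ (4 * σ) ^ d * volume.real (Metric.closedBall y (r / 4)) :=
    volume_real_le_of_subset_closedBall (by positivity) (by positivity)
      (hKc.trans_eq (by congr 1; ring))
  calc volume.real K * a z ^ 2 ≤ ((4 * σ) ^ d * volume.real (Metric.closedBall y (r / 4)))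
        * (4 * σ * (|a c| + ‖e‖ * (r / 4))) ^ 2 := by
        rw [← sq_abs (a z)]; gcongr
    _ = (4 * σ) ^ (d + 2) * (volume.real (Metric.closedBall y (r / 4))
        * (|a c| + ‖e‖ * (r / 4)) ^ 2) := by ring
    _ ≤ _ := by gcongr

/-- The squared mean oscillation `∫_{|u| ≤ 4t} |v(x) - v(x + u)|² du` of `v` around `x`. -/
def localOsc (v : EuclideanSpace ℝ (Fin d) → ℝ) (t : ℝ) (x : EuclideanSpace ℝ (Fin d)) : ℝ :=
  ∫ u in Metric.closedBall (0 : EuclideanSpace ℝ (Fin d)) (4 * t), (v x - v (x + u)) ^ 2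

theorem localOsc_nonneg (v : EuclideanSpace ℝ (Fin d) → ℝ) (t : ℝ)
    (x : EuclideanSpace ℝ (Fin d)) : 0 ≤ localOsc v t x :=
  setIntegral_nonneg measurableSet_closedBall fun _ _ => sq_nonneg _

theorem continuous_localOsc {v : EuclideanSpace ℝ (Fin d) → ℝ} (hv : Continuous v) (t : ℝ) :
    Continuous (localOsc v t) :=
  continuous_parametric_integral_of_continuous (by fun_prop) (isCompact_closedBall _ _)

theorem mul_volume_le_localOsc {v : EuclideanSpace ℝ (Fin d) → ℝ} (hv : Continuous v) {t m : ℝ}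
    {x : EuclideanSpace ℝ (Fin d)} {B : Set (EuclideanSpace ℝ (Fin d))} (hB : MeasurableSet B)
    (hBt : B ⊆ Metric.closedBall 0 (4 * t))
    (hm : ∀ u ∈ B, m ≤ (v x - v (x + u)) ^ 2) : volume.real B * m ≤ localOsc v t x :=
  mul_volume_le_setIntegral hB measurableSet_closedBall hBt
    (measure_ne_top_of_subset hBt measure_closedBall_lt_top.ne)
    (ContinuousOn.integrableOn_compact (isCompact_closedBall _ _) (by fun_prop))
    (fun _ _ => sq_nonneg _) hm

/-- On a shape regular body of size at least `ρ`, the gradient of an affine function is controlled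
by the mean oscillation. -/
theorem volume_mul_norm_gradient_sq_le {v a : EuclideanSpace ℝ (Fin d) → ℝ} (hv : Continuous v)
    {e c : EuclideanSpace ℝ (Fin d)} {r σ t ρ : ℝ} {K : Set (EuclideanSpace ℝ (Fin d))}
    (ha : ∀ x y, a x - a y = inner ℝ e (x - y)) (hr : 0 ≤ r) (hσ : 1 ≤ σ) (hK : IsCompact K)
    (hcK : Metric.closedBall c r ⊆ K) (hKc : K ⊆ Metric.closedBall c (σ * r))
    (hva : ∀ x ∈ K, v x = a x) (hρ : 0 ≤ ρ) (hρr : ρ ≤ r / 2) (hρt : ρ ≤ t) :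
    volume.real K * ‖e‖ ^ 2 * ρ ^ (d + 2)
        * volume.real (Metric.ball (0 : EuclideanSpace ℝ (Fin d)) 1)
      ≤ (2 * σ) ^ d * 4 ^ (d + 2) * ∫ x in K, localOsc v t x := by
  set β := volume.real (Metric.ball (0 : EuclideanSpace ℝ (Fin d)) 1)
  -- Restricting x to the half ball keeps x + u inside K for ‖u‖ ≤ ρ ≤ r/2, so v is affine along the
  -- increment. A ball of increments of radius ρ/4 then sees a change of at least ‖e‖ρ/4.
  have hx : ∀ x ∈ Metric.closedBall c (r / 2),
      (ρ / 4) ^ d * β * (‖e‖ * (ρ / 4)) ^ 2 ≤ localOsc v t x := by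
    intro x hx
    obtain ⟨y, hy, hya⟩ := exists_closedBall_le_abs_affine (a := fun u => inner ℝ e u) (e := e)
      (c := 0) (r := ρ) (fun x y => (inner_sub_right _ _ _).symm) hρ
    rw [← volume_real_closedBall y (by positivity)]
    refine mul_volume_le_localOsc hv measurableSet_closedBall
      (hy.trans (Metric.closedBall_subset_closedBall (by linarith))) fun u hu => ?_
    have hu0 := hy hu
    rw [mem_closedBall_zero_iff] at hu0
    rw [Metric.mem_closedBall] at hx
    have hxK : x ∈ K := hcK (by rw [Metric.mem_closedBall]; linarith)
    have hxuK : x + u ∈ K := hcK (by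
      rw [Metric.mem_closedBall]
      have := dist_triangle (x + u) x c
      rw [dist_self_add_left] at this
      linarith)
    have h1 := hya u hu
    rw [hva x hxK, hva _ hxuK, ha]
    simp only [inner_zero_right, abs_zero, zero_add, sub_add_cancel_left, inner_neg_right,
      even_two, Even.neg_pow] at h1 ⊢
    rw [← sq_abs (inner ℝ e u)]
    gcongr
  have h2 : volume.real (Metric.closedBall c (r / 2)) * ((ρ / 4) ^ d * β * (‖e‖ * (ρ / 4)) ^ 2)
      ≤ ∫ x in K, localOsc v t x :=
    mul_volume_le_setIntegral measurableSet_closedBall hK.measurableSet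
      ((Metric.closedBall_subset_closedBall (by linarith)).trans hcK)
      measure_closedBall_lt_top.ne
      ((continuous_localOsc hv t).continuousOn.integrableOn_compact hK)
      (fun x _ => localOsc_nonneg v t x) hx
  have h3 : volume.real K ≤ (2 * σ) ^ d * volume.real (Metric.closedBall c (r / 2)) :=
    volume_real_le_of_subset_closedBall (by positivity) (by positivity)
      (hKc.trans_eq (by congr 1; ring))
  calc volume.real K * ‖e‖ ^ 2 * ρ ^ (d + 2) * β
      ≤ ((2 * σ) ^ d * volume.real (Metric.closedBall c (r / 2))) * ‖e‖ ^ 2 * ρ ^ (d + 2) * β := by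
        gcongr
    _ = (2 * σ) ^ d * 4 ^ (d + 2) * (volume.real (Metric.closedBall c (r / 2))
        * ((ρ / 4) ^ d * β * (‖e‖ * (ρ / 4)) ^ 2)) := by
        rw [div_pow ρ 4 d, pow_add, pow_add]
        field_simp
    _ ≤ _ := by gcongr

end AffineOnBalls

/-! ### Comparability of the elements meeting at a vertex. -/

section Grading

variable {d : ℕ} {Ω : Set (EuclideanSpace ℝ (Fin d))}
  {T : Geometry.SimplicialComplex ℝ (EuclideanSpace ℝ (Fin d))}
  {t t' : Finset (EuclideanSpace ℝ (Fin d))}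

/-- The barycentric coordinate of p takes values in [0, 1] on the inscribed ball, so its gradient is
at most 1/(2r). Yet it drops from 1 to 0 between p and q. Every edge is therefore comparable to the
diameter, which lets a shared edge compare two elements. -/
theorem two_mul_le_dist_vertices (ht : t ∈ meshElements T) {c p q : EuclideanSpace ℝ (Fin d)}
    {r : ℝ} (hr : 0 ≤ r)
    (hc : Metric.closedBall c r ⊆ convexHull ℝ (t : Set (EuclideanSpace ℝ (Fin d))))
    (hp : p ∈ t) (hq : q ∈ t) (hpq : p ≠ q) : 2 * r ≤ dist p q := by
  obtain ⟨e, he⟩ := exists_gradient_affineMap (baryCoord ht p)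
  have h1 : 2 * r * ‖e‖ ≤ 1 := two_mul_norm_gradient_le he hr hc fun x hx y hy => by
    rw [abs_le]
    constructor <;> linarith [baryCoord_nonneg ht hx p, baryCoord_nonneg ht hy p,
      baryCoord_le_one ht hx p, baryCoord_le_one ht hy p]
  have h2 := he p q
  rw [baryCoord_self ht hp, baryCoord_of_ne ht hq hpq, sub_zero] at h2
  have h3 : 1 ≤ ‖e‖ * dist p q := by
    rw [h2, dist_eq_norm]; exact real_inner_le_norm _ _
  have h4 : 0 < ‖e‖ := by
    rcases (norm_nonneg e).eq_or_lt with h | h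
    · rw [← h, zero_mul] at h3; linarith
    · exact h
  have : ‖e‖ * (2 * r) ≤ ‖e‖ * dist p q := by linarith
  exact le_of_mul_le_mul_left this h4

theorem isBounded_convexHull_finset (t : Finset (EuclideanSpace ℝ (Fin d))) :
    Bornology.IsBounded (convexHull ℝ (t : Set (EuclideanSpace ℝ (Fin d)))) :=
  (isCompact_convexHull_finset t).isBounded

/-- Elements sharing an edge have comparable diameters. -/
theorem IsShapeRegular.diam_le_of_edge {σ : ℝ} (h : IsShapeRegular σ T) (hσ : 1 ≤ σ)
    (ht : t ∈ meshElements T) {p q : EuclideanSpace ℝ (Fin d)}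
    (hp : p ∈ t) (hq : q ∈ t) (hp' : p ∈ t') (hq' : q ∈ t') (hpq : p ≠ q) :
    Metric.diam (convexHull ℝ (t : Set (EuclideanSpace ℝ (Fin d))))
      ≤ σ * Metric.diam (convexHull ℝ (t' : Set (EuclideanSpace ℝ (Fin d)))) := by
  obtain ⟨c, r, hr, hc, hd⟩ := h.exists_ball t ht
  have h1 := two_mul_le_dist_vertices ht hr.le hc hp hq hpq
  have h2 := Metric.dist_le_diam_of_mem (isBounded_convexHull_finset t')
    (subset_convexHull ℝ _ hp') (subset_convexHull ℝ _ hq')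
  refine hd.trans ?_
  gcongr
  linarith

theorem notMem_interior_of_vertex (hd : 1 ≤ d) (ht : t ∈ meshElements T)
    {z : EuclideanSpace ℝ (Fin d)} (hz : z ∈ t) :
    z ∉ interior (convexHull ℝ (t : Set (EuclideanSpace ℝ (Fin d)))) := by
  intro hzi
  obtain ⟨p, hp, hpz⟩ := Finset.exists_mem_ne (by rw [ht.2]; omega) z
  have h := baryCoord_pos_of_mem_interior ht hzi hp
  rw [baryCoord_of_ne ht hz hpz] at h
  exact lt_irrefl _ h

theorem diam_convexHull_pos (hd : 1 ≤ d) (ht : t ∈ meshElements T) :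
    0 < Metric.diam (convexHull ℝ (t : Set (EuclideanSpace ℝ (Fin d)))) := by
  obtain ⟨z, hz⟩ := Finset.card_pos.1 (by rw [ht.2]; omega : 0 < t.card)
  obtain ⟨p, hp, hpz⟩ := Finset.exists_mem_ne (by rw [ht.2]; omega) z
  exact (dist_pos.2 hpz).trans_le (Metric.dist_le_diam_of_mem (isBounded_convexHull_finset t)
    (subset_convexHull ℝ _ hp) (subset_convexHull ℝ _ hz))

/-- The number of elements at a vertex is bounded in terms of the shape regularity constant. -/
theorem IsShapeRegular.card_le {σ : ℝ} (h : IsShapeRegular σ T) (hd : 1 ≤ d) (hσ : 1 ≤ σ)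
    (z : EuclideanSpace ℝ (Fin d)) (F : Finset (Finset (EuclideanSpace ℝ (Fin d))))
    (hF : ∀ t ∈ F, t ∈ meshElements T ∧ z ∈ t) : (F.card : ℝ) ≤ σ ^ d := by
  -- Each element is rescaled about z to diameter 1. It then lies in the unit ball around z and
  -- contains a ball of radius 1/σ, so a volume count applies once these balls are known to be
  -- disjoint.
  have hex : ∀ t ∈ F, ∃ y : EuclideanSpace ℝ (Fin d),
      Metric.closedBall y (1 / σ) ⊆ Metric.closedBall z 1 ∧
      ∀ x ∈ Metric.ball y (1 / σ), ∃ D : ℝ, 0 < D ∧ z + D • (x - z) ∈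
        interior (convexHull ℝ (t : Set (EuclideanSpace ℝ (Fin d)))) := by
    intro t htF
    obtain ⟨ht, hz⟩ := hF t htF
    obtain ⟨c, r, hr, hc, hdr⟩ := h.exists_ball t ht
    have hD := diam_convexHull_pos hd ht
    set D := Metric.diam (convexHull ℝ (t : Set (EuclideanSpace ℝ (Fin d))))
    have key : ∀ x : EuclideanSpace ℝ (Fin d), z + D • (x - z) - c
        = D • (x - (z + D⁻¹ • (c - z))) := by
      intro x
      have : c - z = D • D⁻¹ • (c - z) := by rw [smul_smul, mul_inv_cancel₀ hD.ne', one_smul]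
      calc z + D • (x - z) - c = D • (x - z) - (c - z) := by abel
        _ = D • (x - z) - D • D⁻¹ • (c - z) := by rw [← this]
        _ = _ := by module
    have hDσ : D * (1 / σ) ≤ r := by
      rw [mul_one_div, div_le_iff₀ (by positivity)]; linarith
    refine ⟨z + D⁻¹ • (c - z), fun x hx => ?_, fun x hx => ⟨D, hD, ?_⟩⟩
    · rw [Metric.mem_closedBall, dist_eq_norm] at hx
      have hmem : z + D • (x - z) ∈ convexHull ℝ (t : Set (EuclideanSpace ℝ (Fin d))) := by
        apply hc
        rw [Metric.mem_closedBall, dist_eq_norm, key, norm_smul, Real.norm_eq_abs, abs_of_pos hD]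
        exact (mul_le_mul_of_nonneg_left hx hD.le).trans hDσ
      have h1 := Metric.dist_le_diam_of_mem (isBounded_convexHull_finset t) hmem
        (subset_convexHull ℝ _ hz)
      rw [dist_self_add_left, norm_smul, Real.norm_eq_abs, abs_of_pos hD] at h1
      rw [Metric.mem_closedBall, dist_eq_norm]
      have : D * ‖x - z‖ ≤ D * 1 := by rw [mul_one]; exact h1
      exact le_of_mul_le_mul_left this hD
    · rw [Metric.mem_ball, dist_eq_norm] at hx
      refine interior_mono hc (Metric.ball_subset_interior_closedBall ?_)
      rw [Metric.mem_ball, dist_eq_norm, key, norm_smul, Real.norm_eq_abs, abs_of_pos hD]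
      exact (mul_lt_mul_of_pos_left hx hD).trans_le hDσ
  choose! y hy hyD using hex
  -- The elements are rescaled by different factors, but z belongs to both. By convexity, shrinking
  -- towards z keeps an interior point interior, so a common point of the rescaled interiors gives
  -- one of the original interiors.
  have hmeet : ∀ t ∈ F, ∀ t' ∈ F, ∀ x (D D' : ℝ), 0 < D → D ≤ D' →
      z + D • (x - z) ∈ interior (convexHull ℝ (t : Set (EuclideanSpace ℝ (Fin d)))) →
      z + D' • (x - z) ∈ interior (convexHull ℝ (t' : Set (EuclideanSpace ℝ (Fin d)))) →
      t = t' := by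
    intro t htF t' htF' x D D' hD hDD' hx hx'
    by_contra hne
    have hD' : 0 < D' := hD.trans_le hDD'
    refine Set.disjoint_left.1
      (disjoint_interior_convexHull (hF t htF).1 (hF t' htF').1 hne) hx (interior_subset ?_)
    have h2 := (convex_convexHull ℝ _).combo_interior_self_mem_interior hx'
      (subset_convexHull ℝ _ (hF t' htF').2) (a := D / D') (b := 1 - D / D') (by positivity)
      (by rw [sub_nonneg, div_le_one hD']; exact hDD') (by ring)
    convert h2 using 1
    rw [smul_add, smul_smul, div_mul_cancel₀ _ hD'.ne']
    module
  have hdisj : Set.PairwiseDisjoint (F : Set (Finset (EuclideanSpace ℝ (Fin d))))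
      fun t => Metric.ball (y t) (1 / σ) := by
    intro t htF t' htF' hne
    rw [Function.onFun, Set.disjoint_left]
    intro x hx hx'
    obtain ⟨D, hD, hxD⟩ := hyD t htF x hx
    obtain ⟨D', hD', hxD'⟩ := hyD t' htF' x hx'
    rcases le_total D D' with hle | hle
    · exact hne (hmeet t htF t' htF' x D D' hD hle hxD hxD')
    · exact hne (hmeet t' htF' t htF x D' D hD' hle hxD' hxD).symm
  have hvol : ∑ t ∈ F, volume.real (Metric.ball (y t) (1 / σ))
      ≤ volume.real (Metric.closedBall z 1) := by
    rw [← measureReal_biUnion_finset hdisj (fun _ _ => measurableSet_ball)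
      (fun _ _ => measure_ball_lt_top.ne)]
    refine measureReal_mono (Set.iUnion₂_subset fun t ht => ?_) measure_closedBall_lt_top.ne
    exact Metric.ball_subset_closedBall.trans (hy t ht)
  have hβ := volume_real_unitBall_pos (d := d)
  have hσ0 : 0 < 1 / σ := by positivity
  rw [volume_real_closedBall _ zero_le_one, one_pow, one_mul] at hvol
  have hball : ∀ t ∈ F, volume.real (Metric.ball (y t) (1 / σ))
      = (1 / σ) ^ d * volume.real (Metric.ball (0 : EuclideanSpace ℝ (Fin d)) 1) := by
    intro t _
    rw [measureReal_def, Measure.addHaar_ball_of_pos _ _ hσ0, finrank_euclideanSpace_fin,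
      ENNReal.toReal_mul, ENNReal.toReal_ofReal (by positivity), measureReal_def]
  rw [Finset.sum_congr rfl hball, Finset.sum_const, nsmul_eq_mul, ← mul_assoc] at hvol
  have h1 : (F.card : ℝ) * (1 / σ) ^ d ≤ 1 := by
    by_contra! hlt
    nlinarith
  rwa [one_div, inv_pow, ← div_eq_mul_inv, div_le_one (by positivity)] at h1

theorem isPreconnected_union_three_segments {E : Type*} [NormedAddCommGroup E] [NormedSpace ℝ E]
    (a b c e : E) : IsPreconnected (segment ℝ a b ∪ segment ℝ b c ∪ segment ℝ c e) :=
  ((convex_segment a b).isPreconnected.union b (right_mem_segment ℝ a b)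
    (left_mem_segment ℝ b c) (convex_segment b c).isPreconnected).union c
    (Or.inr (right_mem_segment ℝ b c)) (left_mem_segment ℝ c e)
    (convex_segment c e).isPreconnected

/-- A Lipschitz domain of dimension at least two is locally connected at each point of its closure,
also after removing that point. -/
theorem IsBoundedLipschitzDomain.exists_isPreconnected (hd : 2 ≤ d)
    (hΩ : IsBoundedLipschitzDomain Ω) {z : EuclideanSpace ℝ (Fin d)} (hz : z ∈ closure Ω)
    {ε : ℝ} (hε : 0 < ε) :
    ∃ δ > 0, ∀ s, 0 < s → s < δ → ∀ x ∈ Ω, ∀ x' ∈ Ω, dist x z = s → dist x' z = s →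
      ∃ P, IsPreconnected P ∧ x ∈ P ∧ x' ∈ P ∧ P ⊆ (Ω ∩ Metric.ball z ε) \ {z} := by
  by_cases hzΩ : z ∈ Ω
  -- At an interior point a small sphere does the job; it is connected because d ≥ 2.
  · obtain ⟨δ, hδ, hball⟩ := Metric.isOpen_iff.1 hΩ.isOpen z hzΩ
    refine ⟨min δ ε, by positivity, fun s hs hsδ x _ x' _ hx hx' =>
      ⟨Metric.sphere z s, isPreconnected_sphere ?_ z s, hx, hx', fun y hy => ?_⟩⟩
    · rw [← Module.finrank_eq_rank, finrank_euclideanSpace_fin]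
      exact_mod_cast hd
    · rw [Metric.mem_sphere] at hy
      refine ⟨⟨hball ?_, ?_⟩, ?_⟩
      · rw [Metric.mem_ball, hy]; exact hsδ.trans_le (min_le_left _ _)
      · rw [Metric.mem_ball, hy]; exact hsδ.trans_le (min_le_right _ _)
      · rintro rfl
        rw [dist_self] at hy
        exact hs.ne hy
  · have hzf : z ∈ frontier Ω := by rw [hΩ.isOpen.frontier_eq]; exact ⟨hz, hzΩ⟩
    obtain ⟨U, ν, L, φ, hU, hzU, hν, hφ, hUΩ⟩ := hΩ.lipschitz_boundary z hzf
    obtain ⟨ρ, hρ, hball⟩ := Metric.isOpen_iff.1 hU z hzU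
    have hL : (0 : ℝ) ≤ L := L.2
    have hνν : inner ℝ ν ν = (1 : ℝ) := by rw [real_inner_self_eq_norm_sq, hν]; norm_num
    refine ⟨min ρ ε / (5 + 4 * L), by positivity, fun s hs hsδ x hx x' hx' hxs hxs' => ?_⟩
    rw [lt_div_iff₀ (by positivity)] at hsδ
    -- At a boundary point the path goes up by l along ν, across, and down again. The height l
    -- exceeds the change of height and graph over the distance 2s, and the bound on s keeps the
    -- path, which reaches at most s + l = (5 + 4L)s, inside both balls. It avoids z because it
    -- stays in Ω.
    set l : ℝ := 4 * (1 + L) * s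
    have hl : 0 ≤ l := by positivity
    have hsl : s + l < min ρ ε := by
      have : s + l = s * (5 + 4 * L) := by simp only [l]; ring
      linarith
    -- membership criterion
    have hmem : ∀ w y : EuclideanSpace ℝ (Fin d), ∀ μ : ℝ, w ∈ Ω → dist w z ≤ s → dist y z ≤ s →
        0 ≤ μ → μ ≤ l → (y = w ∨ μ = l) → y + μ • ν ∈ (Ω ∩ Metric.ball z ε) \ {z} := by
      intro w y μ hw hwz hyz hμ hμl hor
      have hnorm : dist (y + μ • ν) z < min ρ ε := by
        calc dist (y + μ • ν) z ≤ dist (y + μ • ν) y + dist y z := dist_triangle _ _ _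
          _ ≤ μ + s := by
            rw [dist_self_add_left, norm_smul, hν, mul_one, Real.norm_eq_abs, abs_of_nonneg hμ]
            gcongr
          _ < _ := by linarith
      have hwU : w ∈ U := hball (by
        rw [Metric.mem_ball]
        linarith [min_le_left ρ ε])
      have hyU : y + μ • ν ∈ U := hball (hnorm.trans_le (min_le_left _ _))
      have h1 := (hUΩ w hwU).1 hw
      have h2 := hφ.le_add_norm_along hν (y + μ • ν) w μ
      have h3 : y + μ • ν - w - μ • ν = y - w := by module
      have h4 : inner ℝ ν (y + μ • ν) = inner ℝ ν w + inner ℝ ν (y - w) + μ := by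
        rw [inner_add_right, inner_sub_right, inner_smul_right, hνν]; ring
      have h5 := real_inner_le_norm ν (w - y)
      rw [hν, one_mul, norm_sub_rev, ← neg_sub y w, inner_neg_right] at h5
      rw [h3] at h2
      have hΩ' : y + μ • ν ∈ Ω := by
        rw [hUΩ _ hyU]
        refine h2.trans_lt ?_
        rw [h4]
        rcases hor with rfl | rfl
        · rw [sub_self, norm_zero, inner_zero_right]
          linarith
        · have h6 : ‖y - w‖ ≤ 2 * s := by
            rw [← dist_eq_norm]
            linarith [dist_triangle_right y w z]
          have h7 : (L : ℝ) * ‖y - w‖ ≤ L * (2 * s) := by gcongr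
          have h8 : l = 4 * s + 4 * (L * s) := by simp only [l]; ring
          have h9 : 0 ≤ L * s := by positivity
          linarith
      exact ⟨⟨hΩ', hnorm.trans_le (min_le_right _ _)⟩, fun h => hzΩ (h ▸ hΩ')⟩
    refine ⟨segment ℝ x (x + l • ν) ∪ segment ℝ (x + l • ν) (x' + l • ν)
      ∪ segment ℝ (x' + l • ν) x', isPreconnected_union_three_segments _ _ _ _,
      Or.inl (Or.inl (left_mem_segment ℝ _ _)), Or.inr (right_mem_segment ℝ _ _), ?_⟩
    rintro p ((⟨a, b, ha, hb, hab, rfl⟩ | ⟨a, b, ha, hb, hab, rfl⟩) | ⟨a, b, ha, hb, hab, rfl⟩)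
    · have := hmem x x (b * l) hx hxs.le hxs.le (by positivity) (by nlinarith) (Or.inl rfl)
      convert this using 1
      rw [smul_add, ← add_assoc, ← add_smul, hab, one_smul, smul_smul]
    · have hy : dist (a • x + b • x') z ≤ s :=
        convex_closedBall z s (Metric.mem_closedBall.2 hxs.le) (Metric.mem_closedBall.2 hxs'.le)
          ha hb hab
      have := hmem x (a • x + b • x') l hx hxs.le hy hl le_rfl (Or.inr rfl)
      convert this using 1
      rw [smul_add, smul_add, add_add_add_comm, ← add_smul, hab, one_smul]
    · have := hmem x' x' (a * l) hx' hxs'.le hxs'.le (by positivity) (by nlinarith) (Or.inl rfl)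
      convert this using 1
      rw [smul_add, add_right_comm, ← add_smul, hab, one_smul, smul_smul]

/-- The points lie on the segment from z to the centre of the inscribed ball. Prescribing the
distance allows the same radius to be used in two elements, as the local connectedness statement
requires. -/
theorem exists_mem_interior_dist_eq (hd : 1 ≤ d) {σ : ℝ} (h : IsShapeRegular σ T)
    (ht : t ∈ meshElements T) {z : EuclideanSpace ℝ (Fin d)} (hz : z ∈ t) :
    ∃ δ > 0, ∀ s, 0 < s → s < δ →
      ∃ x ∈ interior (convexHull ℝ (t : Set (EuclideanSpace ℝ (Fin d)))), dist x z = s := by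
  obtain ⟨c, r, hr, hc, -⟩ := h.exists_ball t ht
  have hci : c ∈ interior (convexHull ℝ (t : Set (EuclideanSpace ℝ (Fin d)))) :=
    interior_mono hc (Metric.ball_subset_interior_closedBall (Metric.mem_ball_self hr))
  have hcz : 0 < dist c z := dist_pos.2 fun hcz =>
    notMem_interior_of_vertex hd ht hz (hcz ▸ hci)
  refine ⟨dist c z, hcz, fun s hs hsδ => ⟨(s / dist c z) • c + (1 - s / dist c z) • z,
    (convex_convexHull ℝ _).combo_interior_self_mem_interior hci (subset_convexHull ℝ _ hz)
      (by positivity) (by rw [sub_nonneg, div_le_one hcz]; exact hsδ.le) (by ring), ?_⟩⟩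
  rw [dist_eq_norm, show (s / dist c z) • c + (1 - s / dist c z) • z - z
    = (s / dist c z) • (c - z) by module, norm_smul, ← dist_eq_norm, Real.norm_eq_abs,
    abs_of_pos (by positivity), div_mul_cancel₀ _ hcz.ne']

/-- If the elements at a vertex are split into two classes, then some edge at the vertex is shared
by elements of both classes. -/
theorem IsTriangulation.exists_shared_edge (hd : 2 ≤ d) (hT : IsTriangulation Ω T)
    (hΩ : IsBoundedLipschitzDomain Ω) {σ : ℝ} (h : IsShapeRegular σ T)
    {z : EuclideanSpace ℝ (Fin d)} (C : Set (Finset (EuclideanSpace ℝ (Fin d))))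
    (ht : t ∈ meshElements T) (hz : z ∈ t) (htC : t ∈ C)
    (ht' : t' ∈ meshElements T) (hz' : z ∈ t') (htC' : t' ∉ C) :
    ∃ s ∈ meshElements T, z ∈ s ∧ s ∈ C ∧ ∃ s' ∈ meshElements T, z ∈ s' ∧ s' ∉ C ∧
      ∃ p, p ∈ s ∧ p ∈ s' ∧ p ≠ z := by
  by_contra! hcon
  have hfin := hT.finite_meshElements
  have hclosed : ∀ Q : Set (Finset (EuclideanSpace ℝ (Fin d))), Q ⊆ meshElements T →
      IsClosed (⋃ s ∈ Q, convexHull ℝ (s : Set (EuclideanSpace ℝ (Fin d)))) := fun Q hQ =>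
    (hfin.subset hQ).isClosed_biUnion fun s _ => isClosed_convexHull_finset s
  have hA := hclosed {s | s ∈ meshElements T ∧ z ∈ s ∧ s ∈ C} (fun s hs => hs.1)
  have hB := hclosed {s | s ∈ meshElements T ∧ z ∈ s ∧ s ∉ C} (fun s hs => hs.1)
  -- The elements without z as a vertex form a closed set that does not contain z, so a small ball
  -- around z meets only the two classes.
  have hN := hclosed {s | s ∈ meshElements T ∧ z ∉ s} (fun s hs => hs.1)
  have hzN : z ∉ ⋃ s ∈ {s | s ∈ meshElements T ∧ z ∉ s},
      convexHull ℝ (s : Set (EuclideanSpace ℝ (Fin d))) := by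
    simp only [Set.mem_iUnion, not_exists]
    rintro s ⟨hs, hzs⟩ hzc
    have hzv : z ∈ T.vertices := Geometry.SimplicialComplex.vertices_eq (K := T) ▸
      Set.mem_biUnion ht.1 hz
    exact hzs ((Geometry.SimplicialComplex.vertex_mem_convexHull_iff hzv hs.1).1 hzc)
  obtain ⟨ε, hε, hball⟩ := Metric.isOpen_iff.1 hN.isOpen_compl z hzN
  have hzcl : z ∈ closure Ω := hT.convexHull_subset ht (subset_convexHull ℝ _ hz)
  obtain ⟨δ, hδ, hP⟩ := hΩ.exists_isPreconnected hd hzcl hε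
  obtain ⟨δ₁, hδ₁, h₁⟩ := exists_mem_interior_dist_eq (by omega) h ht hz
  obtain ⟨δ₂, hδ₂, h₂⟩ := exists_mem_interior_dist_eq (by omega) h ht' hz'
  obtain ⟨s, hs0, hs⟩ : ∃ s, 0 < s ∧ s < min δ (min δ₁ δ₂) := exists_between (by positivity)
  obtain ⟨x, hx, hxs⟩ := h₁ s hs0 (hs.trans_le ((min_le_right _ _).trans (min_le_left _ _)))
  obtain ⟨x', hx', hxs'⟩ := h₂ s hs0 (hs.trans_le ((min_le_right _ _).trans (min_le_right _ _)))
  have hint : ∀ t ∈ meshElements T,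
      interior (convexHull ℝ (t : Set (EuclideanSpace ℝ (Fin d)))) ⊆ Ω := fun t ht =>
    (interior_mono (hT.convexHull_subset ht)).trans hΩ.interior_closure.subset
  obtain ⟨P, hPc, hxP, hxP', hPsub⟩ := hP s hs0 (hs.trans_le (min_le_left _ _)) x
    (hint t ht hx) x' (hint t' ht' hx') hxs hxs'
  -- A connected set avoiding z is covered by the two closed classes and meets both, so it meets
  -- their intersection. Without a shared edge, conformity reduces that intersection to z.
  obtain ⟨y, hyP, hyA, hyB⟩ := isPreconnected_closed_iff.1 hPc _ _ hA hB (fun y hy => by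
      obtain ⟨s, hs, hys⟩ := hT.exists_meshElement (subset_closure (hPsub hy).1.1)
      have hyN := hball (hPsub hy).1.2
      by_cases hzs : z ∈ s
      · by_cases hsC : s ∈ C
        · exact Or.inl (Set.mem_iUnion₂.2 ⟨_, ⟨hs, hzs, hsC⟩, hys⟩)
        · exact Or.inr (Set.mem_iUnion₂.2 ⟨_, ⟨hs, hzs, hsC⟩, hys⟩)
      · exact absurd (Set.mem_iUnion₂.2 ⟨_, ⟨hs, hzs⟩, hys⟩) hyN)
    ⟨x, hxP, Set.mem_iUnion₂.2 ⟨_, ⟨ht, hz, htC⟩, (interior_subset hx)⟩⟩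
    ⟨x', hxP', Set.mem_iUnion₂.2 ⟨_, ⟨ht', hz', htC'⟩, (interior_subset hx')⟩⟩
  obtain ⟨a, ⟨ha, hza, haC⟩, hya⟩ := Set.mem_iUnion₂.1 hyA
  obtain ⟨b, ⟨hb, hzb, hbC⟩, hyb⟩ := Set.mem_iUnion₂.1 hyB
  have hsub : (a ∩ b : Set (EuclideanSpace ℝ (Fin d))) ⊆ {z} := fun p hp =>
    hcon a ha hza haC b hb hzb hbC p hp.1 hp.2
  have hyz := convexHull_mono hsub (T.inter_subset_convexHull ha.1 hb.1 ⟨hya, hyb⟩)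
  rw [convexHull_singleton] at hyz
  exact (hPsub hyP).2 hyz

/-- Elements sharing a vertex have comparable diameters. -/
theorem IsShapeRegular.diam_le_of_vertex (hd : 1 ≤ d) (hT : IsTriangulation Ω T)
    (hΩ : IsBoundedLipschitzDomain Ω) {σ : ℝ} (h : IsShapeRegular σ T) (hσ : 1 ≤ σ)
    (ht : t ∈ meshElements T) (ht' : t' ∈ meshElements T) {z : EuclideanSpace ℝ (Fin d)}
    (hz : z ∈ t) (hz' : z ∈ t') :
    Metric.diam (convexHull ℝ (t : Set (EuclideanSpace ℝ (Fin d))))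
      ≤ σ ^ ⌈σ ^ d⌉₊ * Metric.diam (convexHull ℝ (t' : Set (EuclideanSpace ℝ (Fin d)))) := by
  have hpow : ∀ k : ℕ, (k : ℝ) ≤ σ ^ d → σ ^ k ≤ σ ^ ⌈σ ^ d⌉₊ := fun k hk =>
    pow_le_pow_right₀ hσ (by exact_mod_cast hk.trans (Nat.le_ceil _))
  rcases hd.eq_or_lt with hd1 | hd2
  -- In dimension one the endpoint cannot be bypassed, and comparability is part of the definition.
  -- The factor σ is absorbed because the exponent is at least 1.
  · refine (h.comparable_of_dim_one hd1.symm t ht t' ht' ⟨z, hz, hz'⟩).trans ?_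
    gcongr
    simpa using hpow 1 (by simpa using one_le_pow₀ hσ)
  let S := {s : Finset (EuclideanSpace ℝ (Fin d)) // s ∈ meshElements T ∧ z ∈ s}
  have hSfin : {s | s ∈ meshElements T ∧ z ∈ s}.Finite :=
    hT.finite_meshElements.subset fun s hs => hs.1
  have : Fintype S := hSfin.fintype
  -- Each adjacency is a shared edge at z and costs one factor σ. The graph is connected, and a path
  -- without repetitions is shorter than the number of its vertices, at most σ^d.
  let G : SimpleGraph S := SimpleGraph.fromRel fun a b => ∃ p, p ∈ a.1 ∧ p ∈ b.1 ∧ p ≠ z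
  have hreach : G.Reachable ⟨t, ht, hz⟩ ⟨t', ht', hz'⟩ := by
    by_contra hnot
    obtain ⟨s, hs, hzs, ⟨_, hsC⟩, s', hs', hzs', hsC', hp⟩ := hT.exists_shared_edge hd2 hΩ h
      {s | ∃ hs : s ∈ meshElements T ∧ z ∈ s, G.Reachable ⟨t, ht, hz⟩ ⟨s, hs⟩} ht hz
      ⟨⟨ht, hz⟩, SimpleGraph.Reachable.refl _⟩ ht' hz' (fun ⟨_, hr⟩ => hnot hr)
    refine hsC' ⟨⟨hs', hzs'⟩, hsC.trans (SimpleGraph.Adj.reachable ?_)⟩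
    rw [SimpleGraph.fromRel_adj]
    refine ⟨fun heq => hsC' ?_, Or.inl hp⟩
    have : s = s' := congrArg Subtype.val heq
    exact this ▸ ⟨⟨hs, hzs⟩, hsC⟩
  obtain ⟨p, hp⟩ := hreach.exists_isPath
  have hlen := hp.length_lt
  have hcard : (Fintype.card S : ℝ) ≤ σ ^ d := by
    have hle := h.card_le hd hσ z hSfin.toFinset (fun s hs => hSfin.mem_toFinset.1 hs)
    rwa [@Set.Finite.card_toFinset _ _ this hSfin] at hle
  have hwalk : ∀ (a b : S) (p : G.Walk a b),
      Metric.diam (convexHull ℝ (a.1 : Set (EuclideanSpace ℝ (Fin d))))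
        ≤ σ ^ p.length * Metric.diam (convexHull ℝ (b.1 : Set (EuclideanSpace ℝ (Fin d)))) := by
    intro a b p
    induction p with
    | nil => simp
    | @cons a b c hab p ih =>
      rw [SimpleGraph.Walk.length_cons, pow_succ', mul_assoc]
      rw [SimpleGraph.fromRel_adj] at hab
      obtain ⟨q, hqa, hqb, hqz⟩ : ∃ q, q ∈ a.1 ∧ q ∈ b.1 ∧ q ≠ z := by
        rcases hab.2 with ⟨q, h1, h2, h3⟩ | ⟨q, h1, h2, h3⟩
        exacts [⟨q, h1, h2, h3⟩, ⟨q, h2, h1, h3⟩]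
      refine (h.diam_le_of_edge hσ a.2.1 hqa a.2.2 hqb b.2.2 hqz).trans ?_
      gcongr
  refine (hwalk _ _ p).trans ?_
  have := hpow p.length ((by exact_mod_cast hlen.le : (p.length : ℝ) ≤ Fintype.card S).trans hcard)
  gcongr

end Grading

/-! ### Local averages with a cut-off at the boundary. -/

section Smoothing

variable {d : ℕ} {Ω : Set (EuclideanSpace ℝ (Fin d))}

/-- Cauchy–Schwarz against the constant 1: expand ∫ (g − s)² ≥ 0 and take s to be the mean of g. A
null set is treated separately, as the mean is then undefined. -/
theorem sq_setIntegral_le_of_continuous {g : EuclideanSpace ℝ (Fin d) → ℝ} (hg : Continuous g)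
    {K : Set (EuclideanSpace ℝ (Fin d))} (hK : IsCompact K) :
    (∫ u in K, g u) ^ 2 ≤ volume.real K * ∫ u in K, g u ^ 2 := by
  have hi : ∀ f : EuclideanSpace ℝ (Fin d) → ℝ, Continuous f → IntegrableOn f K :=
    fun f hf => hf.continuousOn.integrableOn_compact hK
  have h : ∀ s : ℝ, 0 ≤ (∫ u in K, g u ^ 2) - 2 * s * (∫ u in K, g u) + s ^ 2 * volume.real K := by
    intro s
    have h1 : 0 ≤ ∫ u in K, (g u - s) ^ 2 := integral_nonneg fun _ => sq_nonneg _
    have h2 : ∫ u in K, (g u - s) ^ 2 = ∫ u in K, (g u ^ 2 - 2 * s * g u + s ^ 2) :=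
      integral_congr_ae (Filter.Eventually.of_forall fun u => by ring)
    rw [h2, integral_add (hi _ (by fun_prop)) (hi _ (by fun_prop)),
      integral_sub (hi _ (by fun_prop)) (hi _ (by fun_prop)), integral_const_mul,
      setIntegral_const, smul_eq_mul] at h1
    linarith
  have hv : 0 ≤ volume.real K := measureReal_nonneg
  rcases hv.eq_or_lt with h0 | h0
  · have := setIntegral_measure_zero (μ := volume) g
      ((measureReal_eq_zero_iff hK.measure_lt_top.ne).1 h0.symm)
    rw [this, ← h0]; simp
  · have := h ((∫ u in K, g u) / volume.real K)
    have e : (∫ u in K, g u ^ 2) - 2 * ((∫ u in K, g u) / volume.real K) * (∫ u in K, g u)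
        + ((∫ u in K, g u) / volume.real K) ^ 2 * volume.real K
        = (∫ u in K, g u ^ 2) - (∫ u in K, g u) ^ 2 / volume.real K := by
      field_simp; ring
    rw [e, sub_nonneg, div_le_iff₀ h0] at this
    linarith

/-- Cauchy-Schwarz for a bounded kernel against the oscillation of `v`. -/
theorem sq_integral_kernel_le {v k : EuclideanSpace ℝ (Fin d) → ℝ} (hv : Continuous v)
    {t m : ℝ} {x : EuclideanSpace ℝ (Fin d)} (hk : ∀ y, |k y| ≤ m)
    (hk0 : ∀ y, 4 * t < dist y x → k y = 0) :
    (∫ y, k y * (v y - v x)) ^ 2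
      ≤ m ^ 2 * volume.real (Metric.closedBall (0 : EuclideanSpace ℝ (Fin d)) (4 * t))
        * localOsc v t x := by
  set B := Metric.closedBall (0 : EuclideanSpace ℝ (Fin d)) (4 * t)
  have hm : 0 ≤ m := (abs_nonneg _).trans (hk 0)
  have h1 : ∫ y, k y * (v y - v x) = ∫ u in B, k (x + u) * (v (x + u) - v x) := by
    rw [← integral_add_left_eq_self (fun y => k y * (v y - v x)) x]
    refine (setIntegral_eq_integral_of_forall_compl_eq_zero fun u hu => ?_).symm
    rw [hk0 (x + u), zero_mul]
    rw [dist_self_add_left]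
    simpa [B] using hu
  have hB : IsCompact B := isCompact_closedBall _ _
  have h2 : |∫ y, k y * (v y - v x)| ≤ m * ∫ u in B, |v x - v (x + u)| := by
    rw [h1, ← integral_const_mul]
    refine abs_integral_le_integral_abs.trans (integral_mono_of_nonneg
      (Filter.Eventually.of_forall fun _ => abs_nonneg _)
      (ContinuousOn.integrableOn_compact hB (by fun_prop))
      (Filter.Eventually.of_forall fun u => ?_))
    change |k (x + u) * (v (x + u) - v x)| ≤ m * |v x - v (x + u)|
    rw [abs_mul, abs_sub_comm]
    gcongr
    exact hk _
  have h3 := sq_setIntegral_le_of_continuous (g := fun u => |v x - v (x + u)|) (by fun_prop) hB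
  simp only [sq_abs] at h3
  calc (∫ y, k y * (v y - v x)) ^ 2 = |∫ y, k y * (v y - v x)| ^ 2 := (sq_abs _).symm
    _ ≤ (m * ∫ u in B, |v x - v (x + u)|) ^ 2 := by gcongr
    _ = m ^ 2 * (∫ u in B, |v x - v (x + u)|) ^ 2 := by ring
    _ ≤ m ^ 2 * (volume.real B * localOsc v t x) := by gcongr; exact h3
    _ = _ := by ring

/-- The tent function of radius `t` centred at `z`. -/
def tent (t : ℝ) (z y : EuclideanSpace ℝ (Fin d)) : ℝ := max 0 (1 - dist y z / t)

theorem continuous_tent (t : ℝ) (z : EuclideanSpace ℝ (Fin d)) : Continuous (tent t z) := by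
  unfold tent; fun_prop

theorem tent_eq_zero {t : ℝ} (ht : 0 < t) {z y : EuclideanSpace ℝ (Fin d)} (h : t < dist y z) :
    tent t z y = 0 :=
  max_eq_left (by rw [sub_nonpos, one_le_div ht]; exact h.le)

theorem abs_tent_le_one {t : ℝ} (ht : 0 < t) (z y : EuclideanSpace ℝ (Fin d)) :
    |tent t z y| ≤ 1 := by
  rw [abs_of_nonneg (le_max_left _ _)]
  exact max_le zero_le_one (by have : 0 ≤ dist y z / t := by positivity
                               linarith)

/-- Averaging with a tent rather than an indicator function makes the kernel Lipschitz in its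
centre. This is the source of the factor dist/t in the increments, hence of the energy bound. -/
theorem abs_tent_sub_le {t : ℝ} (ht : 0 < t) (z z' y : EuclideanSpace ℝ (Fin d)) :
    |tent t z y - tent t z' y| ≤ dist z z' / t := by
  unfold tent
  refine (abs_max_sub_max_le_max 0 (1 - dist y z / t) 0 (1 - dist y z' / t)).trans ?_
  refine max_le (by simp; positivity) ?_
  rw [show 1 - dist y z / t - (1 - dist y z' / t) = (dist y z' - dist y z) / t by ring, abs_div,
    abs_of_pos ht]
  gcongr
  rw [dist_comm z, dist_comm y, dist_comm y]
  exact abs_dist_sub_le _ _ _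

theorem integrable_tent_mul {t : ℝ} (ht : 0 < t) (z : EuclideanSpace ℝ (Fin d))
    {f : EuclideanSpace ℝ (Fin d) → ℝ} (hf : Continuous f) :
    Integrable fun y => tent t z y * f y := by
  refine ((continuous_tent t z).mul hf).integrable_of_hasCompactSupport
    (HasCompactSupport.intro (isCompact_closedBall z t) fun y hy => ?_)
  rw [Pi.mul_apply, tent_eq_zero ht (by simpa using hy), zero_mul]

/-- The total mass of a tent function of radius `t`. -/
def tentMass (d : ℕ) (t : ℝ) : ℝ := ∫ y : EuclideanSpace ℝ (Fin d), tent t 0 y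

theorem integral_tent (t : ℝ) (z : EuclideanSpace ℝ (Fin d)) :
    ∫ y, tent t z y = tentMass d t := by
  rw [tentMass, ← integral_sub_right_eq_self (fun y => tent t 0 y) z]
  simp only [tent, dist_eq_norm, sub_zero]

/-- The tent is at least 1/2 on the ball of half its radius. -/
theorem le_tentMass {t : ℝ} (ht : 0 < t) :
    (t / 2) ^ d * volume.real (Metric.ball (0 : EuclideanSpace ℝ (Fin d)) 1) * (1 / 2)
      ≤ tentMass d t := by
  rw [tentMass, ← volume_real_closedBall 0 (by positivity), ← setIntegral_univ]
  refine mul_volume_le_setIntegral measurableSet_closedBall MeasurableSet.univ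
    (Set.subset_univ _) measure_closedBall_lt_top.ne ?_ (fun _ _ => le_max_left _ _) ?_
  · simpa using integrable_tent_mul ht (0 : EuclideanSpace ℝ (Fin d)) (f := fun _ => 1)
      continuous_const
  · intro y hy
    refine le_max_of_le_right ?_
    rw [Metric.mem_closedBall] at hy
    have : dist y 0 / t ≤ 1 / 2 := by rw [div_le_iff₀ ht]; linarith
    linarith

/-- The local average of `v` against a tent function. -/
def tentAverage (t : ℝ) (v : EuclideanSpace ℝ (Fin d) → ℝ) (z : EuclideanSpace ℝ (Fin d)) : ℝ :=
  (tentMass d t)⁻¹ * ∫ y, tent t z y * v y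

theorem tentMass_pos {t : ℝ} (ht : 0 < t) : 0 < tentMass d t :=
  lt_of_lt_of_le (by have := volume_real_unitBall_pos (d := d); positivity) (le_tentMass ht)

theorem integral_tent_mul_sub {t : ℝ} (ht : 0 < t) {v : EuclideanSpace ℝ (Fin d) → ℝ}
    (hv : Continuous v) (z : EuclideanSpace ℝ (Fin d)) (c : ℝ) :
    ∫ y, tent t z y * (v y - c) = tentMass d t * (tentAverage t v z - c) := by
  simp only [mul_sub]
  rw [integral_sub (integrable_tent_mul ht z hv) (integrable_tent_mul ht z continuous_const),
    integral_mul_const, integral_tent, tentAverage, mul_inv_cancel_left₀ (tentMass_pos ht).ne']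

/-- Cauchy–Schwarz yields a volume of order t^d and the normalisation divides by a squared mass of
order t^(2d). The quotient is the factor t^(-d) of all later estimates. -/
theorem volume_div_tentMass_sq_le {t : ℝ} (ht : 0 < t) :
    volume.real (Metric.closedBall (0 : EuclideanSpace ℝ (Fin d)) (4 * t))
      ≤ 4 * 16 ^ d / volume.real (Metric.ball (0 : EuclideanSpace ℝ (Fin d)) 1) * (t ^ d)⁻¹
        * tentMass d t ^ 2 := by
  have hβ := volume_real_unitBall_pos (d := d)
  have h := le_tentMass (d := d) ht
  rw [volume_real_closedBall _ (by positivity)]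
  set β := volume.real (Metric.ball (0 : EuclideanSpace ℝ (Fin d)) 1)
  calc (4 * t) ^ d * β
      = 4 * 16 ^ d / β * (t ^ d)⁻¹ * ((t / 2) ^ d * β * (1 / 2)) ^ 2 := by
        rw [mul_pow, div_pow, show (16 : ℝ) = 4 * (2 * 2) by norm_num, mul_pow, mul_pow]
        field_simp
        norm_num
    _ ≤ _ := by gcongr

theorem sq_tentAverage_sub_le {t : ℝ} (ht : 0 < t) {v : EuclideanSpace ℝ (Fin d) → ℝ}
    (hv : Continuous v) {x z : EuclideanSpace ℝ (Fin d)} (hz : dist z x ≤ t) :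
    (tentAverage t v z - v x) ^ 2
      ≤ 4 * 16 ^ d / volume.real (Metric.ball (0 : EuclideanSpace ℝ (Fin d)) 1)
        * ((t ^ d)⁻¹ * localOsc v t x) := by
  have hM := tentMass_pos (d := d) ht
  have h1 := sq_integral_kernel_le hv (k := tent t z) (x := x) (t := t) (m := 1)
    (abs_tent_le_one ht z) (fun y hy => tent_eq_zero ht (by
      have := dist_triangle y z x
      linarith))
  rw [integral_tent_mul_sub ht hv, mul_pow, one_pow, one_mul] at h1
  have h2 := mul_le_mul_of_nonneg_right (volume_div_tentMass_sq_le (d := d) ht)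
    (localOsc_nonneg v t x)
  have h3 := h1.trans h2
  refine le_of_mul_le_mul_left (h3.trans_eq ?_) (pow_pos hM 2)
  ring

/-- Tents of equal radius have equal mass, so their difference has mean zero and v may be replaced
by v − v(x) under the integral. The difference kernel is bounded by dist z z' / t and supported
within 2t of x. -/
theorem sq_tentAverage_sub_tentAverage_le {t : ℝ} (ht : 0 < t)
    {v : EuclideanSpace ℝ (Fin d) → ℝ} (hv : Continuous v) {x z z' : EuclideanSpace ℝ (Fin d)}
    (hz : dist z x ≤ t) (hz' : dist z' x ≤ t) :
    (tentAverage t v z - tentAverage t v z') ^ 2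
      ≤ (dist z z' / t) ^ 2 *
        (4 * 16 ^ d / volume.real (Metric.ball (0 : EuclideanSpace ℝ (Fin d)) 1)
        * ((t ^ d)⁻¹ * localOsc v t x)) := by
  have hM := tentMass_pos (d := d) ht
  have h1 := sq_integral_kernel_le hv (k := fun y => tent t z y - tent t z' y) (x := x) (t := t)
    (abs_tent_sub_le ht z z') (fun y hy => by
      have := dist_triangle y z x
      have := dist_triangle y z' x
      rw [tent_eq_zero ht (by linarith), tent_eq_zero ht (by linarith), sub_zero])
  simp only [sub_mul] at h1
  rw [integral_sub (integrable_tent_mul ht z (by fun_prop))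
    (integrable_tent_mul ht z' (by fun_prop)), integral_tent_mul_sub ht hv,
    integral_tent_mul_sub ht hv] at h1
  have h2 := mul_le_mul_of_nonneg_left (mul_le_mul_of_nonneg_right
    (volume_div_tentMass_sq_le (d := d) ht) (localOsc_nonneg v t x)) (sq_nonneg (dist z z' / t))
  refine le_of_mul_le_mul_left (le_trans (le_trans (le_of_eq ?_) h1) (le_trans
    (le_of_eq ?_) (h2.trans_eq ?_))) (pow_pos hM 2) <;> ring

/-- A function vanishing off `Ω` is controlled by its oscillation near the boundary. -/
theorem IsBoundedLipschitzDomain.exists_sq_le_localOsc (hd : 1 ≤ d)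
    (hΩ : IsBoundedLipschitzDomain Ω) :
    ∃ c > 0, ∀ v : EuclideanSpace ℝ (Fin d) → ℝ, Continuous v → (∀ x ∉ Ω, v x = 0) →
      ∀ t, 0 < t → ∀ x, Metric.infDist x Ωᶜ < 2 * t →
        v x ^ 2 ≤ c * ((t ^ d)⁻¹ * localOsc v t x) := by
  obtain ⟨κ, hκ, h⟩ := hΩ.exists_exterior_ball_of_infDist_lt hd
  have hβ := volume_real_unitBall_pos (d := d)
  refine ⟨1 / ((2 * κ) ^ d * volume.real (Metric.ball (0 : EuclideanSpace ℝ (Fin d)) 1)),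
    by positivity, fun v hv hv0 t ht x hx => ?_⟩
  by_cases hxΩ : x ∈ Ω
  -- The exterior ball is taken at scale 2t and lies within 4t of x, which is why `localOsc` uses
  -- radius 4t. On it v = 0, so each difference equals v(x).
  · obtain ⟨y, hy⟩ := h x hxΩ (2 * t) (by positivity) hx
    have h1 : volume.real (Metric.closedBall (y - x) (κ * (2 * t))) * v x ^ 2
        ≤ localOsc v t x := by
      have hmem : ∀ u ∈ Metric.closedBall (y - x) (κ * (2 * t)),
          x + u ∈ Metric.closedBall y (κ * (2 * t)) := by
        intro u hu
        rw [Metric.mem_closedBall, dist_eq_norm] at hu ⊢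
        rwa [show x + u - y = u - (y - x) by abel]
      refine mul_volume_le_localOsc hv measurableSet_closedBall (fun u hu => ?_) fun u hu => ?_
      · have := (hy (hmem u hu)).1
        rw [Metric.mem_closedBall, dist_self_add_left] at this
        rw [mem_closedBall_zero_iff]
        linarith
      · rw [hv0 _ (hy (hmem u hu)).2, sub_zero]
    rw [volume_real_closedBall _ (by positivity)] at h1
    set β := volume.real (Metric.ball (0 : EuclideanSpace ℝ (Fin d)) 1)
    rw [one_div, ← mul_assoc, ← mul_inv, ← div_eq_inv_mul, le_div_iff₀ (by positivity)]
    refine le_trans (le_of_eq ?_) h1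
    rw [mul_pow, mul_pow, mul_pow]
    ring
  · rw [hv0 x hxΩ, zero_pow two_ne_zero]
    have := localOsc_nonneg v t x
    positivity

/-- Local averages with a cut-off at the boundary: an approximation of `v` at scale `t` that
vanishes off `Ω` and whose error and increments are controlled by the local oscillation. -/
theorem IsBoundedLipschitzDomain.exists_smoothing (hd : 1 ≤ d)
    (hΩ : IsBoundedLipschitzDomain Ω) :
    ∃ c > 0, ∀ v : EuclideanSpace ℝ (Fin d) → ℝ, Continuous v → (∀ x ∉ Ω, v x = 0) →
      ∀ t, 0 < t → ∃ W : EuclideanSpace ℝ (Fin d) → ℝ, (∀ z ∉ Ω, W z = 0) ∧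
        ∀ x z, dist z x ≤ t → (W z - v x) ^ 2 ≤ c * ((t ^ d)⁻¹ * localOsc v t x) ∧
          ∀ z', dist z' x ≤ t →
            (W z - W z') ^ 2 ≤ (dist z z' / t) ^ 2 * (c * ((t ^ d)⁻¹ * localOsc v t x)) := by
  obtain ⟨c₃, hc₃, h₃⟩ := hΩ.exists_sq_le_localOsc hd
  set c₁ : ℝ := 4 * 16 ^ d / volume.real (Metric.ball (0 : EuclideanSpace ℝ (Fin d)) 1)
  have hc₁ : 0 < c₁ := by have := volume_real_unitBall_pos (d := d); positivity
  refine ⟨9 * (c₁ + c₃), by positivity, fun v hv hv0 t ht => ?_⟩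
  -- The smoothing is χ times the tent average. The cut-off is 1/t-Lipschitz, vanishes off Ω, and
  -- equals 1 at distance at least t from Ωᶜ.
  let χ : EuclideanSpace ℝ (Fin d) → ℝ := fun z => min 1 (Metric.infDist z Ωᶜ / t)
  have hχ0 : ∀ z, 0 ≤ χ z := fun z => le_min zero_le_one (by
    have := Metric.infDist_nonneg (x := z) (s := Ωᶜ); positivity)
  have hχ1 : ∀ z, χ z ≤ 1 := fun z => min_le_left _ _
  have hχ : ∀ z z', |χ z - χ z'| ≤ dist z z' / t := by
    intro z z'
    refine (abs_min_sub_min_le_max 1 _ 1 _).trans ?_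
    refine max_le (by simp; positivity) ?_
    rw [← sub_div, abs_div, abs_of_pos ht]
    gcongr
    have := (Metric.lipschitz_infDist_pt Ωᶜ).dist_le_mul z z'
    simpa [Real.dist_eq] using this
  -- Wherever the cut-off is active, x is so close to the boundary that v(x) itself is controlled by
  -- the oscillation.
  have hnear : ∀ x z, dist z x ≤ t → χ z ≠ 1 → Metric.infDist x Ωᶜ < 2 * t := by
    intro x z hz hne
    have h1 : Metric.infDist z Ωᶜ / t < 1 := by
      by_contra! hge
      exact hne (min_eq_left hge)
    rw [div_lt_one ht] at h1
    have := Metric.infDist_le_infDist_add_dist (x := x) (y := z) (s := Ωᶜ)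
    rw [dist_comm] at this
    linarith
  refine ⟨fun z => χ z * tentAverage t v z, fun z hz => ?_, fun x z hz => ?_⟩
  · have : χ z = 0 := by
      simp only [χ]
      rw [Metric.infDist_zero_of_mem (Set.mem_compl hz), zero_div]
      exact min_eq_right zero_le_one
    change χ z * _ = 0
    rw [this, zero_mul]
  have hΓ : 0 ≤ (t ^ d)⁻¹ * localOsc v t x := by
    have := localOsc_nonneg v t x
    positivity
  set Γ := (t ^ d)⁻¹ * localOsc v t x
  set q := √((c₁ + c₃) * Γ)
  have hq : 0 ≤ q := Real.sqrt_nonneg _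
  have hq2 : q ^ 2 = (c₁ + c₃) * Γ := Real.sq_sqrt (by positivity)
  have hA : ∀ z, dist z x ≤ t → |tentAverage t v z - v x| ≤ q := fun z hz =>
    Real.abs_le_sqrt ((sq_tentAverage_sub_le ht hv hz).trans (by
      change c₁ * Γ ≤ _
      nlinarith))
  have hvx : ∀ z, dist z x ≤ t → χ z ≠ 1 → |v x| ≤ q := fun z hz hne =>
    Real.abs_le_sqrt ((h₃ v hv hv0 t ht x (hnear x z hz hne)).trans (by
      change c₃ * Γ ≤ _
      nlinarith))
  constructor
  · have h1 : |χ z * tentAverage t v z - v x| ≤ q := by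
      by_cases hne : χ z = 1
      · rw [hne, one_mul]; exact hA z hz
      · calc |χ z * tentAverage t v z - v x|
            = |χ z * (tentAverage t v z - v x) - (1 - χ z) * v x| := by congr 1; ring
          _ ≤ |χ z * (tentAverage t v z - v x)| + |(1 - χ z) * v x| := abs_sub _ _
          _ = χ z * |tentAverage t v z - v x| + (1 - χ z) * |v x| := by
            rw [abs_mul, abs_mul, abs_of_nonneg (hχ0 z), abs_of_nonneg (sub_nonneg.2 (hχ1 z))]
          _ ≤ χ z * q + (1 - χ z) * q :=
            add_le_add (mul_le_mul_of_nonneg_left (hA z hz) (hχ0 z))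
              (mul_le_mul_of_nonneg_left (hvx z hz hne) (sub_nonneg.2 (hχ1 z)))
          _ = q := by ring
    rw [← sq_abs]
    calc |χ z * tentAverage t v z - v x| ^ 2 ≤ q ^ 2 := by gcongr
      _ ≤ _ := by rw [hq2]; nlinarith
  · intro z' hz'
    have hdist : 0 ≤ dist z z' / t := by positivity
    have h1 : |tentAverage t v z - tentAverage t v z'| ≤ dist z z' / t * q := by
      rw [← abs_of_nonneg (mul_nonneg hdist hq), ← sq_le_sq, mul_pow, hq2]
      refine (sq_tentAverage_sub_tentAverage_le ht hv hz hz').trans ?_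
      gcongr
      exact le_add_of_nonneg_right hc₃.le
    -- The term vanishes unless the cut-off is active at z or z'. In that case |v(x)| ≤ q, and hence
    -- the average is at most 2q.
    have h2 : |(χ z - χ z') * tentAverage t v z'| ≤ dist z z' / t * (2 * q) := by
      by_cases hne : χ z = 1 ∧ χ z' = 1
      · rw [hne.1, hne.2]; simp; positivity
      · have hvq : |v x| ≤ q := by
          by_cases hz1 : χ z = 1
          · exact hvx z' hz' fun h => hne ⟨hz1, h⟩
          · exact hvx z hz hz1
        rw [abs_mul]
        gcongr
        · exact hχ z z'
        · calc |tentAverage t v z'| = |(tentAverage t v z' - v x) + v x| := by congr 1; ring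
            _ ≤ q + q := (abs_add_le _ _).trans (add_le_add (hA z' hz') hvq)
            _ = 2 * q := by ring
    have h3 : |χ z * tentAverage t v z - χ z' * tentAverage t v z'| ≤ dist z z' / t * (3 * q) := by
      calc |χ z * tentAverage t v z - χ z' * tentAverage t v z'|
          = |χ z * (tentAverage t v z - tentAverage t v z')
              + (χ z - χ z') * tentAverage t v z'| := by congr 1; ring
        _ ≤ |χ z * (tentAverage t v z - tentAverage t v z')|
              + |(χ z - χ z') * tentAverage t v z'| := abs_add_le _ _
        _ ≤ 1 * (dist z z' / t * q) + dist z z' / t * (2 * q) := by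
            refine add_le_add ?_ h2
            rw [abs_mul, abs_of_nonneg (hχ0 z)]
            exact mul_le_mul (hχ1 z) h1 (abs_nonneg _) zero_le_one
        _ = _ := by ring
    calc (χ z * tentAverage t v z - χ z' * tentAverage t v z') ^ 2
        = |χ z * tentAverage t v z - χ z' * tentAverage t v z'| ^ 2 := (sq_abs _).symm
      _ ≤ (dist z z' / t * (3 * q)) ^ 2 := by gcongr
      _ = (dist z z' / t) ^ 2 * (9 * q ^ 2) := by ring
      _ = _ := by rw [hq2]; ring

end Smoothing

/-! ### The discrete approximation at scale t. -/

section Approximation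

variable {d : ℕ} {Ω : Set (EuclideanSpace ℝ (Fin d))}
  {T : Geometry.SimplicialComplex ℝ (EuclideanSpace ℝ (Fin d))}

theorem abs_affine_le_of_vertices {E : Type*} [AddCommGroup E] [Module ℝ E] {s : Set E}
    (f : E →ᵃ[ℝ] ℝ) {m : ℝ} (h : ∀ z ∈ s, |f z| ≤ m) : ∀ x ∈ convexHull ℝ s, |f x| ≤ m := by
  have : convexHull ℝ s ⊆ f ⁻¹' Set.Icc (-m) m :=
    convexHull_min (fun z hz => abs_le.1 (h z hz)) ((convex_Icc _ _).affine_preimage f)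
  exact fun x hx => abs_le.2 (this hx)

theorem abs_affine_sub_le_of_vertices {E : Type*} [AddCommGroup E] [Module ℝ E] {s : Set E}
    (f : E →ᵃ[ℝ] ℝ) {m : ℝ} (h : ∀ z ∈ s, ∀ z' ∈ s, |f z - f z'| ≤ m) :
    ∀ x ∈ convexHull ℝ s, ∀ y ∈ convexHull ℝ s, |f x - f y| ≤ m := by
  have h1 : ∀ z ∈ s, ∀ y ∈ convexHull ℝ s, |f z - f y| ≤ m := fun z hz y hy =>
    abs_affine_le_of_vertices (AffineMap.const ℝ E (f z) - f) (fun z' hz' => h z hz z' hz') y hy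
  exact fun x hx y hy =>
    abs_affine_le_of_vertices (f - AffineMap.const ℝ E (f y)) (fun z hz => h1 z hz y hy) x hx

theorem IsTriangulation.ae_mem_interior (hT : IsTriangulation Ω T) :
    ∀ᵐ x ∂(volume : Measure (EuclideanSpace ℝ (Fin d))), x ∈ closure Ω →
      ∃ t ∈ meshElements T, x ∈ interior (convexHull ℝ (t : Set (EuclideanSpace ℝ (Fin d)))) := by
  have h : ∀ᵐ x ∂(volume : Measure (EuclideanSpace ℝ (Fin d))), ∀ t ∈ meshElements T,
      x ∉ frontier (convexHull ℝ (t : Set (EuclideanSpace ℝ (Fin d)))) := by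
    rw [ae_ball_iff hT.finite_meshElements.countable]
    exact fun t _ => measure_eq_zero_iff_ae_notMem.1 ((convex_convexHull ℝ _).addHaar_frontier _)
  filter_upwards [h] with x hx hxΩ
  obtain ⟨t, ht, hxt⟩ := hT.exists_meshElement hxΩ
  refine ⟨t, ht, by_contra fun hxi => hx t ht ?_⟩
  rw [(isClosed_convexHull_finset t).frontier_eq]
  exact ⟨hxt, hxi⟩

/-- Element boundaries are null, so bounds on the interiors suffice. No integrability of f is
needed, since only the dominating step function has to be integrable; this spares any discussion of
the measurability of the gradient. -/
theorem IsTriangulation.integral_le_sum (hT : IsTriangulation Ω T)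
    {f : EuclideanSpace ℝ (Fin d) → ℝ} {m : Finset (EuclideanSpace ℝ (Fin d)) → ℝ}
    (hf : ∀ x, 0 ≤ f x) (hf0 : ∀ x ∉ closure Ω, f x = 0) (hm : ∀ t ∈ meshElements T, 0 ≤ m t)
    (hfm : ∀ t ∈ meshElements T,
      ∀ x ∈ interior (convexHull ℝ (t : Set (EuclideanSpace ℝ (Fin d)))), f x ≤ m t) :
    ∫ x, f x ≤ ∑ t ∈ hT.finite_meshElements.toFinset,
      volume.real (convexHull ℝ (t : Set (EuclideanSpace ℝ (Fin d)))) * m t := by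
  have hi : ∀ t : Finset (EuclideanSpace ℝ (Fin d)), Integrable
      ((convexHull ℝ (t : Set (EuclideanSpace ℝ (Fin d)))).indicator fun _ => m t) := fun t =>
    (integrable_indicator_iff (isClosed_convexHull_finset t).measurableSet).2
      (integrableOn_const (isCompact_convexHull_finset t).measure_lt_top.ne)
  calc ∫ x, f x ≤ ∫ x, ∑ t ∈ hT.finite_meshElements.toFinset,
        (convexHull ℝ (t : Set (EuclideanSpace ℝ (Fin d)))).indicator (fun _ => m t) x := by
        refine integral_mono_of_nonneg (Filter.Eventually.of_forall hf)
          (integrable_finsetSum _ fun t _ => hi t) ?_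
        filter_upwards [hT.ae_mem_interior] with x hx
        have hnn : ∀ t ∈ hT.finite_meshElements.toFinset,
            0 ≤ (convexHull ℝ (t : Set (EuclideanSpace ℝ (Fin d)))).indicator
              (fun _ => m t) x := fun t ht =>
          Set.indicator_nonneg (fun _ _ => hm t (hT.finite_meshElements.mem_toFinset.1 ht)) x
        by_cases hxΩ : x ∈ closure Ω
        · obtain ⟨t, ht, hxt⟩ := hx hxΩ
          refine le_trans ?_ (Finset.single_le_sum hnn (hT.finite_meshElements.mem_toFinset.2 ht))
          rw [Set.indicator_of_mem (interior_subset hxt)]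
          exact hfm t ht x hxt
        · rw [hf0 x hxΩ]
          exact Finset.sum_nonneg hnn
    _ = _ := by
        rw [integral_finsetSum _ fun t _ => hi t]
        refine Finset.sum_congr rfl fun t _ => ?_
        rw [integral_indicator (isClosed_convexHull_finset t).measurableSet, setIntegral_const,
          smul_eq_mul]

/-- The elements overlap only in null sets: each is replaced by its interior, and the interiors are
disjoint. -/
theorem IsTriangulation.sum_setIntegral_le (hT : IsTriangulation Ω T)
    {f : EuclideanSpace ℝ (Fin d) → ℝ} (hf : ∀ x, 0 ≤ f x) (hfi : Integrable f) :
    ∑ t ∈ hT.finite_meshElements.toFinset,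
      ∫ x in convexHull ℝ (t : Set (EuclideanSpace ℝ (Fin d))), f x ≤ ∫ x, f x := by
  have h1 : ∀ t : Finset (EuclideanSpace ℝ (Fin d)),
      ∫ x in convexHull ℝ (t : Set (EuclideanSpace ℝ (Fin d))), f x
        = ∫ x in interior (convexHull ℝ (t : Set (EuclideanSpace ℝ (Fin d)))), f x := fun t =>
    (setIntegral_congr_set
      (interior_ae_eq_of_null_frontier ((convex_convexHull ℝ _).addHaar_frontier _))).symm
  simp only [h1]
  rw [← integral_biUnion_finset _ (fun t _ => isOpen_interior.measurableSet)
    (fun t ht t' ht' hne => (disjoint_interior_convexHull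
      (hT.finite_meshElements.mem_toFinset.1 ht) (hT.finite_meshElements.mem_toFinset.1 ht')
      hne).mono_right interior_subset) (fun t _ => hfi.integrableOn)]
  exact setIntegral_le_integral hfi (Filter.Eventually.of_forall hf)

theorem hasGradientAt_of_affine {a : EuclideanSpace ℝ (Fin d) → ℝ}
    {e : EuclideanSpace ℝ (Fin d)} (ha : ∀ x y, a x - a y = inner ℝ e (x - y))
    (x : EuclideanSpace ℝ (Fin d)) : HasGradientAt a e x := by
  rw [hasGradientAt_iff_hasFDerivAt]
  have h : a = fun y => a 0 + InnerProductSpace.toDual ℝ _ e y := by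
    funext y
    have := ha y 0
    rw [sub_zero] at this
    rw [InnerProductSpace.toDual_apply_apply]
    linarith
  rw [h]
  exact (InnerProductSpace.toDual ℝ _ e).hasFDerivAt.const_add (a 0)

/-- If a smoothed function `W` is close to `v` and `v = a` is affine on a small element, then
the nodal errors are controlled by the oscillation. -/
theorem volume_mul_sq_sub_le {v W : EuclideanSpace ℝ (Fin d) → ℝ} (hv : Continuous v)
    {a : EuclideanSpace ℝ (Fin d) →ᵃ[ℝ] ℝ} {c : EuclideanSpace ℝ (Fin d)} {r σ t C : ℝ}
    {K : Set (EuclideanSpace ℝ (Fin d))} (hr : 0 ≤ r) (hσ : 1 ≤ σ) (hK : IsCompact K)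
    (hcK : Metric.closedBall c r ⊆ K) (hKc : K ⊆ Metric.closedBall c (σ * r))
    (hva : ∀ x ∈ K, v x = a x) {z : EuclideanSpace ℝ (Fin d)} (hz : z ∈ K)
    (hW : ∀ x ∈ K, (W z - v x) ^ 2 ≤ C * ((t ^ d)⁻¹ * localOsc v t x)) :
    volume.real K * (W z - v z) ^ 2
      ≤ (4 * σ) ^ (d + 2) * C * ((t ^ d)⁻¹ * ∫ x in K, localOsc v t x) := by
  obtain ⟨e, he⟩ := exists_gradient_affineMap a
  -- On K the function v − W z is affine, so its value at the node is bounded by its L² norm over K.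
  have h1 := volume_mul_sq_le_setIntegral_sq (a := fun x => a x - W z)
    (fun x y => by rw [← he]; ring) hr hσ hK hcK hKc hz
  have h2 : ∫ x in K, (a x - W z) ^ 2 ≤ C * ((t ^ d)⁻¹ * ∫ x in K, localOsc v t x) := by
    rw [← integral_const_mul, ← integral_const_mul]
    have hc := continuous_of_gradient he
    have hl := continuous_localOsc hv t
    refine setIntegral_mono_on (ContinuousOn.integrableOn_compact hK (by fun_prop))
      (ContinuousOn.integrableOn_compact hK (by fun_prop)) hK.measurableSet fun x hx => ?_
    rw [← hva x hx, ← neg_sub, neg_sq]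
    exact hW x hx
  rw [hva z hz, ← neg_sub, neg_sq, mul_assoc]
  exact h1.trans (by gcongr)

/-- The local estimate on one element. -/
theorem element_approximation_le {v W : EuclideanSpace ℝ (Fin d) → ℝ} (hv : Continuous v)
    {s : Finset (EuclideanSpace ℝ (Fin d))} {a b : EuclideanSpace ℝ (Fin d) →ᵃ[ℝ] ℝ}
    {c eb : EuclideanSpace ℝ (Fin d)} {r σ t C Q : ℝ} (hr : 0 < r) (hσ : 1 ≤ σ) (ht : 0 < t)
    (hC : 0 ≤ C) (hQ : 1 ≤ Q)
    (hc : Metric.closedBall c r ⊆ convexHull ℝ (s : Set (EuclideanSpace ℝ (Fin d))))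
    (hdiam : Metric.diam (convexHull ℝ (s : Set (EuclideanSpace ℝ (Fin d)))) ≤ σ * r)
    (hva : ∀ x ∈ convexHull ℝ (s : Set (EuclideanSpace ℝ (Fin d))), v x = a x)
    (heb : ∀ x y, b x - b y = inner ℝ eb (x - y))
    (hW : ∀ x z, dist z x ≤ t → (W z - v x) ^ 2 ≤ C * ((t ^ d)⁻¹ * localOsc v t x) ∧
      ∀ z', dist z' x ≤ t →
        (W z - W z') ^ 2 ≤ (dist z z' / t) ^ 2 * (C * ((t ^ d)⁻¹ * localOsc v t x)))
    (hb : ∀ z ∈ s, (b z = v z ∧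
        t ≤ Q * Metric.diam (convexHull ℝ (s : Set (EuclideanSpace ℝ (Fin d))))) ∨
      (b z = W z ∧ Metric.diam (convexHull ℝ (s : Set (EuclideanSpace ℝ (Fin d)))) < t)) :
    (∀ x ∈ convexHull ℝ (s : Set (EuclideanSpace ℝ (Fin d))),
      volume.real (convexHull ℝ (s : Set (EuclideanSpace ℝ (Fin d)))) * (v x - b x) ^ 2
        ≤ (4 * σ) ^ (d + 2) * C * ((t ^ d)⁻¹
          * ∫ x in convexHull ℝ (s : Set (EuclideanSpace ℝ (Fin d))), localOsc v t x)) ∧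
    t ^ 2 * (volume.real (convexHull ℝ (s : Set (EuclideanSpace ℝ (Fin d)))) * ‖eb‖ ^ 2)
      ≤ (σ ^ 2 * C + 2 * (Q * σ) ^ 2 * ((4 * σ) ^ (d + 2) * C)
        + 2 * ((2 * Q * σ) ^ (d + 2) * ((2 * σ) ^ d * 4 ^ (d + 2))
          / volume.real (Metric.ball (0 : EuclideanSpace ℝ (Fin d)) 1)))
        * ((t ^ d)⁻¹
          * ∫ x in convexHull ℝ (s : Set (EuclideanSpace ℝ (Fin d))), localOsc v t x) := by
  set K := convexHull ℝ (s : Set (EuclideanSpace ℝ (Fin d)))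
  set h := Metric.diam K
  have hKcomp : IsCompact K := isCompact_convexHull_finset s
  have hcK : c ∈ K := hc (Metric.mem_closedBall_self hr.le)
  have hdist : ∀ x ∈ K, ∀ y ∈ K, dist x y ≤ h := fun x hx y hy =>
    Metric.dist_le_diam_of_mem hKcomp.isBounded hx hy
  have hKc : K ⊆ Metric.closedBall c (σ * r) := fun x hx =>
    Metric.mem_closedBall.2 ((hdist x hx c hcK).trans hdiam)
  have hsK : ∀ z ∈ s, z ∈ K := fun z hz => subset_convexHull ℝ _ hz
  have hvol : 0 < volume.real K := by
    refine lt_of_lt_of_le ?_ (measureReal_mono hc hKcomp.measure_lt_top.ne)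
    rw [volume_real_closedBall _ hr.le]
    have := volume_real_unitBall_pos (d := d)
    positivity
  have hI0 : 0 ≤ (t ^ d)⁻¹ * ∫ x in K, localOsc v t x := by
    have : 0 ≤ ∫ x in K, localOsc v t x :=
      integral_nonneg fun x => localOsc_nonneg v t x
    positivity
  set β := volume.real (Metric.ball (0 : EuclideanSpace ℝ (Fin d)) 1)
  have hβ : 0 < β := volume_real_unitBall_pos (d := d)
  set C₁ := (4 * σ) ^ (d + 2) * C
  have hC₁ : 0 ≤ C₁ := by positivity
  set C₂ := (2 * Q * σ) ^ (d + 2) * ((2 * σ) ^ d * 4 ^ (d + 2)) / β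
  have hC₂ : 0 ≤ C₂ := by positivity
  have hlocint : IntegrableOn (fun x => localOsc v t x) K :=
    (continuous_localOsc hv t).continuousOn.integrableOn_compact hKcomp
  -- errors at the vertices
  have hnode : ∀ z ∈ s, |(b - a) z| ≤ √(C₁ * ((t ^ d)⁻¹ * ∫ x in K, localOsc v t x)
      / volume.real K) := by
    intro z hz
    refine Real.abs_le_sqrt ?_
    rw [le_div_iff₀ hvol, mul_comm]
    change volume.real K * (b z - a z) ^ 2 ≤ _
    rw [← hva z (hsK z hz)]
    rcases hb z hz with ⟨hbz, -⟩ | ⟨hbz, hht⟩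
    · rw [hbz, sub_self, zero_pow two_ne_zero, mul_zero]
      positivity
    · rw [hbz]
      exact volume_mul_sq_sub_le hv hr.le hσ hKcomp hc hKc hva (hsK z hz) fun x hx =>
        (hW x z ((hdist z (hsK z hz) x hx).trans hht.le)).1
  have herr := abs_affine_le_of_vertices (b - a) hnode
  have hm2 : √(C₁ * ((t ^ d)⁻¹ * ∫ x in K, localOsc v t x) / volume.real K) ^ 2
      * volume.real K = C₁ * ((t ^ d)⁻¹ * ∫ x in K, localOsc v t x) := by
    rw [Real.sq_sqrt (by positivity), div_mul_cancel₀ _ hvol.ne']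
  set m := √(C₁ * ((t ^ d)⁻¹ * ∫ x in K, localOsc v t x) / volume.real K)
  have hm : 0 ≤ m := Real.sqrt_nonneg _
  refine ⟨fun x hx => ?_, ?_⟩
  · rw [← hm2, mul_comm, hva x hx, ← sq_abs (a x - b x), abs_sub_comm]
    gcongr
    exact herr x hx
  -- If every vertex carries an average, the increments of W bound the gradient directly. Otherwise
  -- a kept value forces t ≤ Qh ≤ Qσr, and an inverse estimate for the error plus the gradient of v
  -- suffice.
  · by_cases hsmall : ∀ z ∈ s, b z = W z ∧ h < t
    · -- all vertices carry averages
      have hosc : ∀ z ∈ (s : Set (EuclideanSpace ℝ (Fin d))),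
          ∀ z' ∈ (s : Set (EuclideanSpace ℝ (Fin d))), |b z - b z'|
          ≤ √((h / t) ^ 2 * (C * ((t ^ d)⁻¹ * ∫ x in K, localOsc v t x)) / volume.real K) := by
        intro z hz z' hz'
        have hht := (hsmall z hz).2
        refine Real.abs_le_sqrt ?_
        rw [le_div_iff₀ hvol, mul_comm, (hsmall z hz).1, (hsmall z' hz').1,
          ← integral_const_mul, ← integral_const_mul, ← integral_const_mul]
        refine mul_volume_le_setIntegral hKcomp.measurableSet hKcomp.measurableSet subset_rfl
          hKcomp.measure_lt_top.ne ?_ ?_ fun x hx => ?_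
        · exact ((hlocint.const_mul _).const_mul _).const_mul _
        · intro x _
          have := localOsc_nonneg v t x
          positivity
        · refine ((hW x z ((hdist z (hsK z hz) x hx).trans hht.le)).2 z'
            ((hdist z' (hsK z' hz') x hx).trans hht.le)).trans ?_
          have := localOsc_nonneg v t x
          gcongr
          exact hdist z (hsK z hz) z' (hsK z' hz')
      have h1 := two_mul_norm_gradient_le heb hr.le hc (abs_affine_sub_le_of_vertices b hosc)
      have hh : 0 ≤ h := Metric.diam_nonneg
      have h2 : (2 * r * ‖eb‖) ^ 2 * volume.real K
          ≤ (h / t) ^ 2 * (C * ((t ^ d)⁻¹ * ∫ x in K, localOsc v t x)) := by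
        have h3 := pow_le_pow_left₀ (by positivity) h1 2
        rw [Real.sq_sqrt (by positivity), le_div_iff₀ hvol] at h3
        exact h3
      have h4 : (h / t) ^ 2 ≤ (σ * r / t) ^ 2 := by gcongr
      have h5 : (2 * r) ^ 2 * (‖eb‖ ^ 2 * volume.real K)
          ≤ r ^ 2 * (σ ^ 2 * C * ((t ^ d)⁻¹ * ∫ x in K, localOsc v t x) / t ^ 2) := by
        calc (2 * r) ^ 2 * (‖eb‖ ^ 2 * volume.real K) = (2 * r * ‖eb‖) ^ 2 * volume.real K := by
              ring
          _ ≤ (σ * r / t) ^ 2 * (C * ((t ^ d)⁻¹ * ∫ x in K, localOsc v t x)) :=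
              h2.trans (by gcongr)
          _ = _ := by field_simp
      have h6 : ‖eb‖ ^ 2 * volume.real K
          ≤ σ ^ 2 * C * ((t ^ d)⁻¹ * ∫ x in K, localOsc v t x) / t ^ 2 := by
        refine le_of_mul_le_mul_left (le_trans ?_ h5) (pow_pos hr 2)
        gcongr
        linarith
      rw [le_div_iff₀ (by positivity)] at h6
      calc t ^ 2 * (volume.real K * ‖eb‖ ^ 2) = ‖eb‖ ^ 2 * volume.real K * t ^ 2 := by ring
        _ ≤ σ ^ 2 * C * ((t ^ d)⁻¹ * ∫ x in K, localOsc v t x) := h6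
        _ ≤ _ := by
          gcongr
          have : 0 ≤ 2 * (Q * σ) ^ 2 * C₁ := by positivity
          linarith
    · -- the element is large
      have htQ : t ≤ Q * h := by
        push Not at hsmall
        obtain ⟨z, hz, hzs⟩ := hsmall
        rcases hb z hz with h1 | h1
        · exact h1.2
        · exact absurd h1.2 (not_lt.2 (hzs h1.1))
      have htr : t ≤ Q * σ * r := by
        rw [mul_assoc]
        exact htQ.trans (by gcongr)
      obtain ⟨ea, hea⟩ := exists_gradient_affineMap a
      -- gradient of the error
      have h1 : 2 * r * ‖eb - ea‖ ≤ 2 * m := by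
        refine two_mul_norm_gradient_le (a := b - a) (fun x y => ?_) hr.le hc fun x hx y hy => ?_
        · rw [inner_sub_left, ← heb, ← hea]
          change b x - a x - (b y - a y) = _
          ring
        · refine (abs_sub _ _).trans ?_
          linarith [herr x hx, herr y hy]
      have h2 : t ^ 2 * (volume.real K * ‖eb - ea‖ ^ 2)
          ≤ (Q * σ) ^ 2 * C₁ * ((t ^ d)⁻¹ * ∫ x in K, localOsc v t x) := by
        calc t ^ 2 * (volume.real K * ‖eb - ea‖ ^ 2)
            ≤ (Q * σ * r) ^ 2 * (volume.real K * ‖eb - ea‖ ^ 2) := by gcongr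
          _ = (Q * σ) ^ 2 * ((r * ‖eb - ea‖) ^ 2 * volume.real K) := by ring
          _ ≤ (Q * σ) ^ 2 * (m ^ 2 * volume.real K) := by gcongr; linarith
          _ = _ := by rw [hm2]; ring
      -- gradient of `v`
      have h3 : t ^ 2 * (volume.real K * ‖ea‖ ^ 2)
          ≤ C₂ * ((t ^ d)⁻¹ * ∫ x in K, localOsc v t x) := by
        have hQσ : 1 ≤ Q * σ := one_le_mul_of_one_le_of_one_le hQ hσ
        -- This ρ is comparable to t and satisfies both ρ ≤ r/2, because t ≤ Qσr, and ρ ≤ t.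
        have h4 := volume_mul_norm_gradient_sq_le hv (t := t) (ρ := t / (2 * Q * σ)) hea hr.le hσ
          hKcomp hc hKc hva (by positivity)
          (by rw [div_le_iff₀ (by positivity)]; linarith)
          (by rw [div_le_iff₀ (by positivity)]; nlinarith)
        rw [div_pow, mul_div_assoc', div_mul_eq_mul_div, div_le_iff₀ (by positivity)] at h4
        have h5 : (t ^ d * β) * (t ^ 2 * (volume.real K * ‖ea‖ ^ 2))
            ≤ (t ^ d * β) * (C₂ * ((t ^ d)⁻¹ * ∫ x in K, localOsc v t x)) := by
          refine le_trans (le_of_eq (by ring)) (h4.trans (le_of_eq ?_))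
          simp only [C₂]
          field_simp
        exact le_of_mul_le_mul_left h5 (by positivity)
      have h6 : ‖eb‖ ^ 2 ≤ 2 * ‖eb - ea‖ ^ 2 + 2 * ‖ea‖ ^ 2 := by
        have h7 : ‖eb‖ ≤ ‖eb - ea‖ + ‖ea‖ := by
          simpa using norm_add_le (eb - ea) ea
        nlinarith [norm_nonneg eb, sq_nonneg (‖eb - ea‖ - ‖ea‖)]
      calc t ^ 2 * (volume.real K * ‖eb‖ ^ 2)
          ≤ t ^ 2 * (volume.real K * (2 * ‖eb - ea‖ ^ 2 + 2 * ‖ea‖ ^ 2)) := by gcongr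
        _ = 2 * (t ^ 2 * (volume.real K * ‖eb - ea‖ ^ 2))
            + 2 * (t ^ 2 * (volume.real K * ‖ea‖ ^ 2)) := by ring
        _ ≤ 2 * ((Q * σ) ^ 2 * C₁ * ((t ^ d)⁻¹ * ∫ x in K, localOsc v t x))
            + 2 * (C₂ * ((t ^ d)⁻¹ * ∫ x in K, localOsc v t x)) := by gcongr
        _ ≤ _ := by
          have : 0 ≤ σ ^ 2 * C * ((t ^ d)⁻¹ * ∫ x in K, localOsc v t x) := by positivity
          linarith

theorem integrable_localOsc {v : EuclideanSpace ℝ (Fin d) → ℝ} (hv : Continuous v)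
    (hvc : HasCompactSupport v) (t : ℝ) : Integrable (localOsc v t) := by
  refine (continuous_localOsc hv t).integrable_of_hasCompactSupport ?_
  obtain ⟨D, hD⟩ := hvc.isCompact.isBounded.subset_closedBall 0
  have hv0 : ∀ x, D < ‖x‖ → v x = 0 := fun x hx => by
    by_contra h
    have := hD (subset_tsupport v h)
    rw [mem_closedBall_zero_iff] at this
    linarith
  refine HasCompactSupport.intro (isCompact_closedBall 0 (D + |4 * t|)) fun x hx => ?_
  rw [mem_closedBall_zero_iff, not_le] at hx
  have h0 := abs_nonneg (4 * t)
  refine setIntegral_eq_zero_of_forall_eq_zero fun u hu => ?_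
  rw [mem_closedBall_zero_iff] at hu
  have h1 : ‖x‖ ≤ ‖x + u‖ + ‖u‖ := by simpa using norm_sub_le (x + u) u
  have h2 := le_abs_self (4 * t)
  rw [hv0 x (by linarith), hv0 (x + u) (by linarith)]
  simp

/-- Finite element functions are approximated in the finite element space at every scale `t`, with
error and energy controlled by the mean oscillation at that scale. -/
theorem exists_discrete_approximation (hd : 1 ≤ d) (hΩ : IsBoundedLipschitzDomain Ω) {σ : ℝ}
    (hσ : 1 ≤ σ) :
    ∃ C > 0, ∀ T : Geometry.SimplicialComplex ℝ (EuclideanSpace ℝ (Fin d)),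
      IsTriangulation Ω T → IsShapeRegular σ T → ∀ v ∈ feSpace Ω T, ∀ t, 0 < t →
        ∃ w ∈ feSpace Ω T, (∫ x in Ω, (v x - w x) ^ 2) + t ^ 2 * h1Seminorm w ^ 2
          ≤ C * ((t ^ d)⁻¹ * ∫ x, localOsc v t x) := by
  classical
  obtain ⟨c₀, hc₀, hsm⟩ := hΩ.exists_smoothing hd
  set Q : ℝ := σ ^ ⌈σ ^ d⌉₊
  have hQ : 1 ≤ Q := one_le_pow₀ hσ
  have hβ := volume_real_unitBall_pos (d := d)
  refine ⟨(4 * σ) ^ (d + 2) * c₀ + (σ ^ 2 * c₀ + 2 * (Q * σ) ^ 2 * ((4 * σ) ^ (d + 2) * c₀)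
        + 2 * ((2 * Q * σ) ^ (d + 2) * ((2 * σ) ^ d * 4 ^ (d + 2))
          / volume.real (Metric.ball (0 : EuclideanSpace ℝ (Fin d)) 1))), by positivity,
    fun T hT hreg v hv t ht => ?_⟩
  set C₁ := (4 * σ) ^ (d + 2) * c₀
  set C₂ := σ ^ 2 * c₀ + 2 * (Q * σ) ^ 2 * C₁
        + 2 * ((2 * Q * σ) ^ (d + 2) * ((2 * σ) ^ d * 4 ^ (d + 2))
          / volume.real (Metric.ball (0 : EuclideanSpace ℝ (Fin d)) 1))
  have hC₁ : 0 ≤ C₁ := by positivity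
  have hC₂ : 0 ≤ C₂ := by positivity
  obtain ⟨W, hW0, hW⟩ := hsm v hv.1 hv.2.1 t ht
  -- The choice is made per vertex, not per element, so that the interpolant is single-valued across
  -- elements. If a vertex carries an average, all elements around it have diameter below t.
  let N : EuclideanSpace ℝ (Fin d) → ℝ := fun z =>
    if ∃ s ∈ meshElements T, z ∈ s ∧
      t ≤ Metric.diam (convexHull ℝ (s : Set (EuclideanSpace ℝ (Fin d)))) then v z else W z
  obtain ⟨w, hw, hwN⟩ := hT.exists_interpolant hΩ N (fun z hz => by
    simp only [N]; split_ifs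
    exacts [hv.2.1 z hz, hW0 z hz])
  have hloc : ∀ s ∈ meshElements T, ∃ eb : EuclideanSpace ℝ (Fin d),
      (∀ x ∈ interior (convexHull ℝ (s : Set (EuclideanSpace ℝ (Fin d)))),
        gradient w x = eb) ∧
      (∀ x ∈ convexHull ℝ (s : Set (EuclideanSpace ℝ (Fin d))),
        volume.real (convexHull ℝ (s : Set (EuclideanSpace ℝ (Fin d)))) * (v x - w x) ^ 2
          ≤ C₁ * ((t ^ d)⁻¹
            * ∫ x in convexHull ℝ (s : Set (EuclideanSpace ℝ (Fin d))), localOsc v t x)) ∧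
      t ^ 2 * (volume.real (convexHull ℝ (s : Set (EuclideanSpace ℝ (Fin d)))) * ‖eb‖ ^ 2)
        ≤ C₂ * ((t ^ d)⁻¹
          * ∫ x in convexHull ℝ (s : Set (EuclideanSpace ℝ (Fin d))), localOsc v t x) ∧
      0 < volume.real (convexHull ℝ (s : Set (EuclideanSpace ℝ (Fin d)))) := by
    intro s hs
    obtain ⟨c, r, hr, hc, hdiam⟩ := hreg.exists_ball s hs
    obtain ⟨a, ha⟩ := hv.2.2 s hs
    obtain ⟨b, hb⟩ := hw.2.2 s hs
    obtain ⟨eb, heb⟩ := exists_gradient_affineMap b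
    have hnodes : ∀ z ∈ s, (b z = v z ∧
        t ≤ Q * Metric.diam (convexHull ℝ (s : Set (EuclideanSpace ℝ (Fin d))))) ∨
      (b z = W z ∧ Metric.diam (convexHull ℝ (s : Set (EuclideanSpace ℝ (Fin d)))) < t) := by
      intro z hz
      rw [← hb z (subset_convexHull ℝ _ hz), hwN s hs z hz]
      by_cases hbig : ∃ s ∈ meshElements T, z ∈ s ∧
          t ≤ Metric.diam (convexHull ℝ (s : Set (EuclideanSpace ℝ (Fin d))))
      · left
        refine ⟨if_pos hbig, ?_⟩
        obtain ⟨s', hs', hz', hts'⟩ := hbig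
        -- The large element at z may differ from `s`; the grading transfers its size to `s` at the
        -- cost of the factor Q.
        exact hts'.trans (hreg.diam_le_of_vertex hd hT hΩ hσ hs' hs hz' hz)
      · right
        refine ⟨if_neg hbig, ?_⟩
        by_contra! hge
        exact hbig ⟨s, hs, hz, hge⟩
    have h := element_approximation_le hv.1 hr hσ ht hc₀.le hQ hc hdiam ha heb hW hnodes
    refine ⟨eb, fun x hx => ?_, fun x hx => ?_, h.2, ?_⟩
    · refine ((hasGradientAt_of_affine heb x).congr_of_eventuallyEq ?_).gradient
      filter_upwards [isOpen_interior.mem_nhds hx] with y hy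
      exact hb y (interior_subset hy)
    · rw [hb x hx]
      exact h.1 x hx
    · refine lt_of_lt_of_le ?_
        (measureReal_mono hc (isCompact_convexHull_finset s).measure_lt_top.ne)
      rw [volume_real_closedBall _ hr.le]
      positivity
  choose! eb hgrad herr hen hvol using hloc
  refine ⟨w, hw, ?_⟩
  have hI0 : ∀ s : Finset (EuclideanSpace ℝ (Fin d)), 0 ≤ (t ^ d)⁻¹
      * ∫ x in convexHull ℝ (s : Set (EuclideanSpace ℝ (Fin d))), localOsc v t x := fun s => by
    have : 0 ≤ ∫ x in convexHull ℝ (s : Set (EuclideanSpace ℝ (Fin d))), localOsc v t x :=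
      integral_nonneg fun x => localOsc_nonneg v t x
    positivity
  have hsum : ∑ s ∈ hT.finite_meshElements.toFinset, (t ^ d)⁻¹
      * ∫ x in convexHull ℝ (s : Set (EuclideanSpace ℝ (Fin d))), localOsc v t x
      ≤ (t ^ d)⁻¹ * ∫ x, localOsc v t x := by
    rw [← Finset.mul_sum]
    gcongr
    exact hT.sum_setIntegral_le (localOsc_nonneg v t)
      (integrable_localOsc hv.1 (feSpace_hasCompactSupport hΩ hv) t)
  have h1 : ∫ x in Ω, (v x - w x) ^ 2 ≤ C₁ * ((t ^ d)⁻¹ * ∫ x, localOsc v t x) := by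
    rw [← integral_indicator hΩ.isOpen.measurableSet]
    refine (hT.integral_le_sum (m := fun s => C₁ * ((t ^ d)⁻¹
      * ∫ x in convexHull ℝ (s : Set (EuclideanSpace ℝ (Fin d))), localOsc v t x)
      / volume.real (convexHull ℝ (s : Set (EuclideanSpace ℝ (Fin d)))))
      (fun x => Set.indicator_nonneg (fun _ _ => sq_nonneg _) x)
      (fun x hx => Set.indicator_of_notMem (fun h => hx (subset_closure h)) _)
      (fun s hs => by have := hI0 s; positivity) fun s hs x hx => ?_).trans ?_
    · refine (Set.indicator_le_self' (fun _ _ => sq_nonneg _) x).trans ?_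
      rw [le_div_iff₀ (hvol s hs), mul_comm]
      exact herr s hs x (interior_subset hx)
    · refine le_trans (le_of_eq ?_) (mul_le_mul_of_nonneg_left hsum hC₁)
      rw [Finset.mul_sum]
      refine Finset.sum_congr rfl fun s hs => ?_
      have := hvol s (hT.finite_meshElements.mem_toFinset.1 hs)
      field_simp
  have h2 : t ^ 2 * h1Seminorm w ^ 2 ≤ C₂ * ((t ^ d)⁻¹ * ∫ x, localOsc v t x) := by
    rw [h1Seminorm, Real.sq_sqrt (integral_nonneg fun _ => sq_nonneg _)]
    refine (mul_le_mul_of_nonneg_left (hT.integral_le_sum (m := fun s => ‖eb s‖ ^ 2)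
      (fun x => sq_nonneg _) (fun x hx => ?_) (fun s _ => sq_nonneg _) fun s hs x hx => ?_)
      (sq_nonneg t)).trans ?_
    · have : w =ᶠ[nhds x] fun _ => 0 := by
        filter_upwards [isClosed_closure.isOpen_compl.mem_nhds hx] with y hy
        exact hw.2.1 y fun h => hy (subset_closure h)
      rw [this.gradient_eq, gradient_fun_const, norm_zero, zero_pow two_ne_zero]
    · rw [hgrad s hs x hx]
    · rw [Finset.mul_sum]
      refine le_trans (Finset.sum_le_sum fun s hs =>
        hen s (hT.finite_meshElements.mem_toFinset.1 hs)) ?_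
      rw [← Finset.mul_sum]
      gcongr
  calc _ ≤ C₁ * ((t ^ d)⁻¹ * ∫ x, localOsc v t x) + C₂ * ((t ^ d)⁻¹ * ∫ x, localOsc v t x) :=
        add_le_add h1 h2
    _ = _ := by ring

end Approximation

/-! ### The Gagliardo integral as an integral of oscillations over all scales. -/

section Gagliardo

variable {d : ℕ} {Ω : Set (EuclideanSpace ℝ (Fin d))}
  {T : Geometry.SimplicialComplex ℝ (EuclideanSpace ℝ (Fin d))}

/-- A function on an interval that is Lipschitz on each member of a finite closed cover is Lipschitz
(between the end points). -/
theorem abs_sub_le_of_finite_closed_cover {ι : Type*} [DecidableEq ι] {g : ℝ → ℝ} {L b : ℝ}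
    {F : ι → Set ℝ} (hF : ∀ i, IsClosed (F i))
    (hg : ∀ i, ∀ x ∈ F i, ∀ y ∈ F i, |g x - g y| ≤ L * |x - y|) (S : Finset ι) :
    ∀ a, a ≤ b → Set.Icc a b ⊆ ⋃ i ∈ S, F i → |g a - g b| ≤ L * (b - a) := by
  induction S using Finset.strongInduction with
  | H S ih =>
    intro a hab hcov
    obtain ⟨i, hi, hai⟩ := Set.mem_iUnion₂.1 (hcov (Set.left_mem_Icc.2 hab))
    have hK : IsCompact (F i ∩ Set.Icc a b) := isCompact_Icc.inter_left (hF i)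
    -- Jump to the last point c of the piece containing a. That piece is not needed beyond c, so the
    -- induction runs on the number of pieces.
    obtain ⟨c, ⟨hci, hac, hcb⟩, hc⟩ := hK.exists_isGreatest ⟨a, hai, Set.left_mem_Icc.2 hab⟩
    have h1 : |g a - g c| ≤ L * (c - a) := by
      have := hg i a hai c hci
      rwa [abs_sub_comm a c, abs_of_nonneg (sub_nonneg.2 hac)] at this
    rcases hcb.eq_or_lt with rfl | hcb'
    · exact h1
    have hcl : IsClosed (⋃ j ∈ S.erase i, F j) :=
      (S.erase i).finite_toSet.isClosed_biUnion fun j _ => hF j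
    have hsub : Set.Icc c b ⊆ ⋃ j ∈ S.erase i, F j := by
      -- The point c itself may seem to need the discarded piece, but it is a limit of points
      -- covered by the remaining closed ones.
      rw [← closure_Ioc hcb'.ne]
      refine hcl.closure_subset_iff.2 fun x hx => ?_
      obtain ⟨j, hj, hxj⟩ := Set.mem_iUnion₂.1 (hcov ⟨hac.trans hx.1.le, hx.2⟩)
      refine Set.mem_iUnion₂.2 ⟨j, Finset.mem_erase.2 ⟨?_, hj⟩, hxj⟩
      rintro rfl
      exact absurd (hc ⟨hxj, hac.trans hx.1.le, hx.2⟩) (not_le.2 hx.1)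
    have h2 := ih _ (Finset.erase_ssubset hi) c hcb hsub
    calc |g a - g b| ≤ |g a - g c| + |g c - g b| := abs_sub_le _ _ _
      _ ≤ L * (c - a) + L * (b - c) := add_le_add h1 h2
      _ = L * (b - a) := by ring

/-- The segment from x to y is cut into closed pieces by the elements and Ωᶜ, and v is Lipschitz on
each. The constant, the sum of all gradient norms, is crude and mesh dependent; it serves only to
show that the Gagliardo integral is finite. -/
theorem feSpace_exists_lipschitz (hΩ : IsBoundedLipschitzDomain Ω) (hT : IsTriangulation Ω T)
    {v : EuclideanSpace ℝ (Fin d) → ℝ} (hv : v ∈ feSpace Ω T) :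
    ∃ L : ℝ, 0 ≤ L ∧ ∀ x y, |v x - v y| ≤ L * ‖x - y‖ := by
  classical
  have hex : ∀ t ∈ meshElements T, ∃ e : EuclideanSpace ℝ (Fin d),
      ∀ x ∈ convexHull ℝ (t : Set (EuclideanSpace ℝ (Fin d))),
      ∀ y ∈ convexHull ℝ (t : Set (EuclideanSpace ℝ (Fin d))), v x - v y = inner ℝ e (x - y) := by
    intro t ht
    obtain ⟨a, ha⟩ := hv.2.2 t ht
    obtain ⟨e, he⟩ := exists_gradient_affineMap a
    exact ⟨e, fun x hx y hy => by rw [ha x hx, ha y hy, he]⟩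
  choose! e he using hex
  set L : ℝ := ∑ t ∈ hT.finite_meshElements.toFinset, ‖e t‖
  have hL : 0 ≤ L := Finset.sum_nonneg fun t _ => norm_nonneg _
  refine ⟨L, hL, fun x y => ?_⟩
  let F : Option hT.finite_meshElements.toFinset → Set ℝ := fun o =>
    (AffineMap.lineMap x y : ℝ →ᵃ[ℝ] EuclideanSpace ℝ (Fin d)) ⁻¹'
      o.elim Ωᶜ fun t => convexHull ℝ (t.1 : Set (EuclideanSpace ℝ (Fin d)))
  have hcont : Continuous (AffineMap.lineMap x y : ℝ →ᵃ[ℝ] EuclideanSpace ℝ (Fin d)) :=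
    AffineMap.lineMap_continuous
  have key := abs_sub_le_of_finite_closed_cover (g := fun θ => v (AffineMap.lineMap x y θ))
    (L := L * ‖x - y‖) (b := 1) (F := F) ?_ ?_ Finset.univ 0 zero_le_one ?_
  · simpa using key
  · rintro (_ | t)
    · exact hΩ.isOpen.isClosed_compl.preimage hcont
    · exact (isClosed_convexHull_finset t.1).preimage hcont
  · rintro (_ | t) θ hθ θ' hθ'
    · simp only [F, Option.elim_none, Set.mem_preimage, Set.mem_compl_iff] at hθ hθ'
      rw [hv.2.1 _ hθ, hv.2.1 _ hθ', sub_zero, abs_zero]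
      positivity
    · have ht := hT.finite_meshElements.mem_toFinset.1 t.2
      change |v _ - v _| ≤ _
      rw [he t.1 ht _ hθ _ hθ']
      refine (abs_real_inner_le_norm _ _).trans ?_
      rw [← dist_eq_norm, dist_lineMap_lineMap, Real.dist_eq, dist_eq_norm, mul_assoc,
        mul_comm ‖x - y‖]
      gcongr
      exact Finset.single_le_sum (f := fun t => ‖e t‖) (fun t _ => norm_nonneg _) t.2
  · intro θ _
    by_cases hθ : AffineMap.lineMap x y θ ∈ Ω
    · obtain ⟨t, ht, hxt⟩ := hT.exists_meshElement (subset_closure hθ)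
      exact Set.mem_iUnion₂.2
        ⟨some ⟨t, hT.finite_meshElements.mem_toFinset.2 ht⟩, Finset.mem_univ _, hxt⟩
    · exact Set.mem_iUnion₂.2 ⟨none, Finset.mem_univ _, hθ⟩

theorem lintegral_Ioi_rpow {p c : ℝ} (hp : 0 < p) (hc : 0 < c) :
    ∫⁻ t in Set.Ioi c, ENNReal.ofReal (t ^ (-(1 + p))) = ENNReal.ofReal (c ^ (-p) / p) := by
  rw [← ofReal_integral_eq_lintegral_ofReal (integrableOn_Ioi_rpow_of_lt (by linarith) hc)
    ((ae_restrict_mem measurableSet_Ioi).mono fun t ht => Real.rpow_nonneg (hc.trans ht).le _),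
    integral_Ioi_rpow_of_lt (by linarith) hc]
  congr 1
  rw [show -(1 + p) + 1 = -p by ring, div_neg, neg_div, neg_neg]

theorem lintegral_Ioc_rpow {p b : ℝ} (hp : 0 < p) (hb : 0 ≤ b) :
    ∫⁻ t in Set.Ioc 0 b, ENNReal.ofReal (t ^ (p - 1)) = ENNReal.ofReal (b ^ p / p) := by
  have hi := intervalIntegral.intervalIntegrable_rpow' (a := 0) (b := b) (r := p - 1) (by linarith)
  rw [intervalIntegrable_iff_integrableOn_Ioc_of_le hb] at hi
  rw [← ofReal_integral_eq_lintegral_ofReal hi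
    ((ae_restrict_mem measurableSet_Ioc).mono fun t ht => Real.rpow_nonneg ht.1.le _),
    ← intervalIntegral.integral_of_le hb, integral_rpow (Or.inl (by linarith))]
  rw [sub_add_cancel, Real.zero_rpow hp.ne', sub_zero]

/-- The mean oscillation as an integral over the product space. -/
theorem ofReal_integral_localOsc {v : EuclideanSpace ℝ (Fin d) → ℝ} (hv : Continuous v)
    (hvc : HasCompactSupport v) (t : ℝ) :
    ENNReal.ofReal (∫ x, localOsc v t x)
      = ∫⁻ p : EuclideanSpace ℝ (Fin d) × EuclideanSpace ℝ (Fin d),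
        {p : EuclideanSpace ℝ (Fin d) × EuclideanSpace ℝ (Fin d) | ‖p.2‖ ≤ 4 * t}.indicator
          (fun p => ENNReal.ofReal ((v p.1 - v (p.1 + p.2)) ^ 2)) p := by
  have hS : MeasurableSet
      {p : EuclideanSpace ℝ (Fin d) × EuclideanSpace ℝ (Fin d) | ‖p.2‖ ≤ 4 * t} :=
    measurableSet_le (by fun_prop) measurable_const
  have hm : Measurable fun p : EuclideanSpace ℝ (Fin d) × EuclideanSpace ℝ (Fin d) =>
      ENNReal.ofReal ((v p.1 - v (p.1 + p.2)) ^ 2) :=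
    ENNReal.measurable_ofReal.comp (Continuous.measurable (by fun_prop))
  rw [ofReal_integral_eq_lintegral_ofReal (integrable_localOsc hv hvc t)
    (Filter.Eventually.of_forall (localOsc_nonneg v t)), Measure.volume_eq_prod,
    lintegral_prod _ (hm.indicator hS).aemeasurable]
  refine lintegral_congr fun x => ?_
  rw [localOsc, ofReal_integral_eq_lintegral_ofReal
    (ContinuousOn.integrableOn_compact (isCompact_closedBall _ _) (by fun_prop))
    (Filter.Eventually.of_forall fun _ => sq_nonneg _),
    ← lintegral_indicator measurableSet_closedBall]
  refine lintegral_congr fun u => ?_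
  by_cases hu : ‖u‖ ≤ 4 * t
  · rw [Set.indicator_of_mem (mem_closedBall_zero_iff.2 hu), Set.indicator_of_mem (by exact hu)]
  · rw [Set.indicator_of_notMem (fun h => hu (mem_closedBall_zero_iff.1 h)),
      Set.indicator_of_notMem (by exact hu)]

/-- The Gagliardo double integral as an integral of the mean oscillation over all scales. -/
theorem lintegral_localOsc {v : EuclideanSpace ℝ (Fin d) → ℝ} (hv : Continuous v)
    (hvc : HasCompactSupport v) {q : ℝ} (hq : 0 < q) :
    ∫⁻ t in Set.Ioi (0 : ℝ), ENNReal.ofReal (t ^ (-(1 + q)) * ∫ x, localOsc v t x)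
      = ENNReal.ofReal (4 ^ q / q)
        * ∫⁻ p : EuclideanSpace ℝ (Fin d) × EuclideanSpace ℝ (Fin d),
          ENNReal.ofReal ((v p.1 - v p.2) * (v p.1 - v p.2) / ‖p.1 - p.2‖ ^ q) := by
  have hm : Measurable fun p : EuclideanSpace ℝ (Fin d) × EuclideanSpace ℝ (Fin d) =>
      ENNReal.ofReal ((v p.1 - v (p.1 + p.2)) ^ 2) :=
    ENNReal.measurable_ofReal.comp (Continuous.measurable (by fun_prop))
  have hS : MeasurableSet {r : ℝ × EuclideanSpace ℝ (Fin d) × EuclideanSpace ℝ (Fin d) |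
      ‖r.2.2‖ ≤ 4 * r.1} := measurableSet_le (by fun_prop) (by fun_prop)
  have hm1 : Measurable fun r : ℝ × EuclideanSpace ℝ (Fin d) × EuclideanSpace ℝ (Fin d) =>
      {r : ℝ × EuclideanSpace ℝ (Fin d) × EuclideanSpace ℝ (Fin d) | ‖r.2.2‖ ≤ 4 * r.1}.indicator
      (fun r => ENNReal.ofReal (r.1 ^ (-(1 + q)))
        * ENNReal.ofReal ((v r.2.1 - v (r.2.1 + r.2.2)) ^ 2)) r :=
    Measurable.indicator ((ENNReal.measurable_ofReal.comp
      ((measurable_fst).pow_const _)).mul (hm.comp measurable_snd)) hS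
  calc ∫⁻ t in Set.Ioi (0 : ℝ), ENNReal.ofReal (t ^ (-(1 + q)) * ∫ x, localOsc v t x)
      = ∫⁻ t in Set.Ioi (0 : ℝ), ∫⁻ p : EuclideanSpace ℝ (Fin d) × EuclideanSpace ℝ (Fin d),
        {r : ℝ × EuclideanSpace ℝ (Fin d) × EuclideanSpace ℝ (Fin d) |
          ‖r.2.2‖ ≤ 4 * r.1}.indicator (fun r => ENNReal.ofReal (r.1 ^ (-(1 + q)))
          * ENNReal.ofReal ((v r.2.1 - v (r.2.1 + r.2.2)) ^ 2)) (t, p) := by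
        refine setLIntegral_congr_fun measurableSet_Ioi fun t ht => ?_
        rw [ENNReal.ofReal_mul (Real.rpow_nonneg (le_of_lt ht) _), ofReal_integral_localOsc hv hvc,
          ← lintegral_const_mul' _ _ ENNReal.ofReal_ne_top]
        refine lintegral_congr fun p => ?_
        by_cases hp : ‖p.2‖ ≤ 4 * t
        · rw [Set.indicator_of_mem (by exact hp), Set.indicator_of_mem (by exact hp)]
        · rw [Set.indicator_of_notMem (by exact hp), Set.indicator_of_notMem (by exact hp),
            mul_zero]
    _ = ∫⁻ p : EuclideanSpace ℝ (Fin d) × EuclideanSpace ℝ (Fin d), ∫⁻ t in Set.Ioi (0 : ℝ),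
        {r : ℝ × EuclideanSpace ℝ (Fin d) × EuclideanSpace ℝ (Fin d) |
          ‖r.2.2‖ ≤ 4 * r.1}.indicator (fun r => ENNReal.ofReal (r.1 ^ (-(1 + q)))
          * ENNReal.ofReal ((v r.2.1 - v (r.2.1 + r.2.2)) ^ 2)) (t, p) :=
        lintegral_lintegral_swap hm1.aemeasurable
    _ = ∫⁻ p : EuclideanSpace ℝ (Fin d) × EuclideanSpace ℝ (Fin d), ENNReal.ofReal (4 ^ q / q)
        * ENNReal.ofReal ((v p.1 - v (p.1 + p.2)) * (v p.1 - v (p.1 + p.2)) / ‖p.2‖ ^ q) := by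
        refine lintegral_congr fun p => ?_
        -- For zero increment both sides vanish: the difference is 0, and the quotient 0/0 is 0.
        by_cases hp : p.2 = 0
        · have h0 : ∀ t : ℝ, {r : ℝ × EuclideanSpace ℝ (Fin d) × EuclideanSpace ℝ (Fin d) |
              ‖r.2.2‖ ≤ 4 * r.1}.indicator (fun r => ENNReal.ofReal (r.1 ^ (-(1 + q)))
              * ENNReal.ofReal ((v r.2.1 - v (r.2.1 + r.2.2)) ^ 2)) (t, p) = 0 := fun t =>
            Set.indicator_apply_eq_zero.2 fun _ => by simp [hp]
          simp only [h0, lintegral_zero]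
          simp [hp]
        · have hpos : 0 < ‖p.2‖ := norm_pos_iff.2 hp
          -- A pair with increment u contributes at the scales t ≥ ‖u‖/4, and integrating t^(-1-q)
          -- over these gives 4^q / (q‖u‖^q).
          have h1 : ∀ t : ℝ, {r : ℝ × EuclideanSpace ℝ (Fin d) × EuclideanSpace ℝ (Fin d) |
              ‖r.2.2‖ ≤ 4 * r.1}.indicator (fun r => ENNReal.ofReal (r.1 ^ (-(1 + q)))
              * ENNReal.ofReal ((v r.2.1 - v (r.2.1 + r.2.2)) ^ 2)) (t, p)
              = (Set.Ici (‖p.2‖ / 4)).indicator (fun t => ENNReal.ofReal (t ^ (-(1 + q)))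
              * ENNReal.ofReal ((v p.1 - v (p.1 + p.2)) ^ 2)) t := by
            intro t
            by_cases ht : ‖p.2‖ / 4 ≤ t
            · rw [Set.indicator_of_mem (Set.mem_Ici.2 ht), Set.indicator_of_mem]
              change ‖p.2‖ ≤ 4 * t
              linarith
            · rw [Set.indicator_of_notMem (fun h => ht (Set.mem_Ici.1 h)), Set.indicator_of_notMem]
              intro h
              change ‖p.2‖ ≤ 4 * t at h
              exact ht (by linarith)
          have hsub : Set.Ici (‖p.2‖ / 4) ⊆ Set.Ioi 0 := fun t ht =>
            Set.mem_Ioi.2 (lt_of_lt_of_le (by positivity) (Set.mem_Ici.1 ht))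
          simp only [h1]
          rw [setLIntegral_indicator measurableSet_Ici,
            Set.inter_eq_left.2 hsub,
            lintegral_mul_const' _ _ ENNReal.ofReal_ne_top, setLIntegral_congr Ioi_ae_eq_Ici.symm,
            lintegral_Ioi_rpow hq (by positivity), ← ENNReal.ofReal_mul (by positivity),
            ← ENNReal.ofReal_mul (by positivity)]
          congr 1
          rw [Real.div_rpow hpos.le (by norm_num), Real.rpow_neg hpos.le, Real.rpow_neg (by norm_num)]
          have := Real.rpow_pos_of_pos hpos q
          field_simp
    _ = ENNReal.ofReal (4 ^ q / q)
        * ∫⁻ p : EuclideanSpace ℝ (Fin d) × EuclideanSpace ℝ (Fin d),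
          ENNReal.ofReal ((v p.1 - v p.2) * (v p.1 - v p.2) / ‖p.1 - p.2‖ ^ q) := by
        rw [lintegral_const_mul' _ _ ENNReal.ofReal_ne_top, Measure.volume_eq_prod,
          lintegral_prod _ (by
            refine (ENNReal.measurable_ofReal.comp ?_).aemeasurable
            exact Measurable.div (Continuous.measurable (by fun_prop))
              ((Measurable.norm measurable_snd).pow_const _)),
          lintegral_prod _ (by
            refine (ENNReal.measurable_ofReal.comp ?_).aemeasurable
            exact Measurable.div (Continuous.measurable (by fun_prop))
              ((Measurable.norm (measurable_fst.sub measurable_snd)).pow_const _))]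
        congr 1
        refine lintegral_congr fun x => ?_
        rw [← lintegral_add_left_eq_self (fun y =>
          ENNReal.ofReal ((v x - v y) * (v x - v y) / ‖x - y‖ ^ q)) x]
        refine lintegral_congr fun u => ?_
        simp only [sub_add_cancel_left, norm_neg]

/-- Decay of the mean oscillation of a compactly supported Lipschitz function at small and large
scales. -/
theorem exists_integral_localOsc_le {v : EuclideanSpace ℝ (Fin d) → ℝ} (hv : Continuous v)
    (hvc : HasCompactSupport v) {L : ℝ} (hL : ∀ x y, |v x - v y| ≤ L * ‖x - y‖) :
    ∃ B, 0 ≤ B ∧ (∀ t, 0 < t → t ≤ 1 → ∫ x, localOsc v t x ≤ B * t ^ (d + 2)) ∧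
      ∀ t, 1 ≤ t → ∫ x, localOsc v t x ≤ B * t ^ d := by
  obtain ⟨D, hD0, hD⟩ := hvc.isCompact.isBounded.subset_closedBall_lt 0 0
  have hv0 : ∀ x, D < ‖x‖ → v x = 0 := fun x hx => by
    by_contra h
    have := hD (subset_tsupport v h)
    rw [mem_closedBall_zero_iff] at this
    linarith
  have hloc0 : ∀ t x, D + 4 * t < ‖x‖ → localOsc v t x = 0 := by
    intro t x hx
    refine setIntegral_eq_zero_of_forall_eq_zero fun u hu => ?_
    rw [mem_closedBall_zero_iff] at hu
    have h1 : ‖x‖ ≤ ‖x + u‖ + ‖u‖ := by simpa using norm_sub_le (x + u) u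
    have h2 := (norm_nonneg u).trans hu
    rw [hv0 x (by linarith), hv0 (x + u) (by linarith)]
    simp
  set β := volume.real (Metric.ball (0 : EuclideanSpace ℝ (Fin d)) 1)
  have hβ : 0 < β := volume_real_unitBall_pos (d := d)
  have hball : ∀ r : ℝ, 0 ≤ r →
      volume.real (Metric.closedBall (0 : EuclideanSpace ℝ (Fin d)) r) = r ^ d * β :=
    fun r hr => volume_real_closedBall 0 hr
  -- integration of a bound supported in a ball
  have hbound : ∀ t, 0 < t → ∀ m, (∀ x, localOsc v t x ≤ m) →
      ∫ x, localOsc v t x ≤ (D + 4 * t) ^ d * β * m := by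
    intro t ht m hm
    rw [← hball _ (by positivity), ← smul_eq_mul, ← setIntegral_const,
      ← integral_indicator measurableSet_closedBall]
    refine integral_mono (integrable_localOsc hv hvc t)
      ((integrable_indicator_iff measurableSet_closedBall).2
        (integrableOn_const measure_closedBall_lt_top.ne)) fun x => ?_
    by_cases hx : x ∈ Metric.closedBall (0 : EuclideanSpace ℝ (Fin d)) (D + 4 * t)
    · rw [Set.indicator_of_mem hx]; exact hm x
    · rw [Set.indicator_of_notMem hx]
      exact (hloc0 t x (by simpa using hx)).le
  have hi : ∀ t x, IntegrableOn (fun u => (v x - v (x + u)) ^ 2)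
      (Metric.closedBall (0 : EuclideanSpace ℝ (Fin d)) (4 * t)) := fun t x =>
    ContinuousOn.integrableOn_compact (isCompact_closedBall _ _) (by fun_prop)
  have hsq : Integrable fun x => v x ^ 2 := by
    refine (hv.pow 2).integrable_of_hasCompactSupport (hvc.mono fun x hx => ?_)
    exact fun h => hx (by simp [h])
  set N := ∫ x, v x ^ 2
  have hN : 0 ≤ N := integral_nonneg fun _ => sq_nonneg _
  refine ⟨(D + 4) ^ d * β * (4 ^ d * β * (16 * L ^ 2)) + (2 * (4 ^ d * β) * N
    + 2 * N * ((D + 4) ^ d * β)), by positivity, fun t ht ht1 => ?_, fun t ht => ?_⟩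
  -- At small scales the Lipschitz bound on increments of length at most 4t contributes t², and the
  -- ball of increments t^d.
  · have h1 : ∫ x, localOsc v t x
        ≤ (D + 4 * t) ^ d * β * ((4 * t) ^ d * β * (L * (4 * t)) ^ 2) := by
      refine hbound t ht _ fun x => ?_
      rw [localOsc, ← hball _ (by positivity),
        ← smul_eq_mul (volume.real (Metric.closedBall (0 : EuclideanSpace ℝ (Fin d)) (4 * t))),
        ← setIntegral_const]
      refine setIntegral_mono_on (hi t x) (integrableOn_const measure_closedBall_lt_top.ne)
        measurableSet_closedBall fun u hu => ?_
      rw [mem_closedBall_zero_iff] at hu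
      rw [← sq_abs]
      have := hL x (x + u)
      rw [sub_add_cancel_left, norm_neg] at this
      have h0 : 0 ≤ L * ‖u‖ := (abs_nonneg _).trans this
      have hL0 : L * ‖u‖ ≤ |L * (4 * t)| := by
        rw [← abs_of_nonneg h0, abs_mul, abs_mul, abs_norm, abs_of_pos (by positivity : 0 < 4 * t)]
        gcongr
      rw [← sq_abs (L * (4 * t))]
      exact pow_le_pow_left₀ (abs_nonneg _) (this.trans hL0) 2
    refine h1.trans ?_
    calc (D + 4 * t) ^ d * β * ((4 * t) ^ d * β * (L * (4 * t)) ^ 2)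
        ≤ (D + 4) ^ d * β * ((4 * t) ^ d * β * (L * (4 * t)) ^ 2) := by
          gcongr; linarith
      _ = (D + 4) ^ d * β * (4 ^ d * β * (16 * L ^ 2)) * t ^ (d + 2) := by
          rw [mul_pow, pow_add]; ring
      _ ≤ _ := by
          gcongr
          have : 0 ≤ 2 * (4 ^ d * β) * N + 2 * N * ((D + 4) ^ d * β) := by positivity
          linarith
  · have ht0 : 0 < t := by linarith
    -- At large scales only the L² norm of v is used, via (a − b)² ≤ 2a² + 2b².
    have hpt : ∀ x, localOsc v t x ≤ 2 * ((4 * t) ^ d * β) * v x ^ 2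
        + (Metric.closedBall (0 : EuclideanSpace ℝ (Fin d)) (D + 4 * t)).indicator
          (fun _ => 2 * N) x := by
      intro x
      by_cases hx : x ∈ Metric.closedBall (0 : EuclideanSpace ℝ (Fin d)) (D + 4 * t)
      · rw [Set.indicator_of_mem hx]
        have h1 : ∫ u, v (x + u) ^ 2 = N :=
          integral_add_left_eq_self (fun y => v y ^ 2) x
        have h2 : Integrable fun u => v (x + u) ^ 2 := hsq.comp_add_left x
        have h3 : Integrable (fun _ => 2 * v x ^ 2)
            (volume.restrict (Metric.closedBall (0 : EuclideanSpace ℝ (Fin d)) (4 * t))) :=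
          integrableOn_const measure_closedBall_lt_top.ne
        have h4 : Integrable (fun u => 2 * v (x + u) ^ 2)
            (volume.restrict (Metric.closedBall (0 : EuclideanSpace ℝ (Fin d)) (4 * t))) :=
          (h2.const_mul 2).integrableOn
        calc localOsc v t x ≤ ∫ u in Metric.closedBall (0 : EuclideanSpace ℝ (Fin d)) (4 * t),
              (2 * v x ^ 2 + 2 * v (x + u) ^ 2) := by
              refine integral_mono (hi t x) ?_ fun u => ?_
              · exact h3.add h4
              · change (v x - v (x + u)) ^ 2 ≤ 2 * v x ^ 2 + 2 * v (x + u) ^ 2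
                nlinarith [sq_nonneg (v x + v (x + u))]
          _ = 2 * ((4 * t) ^ d * β) * v x ^ 2
              + 2 * ∫ u in Metric.closedBall (0 : EuclideanSpace ℝ (Fin d)) (4 * t),
                v (x + u) ^ 2 := by
              rw [integral_add h3 h4, setIntegral_const, integral_const_mul, smul_eq_mul,
                hball _ (by positivity)]
              ring
          _ ≤ _ := by
              gcongr
              rw [← h1]
              exact setIntegral_le_integral h2 (Filter.Eventually.of_forall fun _ => sq_nonneg _)
      · rw [hloc0 t x (by simpa using hx), Set.indicator_of_notMem hx]
        positivity
    have hind : Integrable ((Metric.closedBall (0 : EuclideanSpace ℝ (Fin d))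
        (D + 4 * t)).indicator fun _ => 2 * N) :=
      (integrable_indicator_iff measurableSet_closedBall).2
        (integrableOn_const measure_closedBall_lt_top.ne)
    calc ∫ x, localOsc v t x ≤ ∫ x, (2 * ((4 * t) ^ d * β) * v x ^ 2
          + (Metric.closedBall (0 : EuclideanSpace ℝ (Fin d)) (D + 4 * t)).indicator
            (fun _ => 2 * N) x) :=
          integral_mono (integrable_localOsc hv hvc t) ((hsq.const_mul _).add hind) hpt
      _ = 2 * ((4 * t) ^ d * β) * N + (D + 4 * t) ^ d * β * (2 * N) := by
          rw [integral_add (hsq.const_mul _) hind, integral_const_mul,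
            integral_indicator measurableSet_closedBall, setIntegral_const, smul_eq_mul,
            hball _ (by positivity)]
      _ ≤ 2 * ((4 * t) ^ d * β) * N + ((D + 4) * t) ^ d * β * (2 * N) := by
          gcongr
          nlinarith
      _ = (2 * (4 ^ d * β) * N + 2 * N * ((D + 4) ^ d * β)) * t ^ d := by
          rw [mul_pow, mul_pow]; ring
      _ ≤ _ := by
          refine mul_le_mul_of_nonneg_right ?_ (by positivity)
          have : 0 ≤ (D + 4) ^ d * β * (4 ^ d * β * (16 * L ^ 2)) := by positivity
          linarith

/-- Split at t = 1: the integrand is of order t^(1-2s) near zero, integrable since s < 1, and of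
order t^(-1-2s) at infinity, integrable since s > 0. -/
theorem lintegral_localOsc_lt_top {v : EuclideanSpace ℝ (Fin d) → ℝ} (hv : Continuous v)
    (hvc : HasCompactSupport v) {L : ℝ} (hL : ∀ x y, |v x - v y| ≤ L * ‖x - y‖) {s : ℝ}
    (hs0 : 0 < s) (hs1 : s < 1) :
    ∫⁻ t in Set.Ioi (0 : ℝ), ENNReal.ofReal (t ^ (-(1 + ((d : ℝ) + 2 * s)))
      * ∫ x, localOsc v t x) < ⊤ := by
  obtain ⟨B, hB, hsmall, hlarge⟩ := exists_integral_localOsc_le hv hvc hL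
  rw [← Set.Ioc_union_Ioi_eq_Ioi (zero_le_one (α := ℝ)),
    lintegral_union measurableSet_Ioi (Set.Ioc_disjoint_Ioi le_rfl)]
  refine ENNReal.add_lt_top.2 ⟨?_, ?_⟩
  · calc ∫⁻ t in Set.Ioc (0 : ℝ) 1, ENNReal.ofReal (t ^ (-(1 + ((d : ℝ) + 2 * s)))
          * ∫ x, localOsc v t x)
        ≤ ∫⁻ t in Set.Ioc (0 : ℝ) 1, ENNReal.ofReal B * ENNReal.ofReal (t ^ ((2 - 2 * s) - 1)) := by
          refine setLIntegral_mono' measurableSet_Ioc fun t ht => ?_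
          rw [← ENNReal.ofReal_mul hB]
          refine ENNReal.ofReal_le_ofReal ?_
          have h0 := Real.rpow_nonneg ht.1.le (-(1 + ((d : ℝ) + 2 * s)))
          refine (mul_le_mul_of_nonneg_left (hsmall t ht.1 ht.2) h0).trans_eq ?_
          rw [mul_left_comm, ← Real.rpow_natCast, ← Real.rpow_add ht.1]
          congr 2
          push_cast
          ring
      _ < ⊤ := by
          rw [lintegral_const_mul' _ _ ENNReal.ofReal_ne_top,
            lintegral_Ioc_rpow (by linarith) zero_le_one]
          exact ENNReal.mul_lt_top ENNReal.ofReal_lt_top ENNReal.ofReal_lt_top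
  · calc ∫⁻ t in Set.Ioi (1 : ℝ), ENNReal.ofReal (t ^ (-(1 + ((d : ℝ) + 2 * s)))
          * ∫ x, localOsc v t x)
        ≤ ∫⁻ t in Set.Ioi (1 : ℝ), ENNReal.ofReal B * ENNReal.ofReal (t ^ (-(1 + 2 * s))) := by
          refine setLIntegral_mono' measurableSet_Ioi fun t ht => ?_
          have ht0 : 0 < t := zero_lt_one.trans ht
          rw [← ENNReal.ofReal_mul hB]
          refine ENNReal.ofReal_le_ofReal ?_
          have h0 := Real.rpow_nonneg ht0.le (-(1 + ((d : ℝ) + 2 * s)))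
          refine (mul_le_mul_of_nonneg_left (hlarge t (le_of_lt ht)) h0).trans_eq ?_
          rw [mul_left_comm, ← Real.rpow_natCast, ← Real.rpow_add ht0]
          congr 2
          ring
      _ < ⊤ := by
          rw [lintegral_const_mul' _ _ ENNReal.ofReal_ne_top,
            lintegral_Ioi_rpow (by linarith) zero_lt_one]
          exact ENNReal.mul_lt_top ENNReal.ofReal_lt_top ENNReal.ofReal_lt_top

/-- The fractional seminorm of a finite element function dominates the integral of its mean
oscillation over all scales. -/
theorem lintegral_localOsc_eq_ofReal_integral (hΩ : IsBoundedLipschitzDomain Ω)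
    (hT : IsTriangulation Ω T) {v : EuclideanSpace ℝ (Fin d) → ℝ} (hv : v ∈ feSpace Ω T) {s : ℝ}
    (hs0 : 0 < s) (hs1 : s < 1) :
    ∫⁻ t in Set.Ioi (0 : ℝ), ENNReal.ofReal (t ^ (-(1 + ((d : ℝ) + 2 * s)))
        * ∫ x, localOsc v t x)
      = ENNReal.ofReal (4 ^ ((d : ℝ) + 2 * s) / ((d : ℝ) + 2 * s)
        * ∫ p : EuclideanSpace ℝ (Fin d) × EuclideanSpace ℝ (Fin d),
          (v p.1 - v p.2) * (v p.1 - v p.2) / ‖p.1 - p.2‖ ^ ((d : ℝ) + 2 * s)) := by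
  obtain ⟨L, -, hL⟩ := feSpace_exists_lipschitz hΩ hT hv
  have hvc := feSpace_hasCompactSupport hΩ hv
  have hq : 0 < (d : ℝ) + 2 * s := by positivity
  have hc : 0 < (4 : ℝ) ^ ((d : ℝ) + 2 * s) / ((d : ℝ) + 2 * s) := by positivity
  have heq := lintegral_localOsc hv.1 hvc hq
  have hlt := lintegral_localOsc_lt_top hv.1 hvc hL hs0 hs1
  have hvcont := hv.1
  rw [heq] at hlt
  have hfin := ENNReal.lt_top_of_mul_ne_top_right hlt.ne
    (ENNReal.ofReal_pos.2 hc).ne'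
  have hnn : ∀ p : EuclideanSpace ℝ (Fin d) × EuclideanSpace ℝ (Fin d),
      0 ≤ (v p.1 - v p.2) * (v p.1 - v p.2) / ‖p.1 - p.2‖ ^ ((d : ℝ) + 2 * s) := fun p =>
    div_nonneg (mul_self_nonneg _) (Real.rpow_nonneg (norm_nonneg _) _)
  have hmeas : Measurable fun p : EuclideanSpace ℝ (Fin d) × EuclideanSpace ℝ (Fin d) =>
      (v p.1 - v p.2) * (v p.1 - v p.2) / ‖p.1 - p.2‖ ^ ((d : ℝ) + 2 * s) :=
    Measurable.div (Continuous.measurable (by fun_prop))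
      ((Measurable.norm (measurable_fst.sub measurable_snd)).pow_const _)
  -- Integrability is essential: the Bochner integral in the seminorm would otherwise take the
  -- default value 0.
  have hint : Integrable fun p : EuclideanSpace ℝ (Fin d) × EuclideanSpace ℝ (Fin d) =>
      (v p.1 - v p.2) * (v p.1 - v p.2) / ‖p.1 - p.2‖ ^ ((d : ℝ) + 2 * s) := by
    refine ⟨hmeas.aestronglyMeasurable, ?_⟩
    rw [hasFiniteIntegral_iff_ofReal (Filter.Eventually.of_forall hnn)]
    exact hfin
  rw [heq, ENNReal.ofReal_mul hc.le, ofReal_integral_eq_lintegral_ofReal hint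
    (Filter.Eventually.of_forall hnn)]

end Gagliardo

/-! ### Linearity and orthogonality of the L² slices. -/

section Slices

variable {d : ℕ} {Ω : Set (EuclideanSpace ℝ (Fin d))}
  {T : Geometry.SimplicialComplex ℝ (EuclideanSpace ℝ (Fin d))}

theorem l2Norm_sq (Ω : Set (EuclideanSpace ℝ (Fin d))) (v : EuclideanSpace ℝ (Fin d) → ℝ) :
    l2Norm Ω v ^ 2 = l2Inner Ω v v :=
  Real.sq_sqrt (integral_nonneg fun _ => mul_self_nonneg _)

theorem feSpace_integrable_mul (hΩ : IsBoundedLipschitzDomain Ω)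
    {u v : EuclideanSpace ℝ (Fin d) → ℝ} (hu : u ∈ feSpace Ω T) (hv : v ∈ feSpace Ω T) :
    Integrable (fun x => u x * v x) (volume.restrict Ω) :=
  ((hu.1.mul hv.1).integrable_of_hasCompactSupport
    (feSpace_hasCompactSupport hΩ hv).mul_left).integrableOn

theorem l2Inner_add_left (hΩ : IsBoundedLipschitzDomain Ω)
    {u v w : EuclideanSpace ℝ (Fin d) → ℝ} (hu : u ∈ feSpace Ω T) (hv : v ∈ feSpace Ω T)
    (hw : w ∈ feSpace Ω T) : l2Inner Ω (u + v) w = l2Inner Ω u w + l2Inner Ω v w := by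
  simp only [l2Inner, Pi.add_apply, add_mul]
  exact integral_add (feSpace_integrable_mul hΩ hu hw) (feSpace_integrable_mul hΩ hv hw)

theorem l2Inner_sub_self (hΩ : IsBoundedLipschitzDomain Ω)
    {u v : EuclideanSpace ℝ (Fin d) → ℝ} (hu : u ∈ feSpace Ω T) (hv : v ∈ feSpace Ω T) :
    l2Inner Ω (u - v) (u - v) = l2Inner Ω u u - 2 * l2Inner Ω u v + l2Inner Ω v v := by
  have h1 := feSpace_integrable_mul hΩ hu hu
  have h2 := (feSpace_integrable_mul hΩ hu hv).const_mul 2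
  have h3 := feSpace_integrable_mul hΩ hv hv
  have h12 : Integrable (fun x => u x * u x - 2 * (u x * v x)) (volume.restrict Ω) := h1.sub h2
  simp only [l2Inner]
  rw [← integral_const_mul, ← integral_sub h1 h2, ← integral_add h12 h3]
  refine integral_congr_ae (Filter.Eventually.of_forall fun x => ?_)
  simp only [Pi.sub_apply]
  ring

theorem l2Norm_add_sq_le (hΩ : IsBoundedLipschitzDomain Ω)
    {u v : EuclideanSpace ℝ (Fin d) → ℝ} (hu : u ∈ feSpace Ω T) (hv : v ∈ feSpace Ω T) :
    l2Norm Ω (u + v) ^ 2 ≤ 2 * l2Norm Ω u ^ 2 + 2 * l2Norm Ω v ^ 2 := by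
  rw [l2Norm_sq, l2Norm_sq, l2Norm_sq]
  have h1 := (feSpace_integrable_mul hΩ hu hu).const_mul 2
  have h2 := (feSpace_integrable_mul hΩ hv hv).const_mul 2
  have huv := (feSpace Ω T).add_mem hu hv
  simp only [l2Inner]
  rw [← integral_const_mul, ← integral_const_mul, ← integral_add h1 h2]
  refine integral_mono (feSpace_integrable_mul hΩ huv huv) (h1.add h2) fun x => ?_
  simp only [Pi.add_apply]
  nlinarith [sq_nonneg (u x - v x)]

/-- The projection is picked by choice, so additivity comes from its uniqueness. -/
theorem l2Proj_add (hΩ : IsBoundedLipschitzDomain Ω) (hT : IsTriangulation Ω T)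
    {W : Submodule ℝ (EuclideanSpace ℝ (Fin d) → ℝ)} (hW : W ≤ feSpace Ω T)
    {u v : EuclideanSpace ℝ (Fin d) → ℝ} (hu : u ∈ feSpace Ω T) (hv : v ∈ feSpace Ω T) :
    l2Proj Ω W (u + v) = l2Proj Ω W u + l2Proj Ω W v := by
  have h1 := isL2Projection_l2Proj hΩ hT hW hu
  have h2 := isL2Projection_l2Proj hΩ hT hW hv
  refine (IsL2Projection.eq_l2Proj hΩ hT hW ((feSpace Ω T).add_mem hu hv)
    ⟨W.add_mem h1.1 h2.1, fun z hz => ?_⟩).symm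
  rw [l2Inner_add_left hΩ (hW h1.1) (hW h2.1) (hW hz), l2Inner_add_left hΩ hu hv (hW hz),
    h1.2 z hz, h2.2 z hz]

variable {V : ℕ → Submodule ℝ (EuclideanSpace ℝ (Fin d) → ℝ)} {J : ℕ}

theorem l2Slice_add (hΩ : IsBoundedLipschitzDomain Ω) (hT : IsTriangulation Ω T)
    (hV : ∀ j ≤ J, V j ≤ feSpace Ω T) {u v : EuclideanSpace ℝ (Fin d) → ℝ}
    (hu : u ∈ feSpace Ω T) (hv : v ∈ feSpace Ω T) {j : ℕ} (hj : j ≤ J) :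
    l2Slice Ω V (u + v) j = l2Slice Ω V u j + l2Slice Ω V v j := by
  cases j with
  | zero => exact l2Proj_add hΩ hT (hV 0 hj) hu hv
  | succ j =>
    simp only [l2Slice]
    rw [l2Proj_add hΩ hT (hV _ hj) hu hv, l2Proj_add hΩ hT (hV j (by omega)) hu hv]
    abel

theorem l2Slice_mem (hΩ : IsBoundedLipschitzDomain Ω) (hT : IsTriangulation Ω T)
    (hV : ∀ j ≤ J, V j ≤ feSpace Ω T) {u : EuclideanSpace ℝ (Fin d) → ℝ}
    (hu : u ∈ feSpace Ω T) {j : ℕ} (hj : j ≤ J) : l2Slice Ω V u j ∈ feSpace Ω T := by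
  have hp : ∀ i ≤ J, l2Proj Ω (V i) u ∈ feSpace Ω T := fun i hi =>
    hV i hi (isL2Projection_l2Proj hΩ hT (hV i hi) hu).1
  cases j with
  | zero => exact hp 0 hj
  | succ j => exact (feSpace Ω T).sub_mem (hp _ hj) (hp j (by omega))

/-- The slices are orthogonal. -/
theorem sum_l2Norm_l2Slice_sq (hΩ : IsBoundedLipschitzDomain Ω) (hT : IsTriangulation Ω T)
    (hV : ∀ j ≤ J, V j ≤ feSpace Ω T) (hmono : ∀ j, 1 ≤ j → j ≤ J → V (j - 1) ≤ V j)
    {u : EuclideanSpace ℝ (Fin d) → ℝ} (hu : u ∈ feSpace Ω T) :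
    ∀ n ≤ J, ∑ j ∈ Finset.range (n + 1), l2Norm Ω (l2Slice Ω V u j) ^ 2
      = l2Norm Ω (l2Proj Ω (V n) u) ^ 2 := by
  intro n
  induction n with
  | zero => intro _; simp [l2Slice]
  | succ n ih =>
    intro hn
    have h1 := isL2Projection_l2Proj hΩ hT (hV _ hn) hu
    have h0 := isL2Projection_l2Proj hΩ hT (hV n (by omega)) hu
    have hsub : V n ≤ V (n + 1) := hmono (n + 1) (by omega) hn
    -- By nestedness (Q_{n+1}u, Q_n u) = (u, Q_n u) = ‖Q_n u‖₀², so the squared norm of the new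
    -- slice is a difference of squared norms and the sum telescopes.
    rw [Finset.sum_range_succ, ih (by omega), l2Slice, l2Norm_sq, l2Norm_sq, l2Norm_sq,
      l2Inner_sub_self hΩ (hV _ hn h1.1) (hV n (by omega) h0.1), h1.2 _ (hsub h0.1),
      ← h0.2 _ h0.1]
    ring

theorem sum_l2Norm_l2Slice_sq_le (hΩ : IsBoundedLipschitzDomain Ω) (hT : IsTriangulation Ω T)
    (hV : ∀ j ≤ J, V j ≤ feSpace Ω T) (hmono : ∀ j, 1 ≤ j → j ≤ J → V (j - 1) ≤ V j)
    {u : EuclideanSpace ℝ (Fin d) → ℝ} (hu : u ∈ feSpace Ω T) :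
    ∑ j ∈ Finset.range (J + 1), l2Norm Ω (l2Slice Ω V u j) ^ 2 ≤ l2Norm Ω u ^ 2 := by
  rw [sum_l2Norm_l2Slice_sq hΩ hT hV hmono hu J le_rfl]
  have h := isL2Projection_l2Proj hΩ hT (hV J le_rfl) hu
  have h1 := l2Inner_sub_self hΩ hu (hV J le_rfl h.1)
  have h2 : 0 ≤ l2Inner Ω (u - l2Proj Ω (V J) u) (u - l2Proj Ω (V J) u) :=
    integral_nonneg fun _ => mul_self_nonneg _
  rw [← h.2 _ h.1] at h1
  rw [l2Norm_sq, l2Norm_sq]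
  linarith

end Slices

/-! ### The weight integral and the normalising constant. -/

section Interpolation

/-- The minimum switches at t = l^(-1/2). The two ranges contribute l^s / (2 − 2s) and l^s / (2s).
-/
theorem lintegral_min_rpow {l s : ℝ} (hl : 0 < l) (hs0 : 0 < s) (hs1 : s < 1) :
    ∫⁻ t in Set.Ioi (0 : ℝ), ENNReal.ofReal (t ^ (-(1 + 2 * s)) * min 1 (t ^ 2 * l))
      = ENNReal.ofReal (l ^ s / (2 * s * (1 - s))) := by
  set b : ℝ := l ^ (-(1 / 2) : ℝ)
  have hb : 0 < b := Real.rpow_pos_of_pos hl _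
  have hb2 : b ^ 2 * l = 1 := by
    rw [← Real.rpow_natCast, ← Real.rpow_mul hl.le]
    norm_num
    rw [Real.rpow_neg_one, inv_mul_cancel₀ hl.ne']
  have hsmall : ∀ t ∈ Set.Ioc 0 b, t ^ (-(1 + 2 * s)) * min 1 (t ^ 2 * l)
      = l * t ^ ((2 - 2 * s) - 1) := by
    intro t ht
    have h1 : t ^ 2 * l ≤ 1 := by
      rw [← hb2]
      have := ht.1
      have := ht.2
      gcongr
    rw [min_eq_right h1, ← mul_assoc, ← Real.rpow_natCast, ← Real.rpow_add ht.1, mul_comm]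
    congr 2
    push_cast
    ring
  have hlarge : ∀ t ∈ Set.Ioi b, t ^ (-(1 + 2 * s)) * min 1 (t ^ 2 * l) = t ^ (-(1 + 2 * s)) := by
    intro t ht
    have h1 : 1 ≤ t ^ 2 * l := by
      rw [← hb2]
      have : b ≤ t := le_of_lt ht
      gcongr
    rw [min_eq_left h1, mul_one]
  rw [← Set.Ioc_union_Ioi_eq_Ioi hb.le,
    lintegral_union measurableSet_Ioi (Set.Ioc_disjoint_Ioi le_rfl),
    setLIntegral_congr_fun measurableSet_Ioc fun t ht => by rw [hsmall t ht, ENNReal.ofReal_mul hl.le],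
    setLIntegral_congr_fun measurableSet_Ioi fun t ht => by rw [hlarge t ht],
    lintegral_const_mul' _ _ ENNReal.ofReal_ne_top, lintegral_Ioc_rpow (by linarith) hb.le,
    lintegral_Ioi_rpow (by linarith) hb, ← ENNReal.ofReal_mul hl.le,
    ← ENNReal.ofReal_add (mul_nonneg hl.le
      (div_nonneg (Real.rpow_nonneg hb.le _) (by linarith))) (by positivity)]
  congr 1
  have e1 : b ^ (2 - 2 * s) = l ^ s / l := by
    rw [← Real.rpow_mul hl.le, ← Real.rpow_sub_one hl.ne']
    congr 1; ring
  have e2 : b ^ (-(2 * s)) = l ^ s := by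
    rw [← Real.rpow_mul hl.le]
    congr 1; ring
  rw [e1, e2]
  have : 1 - s ≠ 0 := by linarith
  have : 2 - 2 * s ≠ 0 := by linarith
  field_simp
  ring

/-- Writing Γ(1 − s) = Γ(2 − s)/(1 − s) exhibits the factor s(1 − s). What remains is at least Γ(s +
d/2)/Γ(2 − s) up to the power of π, and this quotient is continuous and positive on the compact
interval [0, 1]. -/
theorem exists_le_fracLaplaceConst (d : ℕ) (hd : 1 ≤ d) :
    ∃ c > 0, ∀ s, 0 < s → s < 1 → c * (s * (1 - s)) ≤ fracLaplaceConst d s := by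
  have hd' : (0 : ℝ) < d / 2 := by
    have : (1 : ℝ) ≤ d := by exact_mod_cast hd
    linarith
  have hG : ∀ x : ℝ, 0 < x → ContinuousAt Real.Gamma x := fun x hx =>
    (Real.differentiableAt_Gamma fun m => by
      have : (0 : ℝ) ≤ m := m.cast_nonneg
      linarith).continuousAt
  have hpos : ∀ s ∈ Set.Icc (0 : ℝ) 1, 0 < Real.Gamma (s + d / 2) / Real.Gamma (2 - s) := by
    intro s hs
    have := hs.1
    have := hs.2
    exact div_pos (Real.Gamma_pos_of_pos (by linarith)) (Real.Gamma_pos_of_pos (by linarith))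
  have hcont : ContinuousOn (fun s => Real.Gamma (s + d / 2) / Real.Gamma (2 - s))
      (Set.Icc (0 : ℝ) 1) := by
    intro s hs
    have := hs.1
    have := hs.2
    refine ContinuousAt.continuousWithinAt (ContinuousAt.div ?_ ?_
      (Real.Gamma_pos_of_pos (by linarith)).ne')
    · exact ContinuousAt.comp (f := fun s : ℝ => s + d / 2) (hG _ (by linarith)) (by fun_prop)
    · exact ContinuousAt.comp (f := fun s : ℝ => 2 - s) (hG _ (by linarith)) (by fun_prop)
  obtain ⟨s₀, hs₀, hmin⟩ := isCompact_Icc.exists_isMinOn (Set.nonempty_Icc.2 zero_le_one) hcont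
  have hpi : 0 < Real.pi ^ ((d : ℝ) / 2) := Real.rpow_pos_of_pos Real.pi_pos _
  refine ⟨Real.Gamma (s₀ + d / 2) / Real.Gamma (2 - s₀) / Real.pi ^ ((d : ℝ) / 2),
    div_pos (hpos s₀ hs₀) hpi, fun s hs0 hs1 => ?_⟩
  have hm : Real.Gamma (s₀ + d / 2) / Real.Gamma (2 - s₀)
      ≤ Real.Gamma (s + d / 2) / Real.Gamma (2 - s) := hmin ⟨hs0.le, hs1.le⟩
  have hrec : Real.Gamma (2 - s) = (1 - s) * Real.Gamma (1 - s) := by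
    rw [← Real.Gamma_add_one (by linarith)]
    congr 1; ring
  have hg : 0 < Real.Gamma (1 - s) := Real.Gamma_pos_of_pos (by linarith)
  have hg2 : 0 < Real.Gamma (s + d / 2) := Real.Gamma_pos_of_pos (by linarith)
  have h1s : 0 < 1 - s := by linarith
  have h2 : (1 : ℝ) ≤ 2 ^ (2 * s) := Real.one_le_rpow one_le_two (by linarith)
  calc Real.Gamma (s₀ + d / 2) / Real.Gamma (2 - s₀) / Real.pi ^ ((d : ℝ) / 2) * (s * (1 - s))
      ≤ Real.Gamma (s + d / 2) / Real.Gamma (2 - s) / Real.pi ^ ((d : ℝ) / 2) * (s * (1 - s)) := by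
        gcongr
    _ = 1 * s * Real.Gamma (s + d / 2) / (Real.pi ^ ((d : ℝ) / 2) * Real.Gamma (1 - s)) := by
        rw [hrec]; field_simp
    _ ≤ fracLaplaceConst d s := by
        rw [fracLaplaceConst]
        gcongr

theorem fracSeminorm_sq {d : ℕ} (hd : 1 ≤ d) {s : ℝ} (hs0 : 0 < s) (hs1 : s < 1)
    (v : EuclideanSpace ℝ (Fin d) → ℝ) : fracSeminorm s v ^ 2 = fracForm s v v := by
  obtain ⟨c, hc, h⟩ := exists_le_fracLaplaceConst d hd
  have hC : 0 ≤ fracLaplaceConst d s := le_trans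
    (mul_nonneg hc.le (mul_nonneg hs0.le (by linarith))) (h s hs0 hs1)
  refine Real.sq_sqrt (mul_nonneg (by positivity) (integral_nonneg fun p => ?_))
  exact div_nonneg (mul_self_nonneg _) (Real.rpow_nonneg (norm_nonneg _) _)

/-- Allows σ to be replaced by max σ 1, so that powers of it are monotone in the exponent. -/
theorem IsShapeRegular.mono {d : ℕ} {σ σ' : ℝ}
    {T : Geometry.SimplicialComplex ℝ (EuclideanSpace ℝ (Fin d))} (h : IsShapeRegular σ T)
    (hσ : σ ≤ σ') : IsShapeRegular σ' T where
  exists_ball t ht := by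
    obtain ⟨c, r, hr, hc, hdiam⟩ := h.exists_ball t ht
    exact ⟨c, r, hr, hc, hdiam.trans (by gcongr)⟩
  comparable_of_dim_one hd t ht t' ht' hp :=
    (h.comparable_of_dim_one hd t ht t' ht' hp).trans
      (mul_le_mul_of_nonneg_right hσ Metric.diam_nonneg)

end Interpolation

end

/-! ### The s-uniform interpolation estimate. -/

theorem mainTheorem8 (d : ℕ) (hd : 1 ≤ d)
    (Ω : Set (EuclideanSpace ℝ (Fin d))) (hΩ : IsBoundedLipschitzDomain Ω)
    (σ : ℝ) (γ : ℝ) (hγ0 : 0 < γ) (hγ1 : γ < 1) (C₁ : ℝ) (hC₁ : 0 < C₁) :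
    ∃ C : ℝ, 0 < C ∧
      ∀ T : Geometry.SimplicialComplex ℝ (EuclideanSpace ℝ (Fin d)),
        IsTriangulation Ω T → IsShapeRegular σ T →
      ∀ (J : ℕ) (V : ℕ → Submodule ℝ (EuclideanSpace ℝ (Fin d) → ℝ)),
        (⨆ j ∈ Finset.range (J + 1), V j) = feSpace Ω T →
        (∀ j, 1 ≤ j → j ≤ J → V (j - 1) ≤ V j) →
        (∀ v ∈ feSpace Ω T,
          ∑ j ∈ Finset.range (J + 1), γ ^ (-(2 * (j : ℝ))) * l2Norm Ω (l2Slice Ω V v j) ^ 2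
            ≤ C₁ * h1Seminorm v ^ 2) →
        ∀ s : ℝ, 0 < s → s < 1 → ∀ v ∈ feSpace Ω T,
          ∑ j ∈ Finset.range (J + 1), γ ^ (-(2 * s * (j : ℝ))) * l2Norm Ω (l2Slice Ω V v j) ^ 2
            ≤ C * fracSeminorm s v ^ 2 := by
  obtain ⟨A, hA, happrox⟩ := exists_discrete_approximation hd hΩ (le_max_right σ 1)
  obtain ⟨c, hc, hconst⟩ := exists_le_fracLaplaceConst d hd
  -- One outer factor 2 comes from the weight 1/(2s(1 − s)), the other from the 1/2 in the seminorm.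
  -- The power of 4 bounds 4^q/q uniformly in s.
  refine ⟨2 * (2 * (1 + C₁) * A * 4 ^ (d + 2)) * 2 / c, by positivity,
    fun T hT hreg J V hsup hmono hyp s hs0 hs1 v hv => ?_⟩
  have hV : ∀ j ≤ J, V j ≤ feSpace Ω T := fun j hj => by
    rw [← hsup]
    exact le_biSup V (Finset.mem_range.2 (Nat.lt_succ_of_le hj))
  have h1s : 0 < 1 - s := by linarith
  set q : ℝ := (d : ℝ) + 2 * s
  have hd1 : (1 : ℝ) ≤ d := by exact_mod_cast hd
  have hq1 : 1 ≤ q := by simp only [q]; linarith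
  set I : ℝ := ∫ p : EuclideanSpace ℝ (Fin d) × EuclideanSpace ℝ (Fin d),
    (v p.1 - v p.2) * (v p.1 - v p.2) / ‖p.1 - p.2‖ ^ q
  have hI : 0 ≤ I := integral_nonneg fun p =>
    div_nonneg (mul_self_nonneg _) (Real.rpow_nonneg (norm_nonneg _) _)
  set l : ℕ → ℝ := fun j => γ ^ (-(2 * (j : ℝ)))
  have hl : ∀ j, 0 < l j := fun j => Real.rpow_pos_of_pos hγ0 _
  have hls : ∀ j : ℕ, γ ^ (-(2 * s * (j : ℝ))) = l j ^ s := fun j => by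
    simp only [l]
    rw [← Real.rpow_mul hγ0.le]
    congr 1; ring
  set a : ℕ → ℝ := fun j => l2Norm Ω (l2Slice Ω V v j) ^ 2
  have ha : ∀ j, 0 ≤ a j := fun j => sq_nonneg _
  -- the estimate at a fixed scale
  have hscale : ∀ t, 0 < t → ∑ j ∈ Finset.range (J + 1), min 1 (t ^ 2 * l j) * a j
      ≤ 2 * (1 + C₁) * A * ((t ^ d)⁻¹ * ∫ x, localOsc v t x) := by
    intro t ht
    obtain ⟨w, hw, hest⟩ := happrox T hT (hreg.mono (le_max_left σ 1)) v hv t ht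
    have hvw := (feSpace Ω T).sub_mem hv hw
    have h1 := sum_l2Norm_l2Slice_sq_le hΩ hT hV hmono hvw
    have h2 := hyp w hw
    have h3 : l2Norm Ω (v - w) ^ 2 = ∫ x in Ω, (v x - w x) ^ 2 := by
      rw [l2Norm_sq]
      simp only [l2Inner, Pi.sub_apply, sq]
    -- After splitting v = (v − w) + w, the minimum is bounded by 1 on the first part and by t² l_j
    -- on the second.
    have hterm : ∀ j ∈ Finset.range (J + 1), min 1 (t ^ 2 * l j) * a j
        ≤ 2 * l2Norm Ω (l2Slice Ω V (v - w) j) ^ 2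
          + 2 * t ^ 2 * (l j * l2Norm Ω (l2Slice Ω V w j) ^ 2) := by
      intro j hj
      have hjJ : j ≤ J := Nat.lt_succ_iff.1 (Finset.mem_range.1 hj)
      have hsplit := l2Norm_add_sq_le hΩ (l2Slice_mem hΩ hT hV hvw hjJ)
        (l2Slice_mem hΩ hT hV hw hjJ)
      rw [← l2Slice_add hΩ hT hV hvw hw hjJ, sub_add_cancel] at hsplit
      have hlj := hl j
      have hm0 : 0 ≤ min 1 (t ^ 2 * l j) := le_min zero_le_one (by positivity)
      calc min 1 (t ^ 2 * l j) * a j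
          ≤ min 1 (t ^ 2 * l j) * (2 * l2Norm Ω (l2Slice Ω V (v - w) j) ^ 2
            + 2 * l2Norm Ω (l2Slice Ω V w j) ^ 2) := by gcongr
        _ = min 1 (t ^ 2 * l j) * (2 * l2Norm Ω (l2Slice Ω V (v - w) j) ^ 2)
            + min 1 (t ^ 2 * l j) * (2 * l2Norm Ω (l2Slice Ω V w j) ^ 2) := by ring
        _ ≤ 1 * (2 * l2Norm Ω (l2Slice Ω V (v - w) j) ^ 2)
            + t ^ 2 * l j * (2 * l2Norm Ω (l2Slice Ω V w j) ^ 2) := by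
            gcongr
            · exact min_le_left _ _
            · exact min_le_right _ _
        _ = _ := by ring
    calc ∑ j ∈ Finset.range (J + 1), min 1 (t ^ 2 * l j) * a j
        ≤ ∑ j ∈ Finset.range (J + 1), (2 * l2Norm Ω (l2Slice Ω V (v - w) j) ^ 2
          + 2 * t ^ 2 * (l j * l2Norm Ω (l2Slice Ω V w j) ^ 2)) := Finset.sum_le_sum hterm
      _ = 2 * ∑ j ∈ Finset.range (J + 1), l2Norm Ω (l2Slice Ω V (v - w) j) ^ 2
          + 2 * t ^ 2 * ∑ j ∈ Finset.range (J + 1), l j * l2Norm Ω (l2Slice Ω V w j) ^ 2 := by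
          rw [Finset.sum_add_distrib, Finset.mul_sum, Finset.mul_sum]
      _ ≤ 2 * (∫ x in Ω, (v x - w x) ^ 2) + 2 * t ^ 2 * (C₁ * h1Seminorm w ^ 2) := by
          rw [← h3]
          gcongr
      _ ≤ 2 * (1 + C₁) * ((∫ x in Ω, (v x - w x) ^ 2) + t ^ 2 * h1Seminorm w ^ 2) := by
          have h4 : 0 ≤ ∫ x in Ω, (v x - w x) ^ 2 := integral_nonneg fun _ => sq_nonneg _
          have h5 : 0 ≤ t ^ 2 * h1Seminorm w ^ 2 := by positivity
          have h6 := mul_nonneg hC₁.le h4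
          nlinarith
      _ ≤ 2 * (1 + C₁) * (A * ((t ^ d)⁻¹ * ∫ x, localOsc v t x)) := by gcongr
      _ = _ := by ring
  -- integration over all scales
  have hint : ENNReal.ofReal (∑ j ∈ Finset.range (J + 1), a j * (l j ^ s / (2 * s * (1 - s))))
      ≤ ENNReal.ofReal (2 * (1 + C₁) * A * (4 ^ q / q * I)) := by
    rw [ENNReal.ofReal_mul (by positivity),
      ← lintegral_localOsc_eq_ofReal_integral hΩ hT hv hs0 hs1,
      ← lintegral_const_mul' _ _ ENNReal.ofReal_ne_top,
      ENNReal.ofReal_sum_of_nonneg (fun j _ => by have := hl j; have := ha j; positivity)]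
    have hmeas : ∀ j, Measurable fun t : ℝ =>
        ENNReal.ofReal (t ^ (-(1 + 2 * s)) * min 1 (t ^ 2 * l j)) := fun j =>
      ENNReal.measurable_ofReal.comp ((measurable_id.pow_const _).mul
        (measurable_const.min ((measurable_id.pow_const 2).mul_const _)))
    have heach : ∀ j ∈ Finset.range (J + 1),
        ENNReal.ofReal (a j * (l j ^ s / (2 * s * (1 - s))))
          = ∫⁻ t in Set.Ioi (0 : ℝ), ENNReal.ofReal (a j)
            * ENNReal.ofReal (t ^ (-(1 + 2 * s)) * min 1 (t ^ 2 * l j)) := fun j _ => by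
      rw [lintegral_const_mul' _ _ ENNReal.ofReal_ne_top, lintegral_min_rpow (hl j) hs0 hs1,
        ENNReal.ofReal_mul (ha j)]
    rw [Finset.sum_congr rfl heach, ← lintegral_finsetSum _ fun j _ => (hmeas j).const_mul _]
    refine setLIntegral_mono' measurableSet_Ioi fun t ht => ?_
    have ht0 : 0 < t := ht
    have htp : 0 ≤ t ^ (-(1 + 2 * s)) := Real.rpow_nonneg ht0.le _
    have hsum : ∑ j ∈ Finset.range (J + 1), ENNReal.ofReal (a j)
        * ENNReal.ofReal (t ^ (-(1 + 2 * s)) * min 1 (t ^ 2 * l j))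
        = ENNReal.ofReal (t ^ (-(1 + 2 * s))
          * ∑ j ∈ Finset.range (J + 1), min 1 (t ^ 2 * l j) * a j) := by
      rw [Finset.mul_sum, ENNReal.ofReal_sum_of_nonneg]
      · refine Finset.sum_congr rfl fun j _ => ?_
        rw [← ENNReal.ofReal_mul (ha j)]
        congr 1; ring
      · intro j _
        have := hl j
        have := ha j
        exact mul_nonneg htp (mul_nonneg (le_min zero_le_one (by positivity)) (ha j))
    rw [hsum, ← ENNReal.ofReal_mul (by positivity)]
    refine ENNReal.ofReal_le_ofReal ((mul_le_mul_of_nonneg_left (hscale t ht0) htp).trans_eq ?_)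
    -- The t^(-d) from the approximation and the weight t^(-1-2s) combine to the kernel exponent of
    -- the Gagliardo identity.
    have hpow : t ^ (-(1 + q)) = t ^ (-(1 + 2 * s)) * (t ^ d)⁻¹ := by
      rw [← Real.rpow_natCast, ← Real.rpow_neg ht0.le, ← Real.rpow_add ht0]
      congr 1
      simp only [q]; ring
    rw [hpow]
    ring
  rw [ENNReal.ofReal_le_ofReal_iff (by positivity)] at hint
  have hsum : ∑ j ∈ Finset.range (J + 1), a j * (l j ^ s / (2 * s * (1 - s)))
      = (∑ j ∈ Finset.range (J + 1), γ ^ (-(2 * s * (j : ℝ)))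
        * l2Norm Ω (l2Slice Ω V v j) ^ 2) / (2 * s * (1 - s)) := by
    rw [Finset.sum_div]
    refine Finset.sum_congr rfl fun j _ => ?_
    rw [hls]
    ring
  rw [hsum, div_le_iff₀ (by positivity)] at hint
  have h4q : (4 : ℝ) ^ q / q ≤ 4 ^ (d + 2) := by
    refine (div_le_self (by positivity) hq1).trans ?_
    rw [← Real.rpow_natCast]
    refine Real.rpow_le_rpow_of_exponent_le (by norm_num) ?_
    push_cast
    simp only [q]
    linarith
  rw [fracSeminorm_sq hd hs0 hs1, fracForm]
  calc _ ≤ 2 * (1 + C₁) * A * (4 ^ q / q * I) * (2 * s * (1 - s)) := hint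
    _ ≤ 2 * (1 + C₁) * A * (4 ^ (d + 2) * I) * (2 * s * (1 - s)) := by gcongr
    _ = 2 * (2 * (1 + C₁) * A * 4 ^ (d + 2)) * 2 / c * (c * (s * (1 - s)) / 2 * I) := by
        field_simp
    _ ≤ 2 * (2 * (1 + C₁) * A * 4 ^ (d + 2)) * 2 / c * (fracLaplaceConst d s / 2 * I) := by
        gcongr
        exact hconst s hs0 hs1
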